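/- **Setting.** Let $d,T\ge 1$ be integers, $p\in[1,\infty]$, $q=p/(p-1)$ its Hölder conjugate ($1/\infty=0$), and $D,B>0$. Write $\log=\log_2$ and $\ln=\log_e$. Let $\mathbb X_p(D)$ be the class of nonempty closed convex sets $\mathcal X\subseteq\mathbb R^d$ with $\sup_{x,y\in\mathcal X}\|x-y\|_p\le D$. For $\mathcal X\in\mathbb X_p(D)$ let $\mathcal O_{c,p}$ be the set of pairs $(f,O)$ of a convex function $f:\mathcal X\to\mathbb R$ and a stochastic first-order oracle $O$ which, queried at $x\in\mathcal X$, returns a random vector $\hat g(x)\in\mathbb R^d$ with $\mathbb E[\hat g(x)\mid x]\in\partial f(x)$ and $\|\hat g(x)\|_q\le B$ almost surely (the law of $\hat g(x)$ may depend on the round). In each of $T$ rounds an algorithm queries a point $x_t\in\mathcal X$ and selects a channel $W_t$ from a given family $\mathcal W$, both as functions of shared randomness and of the previous channel outputs; the oracle answer $\hat g(x_t)$ is passed through $W_t$ and only the output of $W_t$ is revealed. After $T$ rounds the algorithm outputs a point $x_T\in\mathcal X$. Let $\mathcal E^*(\mathcal X,T,\mathcal W)$ be the infimum over all algorithms and (adaptive)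 channel selections of $$\sup_{(f,O)\in\mathcal O_{c,p}}\mathbb E\Big[f(x_T)-\min_{x\in\mathcal X}f(x)\Big].$$ Let $\mathcal W_{{\rm com},r}$ be the family of all randomized channels $\mathbb R^d\to\{0,1\}^r$ and let $\mathcal I$ consist of the identity channel only. Put $$R(T,p)=\frac{d^{1/2-1/p}DB}{\sqrt T}\ \ (p\in[2,\infty]),\qquad R(T,p)=\frac{\sqrt{\log d}\,DB}{\sqrt T}\ \ (p\in[1,2)),$$ and, for a constant $c_1>0$, $$r^*(T,p)=\inf\Big\{r\in\{1,2,\dots\}:\ \sup_{\mathcal X\in\mathbb X_p(D)}\mathcal E^*(\mathcal X,T,\mathcal W_{{\rm com},r})\le 4c_1R(T,p)\Big\}\qquad(\inf\emptyset=\infty).$$ Let $e^{*0}=1$, $e^{*i}=e^{e^{*(i-1)}}$ for $i\ge1$, and let $\ln^*b$ be the least integer $i\ge1$ with $e^{*i}\ge b$. Put $\Delta_2=\lceil\log(1+\ln^*(d/3))\rceil$ and $\Delta_1=\big\lceil\log\big(2+\sqrt{18+6\ln\Delta_2}\;d^{1/2-1/q}\big)\big\rceil$. **Theorem.** There are absolute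 constants $0<c_0\le C_1$ such that, for every $c_1\ge C_1$ and all $d,T\geq 1$, $p\in[1,\infty]$, $D,B>0$, the following hold. (0) $c_1$ is a valid constant for the classical rate: if $p\ge2$ or $d\ge2$, then $\sup_{\mathcal X\in\mathbb X_p(D)}\mathcal E^*(\mathcal X,T,\mathcal I)\le c_1R(T,p)$. (1) If $p>2$, then $$r^*(T,p)\le d^{2/p}\log\big(2e\,d^{1-2/p}+2e\big),$$ and, if moreover $T\ge d^2/8$, $$r^*(T,p)\ge\max\Big\{\Big(\frac{c_0}{4c_1}d^{1/p}\Big)^2,\ 2\log\Big(\frac{c_0}{4c_1}d^{1/2}\Big)\Big\}.$$ (2) If $1\le p\le2$ and $d\ge2$, then $$r^*(T,p)\le d\Big(\big\lceil\log(2\sqrt2\,\Delta_1^{1/q}+2)\big\rceil+3\Big)+\Delta_2,$$ and, if moreover $T\ge d/6$, $$r^*(T,p)\ge\Big(\frac{c_0}{4c_1\sqrt{\log d}}\Big)^2 d .$$ -/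

import Mathlib

open MeasureTheory ProbabilityTheory
open scoped ENNReal

noncomputable section

namespace CommOpt

/-- The `ℓ_p` norm on `ℝ^d`, for `p ∈ [1, ∞]`. -/
def lpNorm (p : ℝ≥0∞) {d : ℕ} (x : Fin d → ℝ) : ℝ := ‖(WithLp.toLp p x : PiLp p fun _ : Fin d => ℝ)‖

/-- The Hölder conjugate `q = p / (p - 1)` of `p ∈ [1, ∞]` (so `q = ∞` for `p = 1`, and `q = 1` for
`p = ∞`). -/
def holderConj (p : ℝ≥0∞) : ℝ≥0∞ := ENNReal.conjExponent p

/-- The real number `1 / p`, which is `0` for `p = ∞`. -/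
def recip (p : ℝ≥0∞) : ℝ := (p⁻¹).toReal

/-- The optimization domains: nonempty closed convex subsets of `ℝ^d` of `ℓ_p` diameter at
most `D`. -/
def domains (d : ℕ) (p : ℝ≥0∞) (D : ℝ) : Set (Set (Fin d → ℝ)) :=
  {X | X.Nonempty ∧ IsClosed X ∧ Convex ℝ X ∧ ∀ x ∈ X, ∀ y ∈ X, lpNorm p (x - y) ≤ D}

/-- The set `∂f(x)` of subgradients at `x` of the function `f` with domain `X`. -/
def subgradients {d : ℕ} (X : Set (Fin d → ℝ)) (f : (Fin d → ℝ) → ℝ) (x : Fin d → ℝ) :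
    Set (Fin d → ℝ) :=
  {g | ∀ y ∈ X, f x + g ⬝ᵥ (y - x) ≤ f y}

/-- The pairs `(f, O)` of a convex function `f` on `X` and a first-order oracle `O` for it, whose
output is an unbiased subgradient estimate of `ℓ_q` norm at most `B` almost surely.
`O n x` is the law of the output for the query `x` in round `n` (rounds are numbered from `0`); it
may differ from round to round. Only the values of `f` on `X` matter. -/
def convexLipschitzFamily {d : ℕ} (p : ℝ≥0∞) (B : ℝ) (X : Set (Fin d → ℝ)) :
    Set (((Fin d → ℝ) → ℝ) × (ℕ → Kernel X (Fin d → ℝ))) :=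
  {fO | ConvexOn ℝ X fO.1 ∧ ∀ n, IsMarkovKernel (fO.2 n) ∧ ∀ x : X,
    (∫ g, g ∂(fO.2 n x)) ∈ subgradients X fO.1 x ∧
    ∀ᵐ g ∂(fO.2 n x), lpNorm (holderConj p) g ^ 2 ≤ B ^ 2}

/-- The family of `r`-bit communication-constrained channels `ℝ^d → {0,1}^r`. -/
def comChannels (d r : ℕ) : Set (Kernel (Fin d → ℝ) (Fin r → Bool)) :=
  {W | IsMarkovKernel W}

/-- The channel family that consists of the identity channel `ℝ^d → ℝ^d` only. -/
def idChannel (d : ℕ) : Set (Kernel (Fin d → ℝ) (Fin d → ℝ)) := {Kernel.id}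

/-- A first-order optimization algorithm over `X` with `T` queries, together with an adaptive
channel selection strategy for the channel family `𝒲` with output alphabet `𝒴`.
Both may use shared randomness: a seed with law `seed`, drawn before the first round. In round `n`
the query and the channel are functions of the seed and of the channel outputs of rounds
`0, …, n - 1`; the final point is a function of the seed and of the outputs of rounds
`0, …, T - 1`. (Rounds from `T` on are never run.) -/
structure Protocol {d : ℕ} (X : Set (Fin d → ℝ)) {𝒴 : Type} [MeasurableSpace 𝒴]
    (𝒲 : Set (Kernel (Fin d → ℝ) 𝒴)) (T : ℕ) where
  seed : Measure ℝ
  isProbabilityMeasure_seed : IsProbabilityMeasure seed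
  query : (n : ℕ) → ℝ × (Fin n → 𝒴) → X
  measurable_query : ∀ n, Measurable (query n)
  channel : (n : ℕ) → Kernel ((ℝ × (Fin n → 𝒴)) × (Fin d → ℝ)) 𝒴
  isMarkovKernel_channel : ∀ n, IsMarkovKernel (channel n)
  channel_mem : ∀ n z, (channel n).sectR z ∈ 𝒲
  output : ℝ × (Fin T → 𝒴) → X
  measurable_output : Measurable output

namespace Protocol

variable {d : ℕ} {X : Set (Fin d → ℝ)} {𝒴 : Type} [MeasurableSpace 𝒴]
  {𝒲 : Set (Kernel (Fin d → ℝ) 𝒴)} {T : ℕ}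

/-- The conditional law of the channel output of round `n`, given the seed and the earlier channel
outputs: query the oracle, then pass its answer through the selected channel. -/
def step (P : Protocol X 𝒲 T) (O : ℕ → Kernel X (Fin d → ℝ)) (n : ℕ) :
    Kernel (ℝ × (Fin n → 𝒴)) 𝒴 :=
  (P.channel n) ∘ₖ (Kernel.id ×ₖ ((O n).comap (P.query n) (P.measurable_query n)))

/-- The joint law of the seed and of the channel outputs of the first `n` rounds. -/
def law (P : Protocol X 𝒲 T) (O : ℕ → Kernel X (Fin d → ℝ)) :
    (n : ℕ) → Measure (ℝ × (Fin n → 𝒴))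
  | 0 => P.seed.map fun u => (u, Fin.elim0)
  | n + 1 => ((law P O n) ⊗ₘ (P.step O n)).map
      fun w => (w.1.1, (Fin.snoc w.1.2 w.2 : Fin (n + 1) → 𝒴))

/-- The expected optimization error `𝔼[f(x_T) - min_{x ∈ X} f(x)]`. -/
def error (P : Protocol X 𝒲 T) (f : (Fin d → ℝ) → ℝ) (O : ℕ → Kernel X (Fin d → ℝ)) : ℝ :=
  ∫ z, (f (P.output z) - ⨅ x : X, f x) ∂(P.law O T)

end Protocol

/-- The minmax optimization error over the domain `X`, for the channel family `𝒲` and `T` queries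
(with adaptive channel selection). -/
def minmaxError {d : ℕ} (p : ℝ≥0∞) (B : ℝ) (T : ℕ) {𝒴 : Type} [MeasurableSpace 𝒴]
    (𝒲 : Set (Kernel (Fin d → ℝ) 𝒴)) (X : Set (Fin d → ℝ)) : EReal :=
  ⨅ P : Protocol X 𝒲 T, ⨆ fO ∈ convexLipschitzFamily p B X, ((P.error fO.1 fO.2 : ℝ) : EReal)

/-- The worst-case value of the minmax optimization error over all domains of `ℓ_p` diameter at
most `D`. -/
def worstError {d : ℕ} (p : ℝ≥0∞) (D B : ℝ) (T : ℕ) {𝒴 : Type} [MeasurableSpace 𝒴]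
    (𝒲 : Set (Kernel (Fin d → ℝ) 𝒴)) : EReal :=
  ⨆ X ∈ domains d p D, minmaxError p B T 𝒲 X

/-- The classical convergence rate, up to a constant factor: `d^(1/2 - 1/p) D B / √T` for
`p ∈ [2, ∞]`, and `√(log₂ d) D B / √T` for `p ∈ [1, 2)`. -/
def classicRate (d T : ℕ) (p : ℝ≥0∞) (D B : ℝ) : ℝ :=
  (if 2 ≤ p then (d : ℝ) ^ (1 / 2 - recip p) else √(Real.logb 2 d)) * D * B / √T

/-- The minimum precision `r*(T, p)`: the least positive number `r` of bits for which the worst-case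
minmax error is at most `4 c₁` times the classical rate (`⊤` if there is none). -/
def minPrecision (c₁ : ℝ) (d T : ℕ) (p : ℝ≥0∞) (D B : ℝ) : EReal :=
  ⨅ (r : ℕ) (_ : 1 ≤ r ∧
    worstError p D B T (comChannels d r) ≤ ((4 * c₁ * classicRate d T p D B : ℝ) : EReal)),
    ((r : ℝ) : EReal)

/-- The tetration `e^{*i}`: `e^{*0} = 1` and `e^{*(i+1)} = e^(e^{*i})`. -/
def tetration : ℕ → ℝ
  | 0 => 1
  | i + 1 => Real.exp (tetration i)

/-- `ln^* b`, the least positive integer `i` with `e^{*i} ≥ b`. -/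
def lnStar (b : ℝ) : ℕ := sInf {i : ℕ | 1 ≤ i ∧ b ≤ tetration i}

/-- `Δ₂ = ⌈log₂ (1 + ln^*(d/3))⌉`. -/
def Delta₂ (d : ℕ) : ℕ := ⌈Real.logb 2 (1 + lnStar ((d : ℝ) / 3))⌉₊

/-- `Δ₁ = ⌈log₂ (2 + √(18 + 6 ln Δ₂) d^(1/2 - 1/q))⌉`. -/
def Delta₁ (d : ℕ) (p : ℝ≥0∞) : ℕ :=
  ⌈Real.logb 2 (2 + √(18 + 6 * Real.log (Delta₂ d)) * (d : ℝ) ^ (1 / 2 - recip (holderConj p)))⌉₊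

end CommOpt

end

/-! ### Comparison of `ℓ_p` norms and Hölder exponents. -/

namespace CommOpt

variable {d : ℕ} {p : ℝ≥0∞}

/-! Upper bounds. A fixed channel with a bounded decoder that is unbiased on the dual-norm ball of
radius `B` turns the problem into stochastic optimization with noisy gradients, which dual averaging
solves. The regularizer is the `a`-th power of the `ℓ_a` distance to a point of the domain, with `1
< a ≤ 2`. Its uniform convexity (`dotProduct_sub_le`) yields a potential whose drift controls the
regret (`exists_potential`, `integral_querySum_le`), and `minmaxError_le` gives an error of order
`√(1/(a-1)) ρ G / √T`, for `ℓ_a` diameter `ρ` and dual second moment `G²`. For `p ≥ 2` take `a = 2`.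
For `p < 2` take `a = max p (1 + 1/log₂ d)`, so that `1/(a-1) ≤ log₂ d` while the change of dual
norm costs only a factor 2.

The quantizer divides the gradient by a scale `s` and rounds it to an integer vector, all
coordinates sharing one uniform offset. This is unbiased, moves each coordinate by at most `s`, and
keeps the `ℓ_1` norm of the integer vector at most `k` with certainty. Such vectors are multisets of
size `k` over `2d + 1` symbols, hence need about `log₂ C(2d+k, k)` bits. For `p > 2`, `k` of order
`d^(2/p)` keeps the second moment of order `B²`. For `p ≤ 2`, `k = d` works and costs at most `3d`
bits, already below the claimed bound.

Lower bounds. Assouad's method is applied to the linear functions `κ⟨v, x⟩`, `v` a sign vector, on a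
cube. The channel outputs form an adaptive tree; the affinity between the output laws of
neighbouring sign vectors decreases in each round by at most the Hellinger distance of that round
(`le_sum_affinity`), so it suffices to bound the latter at every node. Two oracles are used. One
reveals a single random biased coordinate, and a channel with `2^r` outputs then gains at most `4δ²
2^r / d` per round (`sum_sqrt_singleProb_le`). The other has independent biased signs in all
coordinates; a level-one inequality and the entropy bound limit the gain to `64 δ² r ln 2`
(`sum_sqrt_signProb_le`). Comparing the two error bounds with `4c₁` times the classical rate gives
the logarithmic bound and the polynomial bounds on `r`. -/

theorem recip_eq (p : ℝ≥0∞) : recip p = p.toReal⁻¹ := by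
  simp [recip, ENNReal.toReal_inv]

theorem recip_nonneg (p : ℝ≥0∞) : 0 ≤ recip p := ENNReal.toReal_nonneg

theorem recip_top : recip ∞ = 0 := by simp [recip]

theorem one_le_holderConj (p : ℝ≥0∞) : 1 ≤ holderConj p := by
  simp [holderConj, ENNReal.conjExponent]

theorem recip_add_recip_holderConj (hp : 1 ≤ p) : recip p + recip (holderConj p) = 1 := by
  have h : p.HolderConjugate (holderConj p) := ENNReal.HolderConjugate.conjExponent hp
  have h1 := h.inv_add_inv_eq_one
  rw [recip, recip, ← ENNReal.toReal_add, h1, ENNReal.toReal_one]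
  · exact ENNReal.inv_ne_top.2 (by positivity)
  · exact ENNReal.inv_ne_top.2 (zero_lt_one.trans_le (one_le_holderConj p)).ne'

theorem recip_le_recip {p q : ℝ≥0∞} (hp : 1 ≤ p) (h : p ≤ q) : recip q ≤ recip p :=
  ENNReal.toReal_mono (ENNReal.inv_ne_top.2 (by positivity)) (ENNReal.inv_le_inv.2 h)

theorem recip_two : recip 2 = 1 / 2 := by simp [recip_eq]

theorem lpNorm_nonneg (hp : 1 ≤ p) (x : Fin d → ℝ) : 0 ≤ lpNorm p x := by
  have : Fact (1 ≤ p) := ⟨hp⟩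
  exact norm_nonneg _

theorem lpNorm_add_le (hp : 1 ≤ p) (x y : Fin d → ℝ) :
    lpNorm p (x + y) ≤ lpNorm p x + lpNorm p y := by
  have : Fact (1 ≤ p) := ⟨hp⟩
  simpa [lpNorm] using norm_add_le (WithLp.toLp p x : PiLp p fun _ : Fin d => ℝ) (WithLp.toLp p y)

theorem abs_apply_le_lpNorm (hp : 1 ≤ p) (x : Fin d → ℝ) (i : Fin d) : |x i| ≤ lpNorm p x := by
  have : Fact (1 ≤ p) := ⟨hp⟩
  simpa [lpNorm] using PiLp.norm_apply_le (WithLp.toLp p x : PiLp p fun _ : Fin d => ℝ) i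

theorem continuous_lpNorm (hp : 1 ≤ p) : Continuous (lpNorm p : (Fin d → ℝ) → ℝ) := by
  have : Fact (1 ≤ p) := ⟨hp⟩
  exact continuous_norm.comp (PiLp.continuous_toLp p _)

theorem lpNorm_single (hp : 1 ≤ p) (i : Fin d) (c : ℝ) :
    lpNorm p (Pi.single i c) = |c| := by
  have : Fact (1 ≤ p) := ⟨hp⟩
  simp [lpNorm]

theorem lpNorm_eq_sum (hp : 1 ≤ p) (hp' : p ≠ ∞) (x : Fin d → ℝ) :
    lpNorm p x = (∑ i, |x i| ^ p.toReal) ^ (p.toReal⁻¹) := by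
  have := PiLp.norm_eq_sum (p := p) (β := fun _ : Fin d => ℝ)
    (ENNReal.toReal_pos (by positivity) hp') (WithLp.toLp p x)
  simpa [lpNorm] using this

theorem lpNorm_rpow (hp : 1 ≤ p) (hp' : p ≠ ∞) (x : Fin d → ℝ) :
    lpNorm p x ^ p.toReal = ∑ i, |x i| ^ p.toReal := by
  have h0 : 0 < p.toReal := ENNReal.toReal_pos (by positivity) hp'
  rw [lpNorm_eq_sum hp hp', ← Real.rpow_mul (by positivity), inv_mul_cancel₀ h0.ne', Real.rpow_one]

theorem lpNorm_top (x : Fin d → ℝ) : lpNorm ∞ x = ⨆ i, |x i| := by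
  have := PiLp.norm_eq_ciSup (β := fun _ : Fin d => ℝ) (WithLp.toLp ∞ x)
  simpa [lpNorm] using this

theorem lpNorm_le_of_abs_le (hp : 1 ≤ p) {x : Fin d → ℝ} {c : ℝ} (hc : 0 ≤ c)
    (h : ∀ i, |x i| ≤ c) : lpNorm p x ≤ (d : ℝ) ^ recip p * c := by
  by_cases hp' : p = ∞
  · subst hp'
    rw [lpNorm_top, recip_top, Real.rpow_zero, one_mul]
    exact Real.iSup_le h hc
  · have h0 : 0 < p.toReal := ENNReal.toReal_pos (by positivity) hp'
    rw [lpNorm_eq_sum hp hp', recip_eq]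
    calc (∑ i, |x i| ^ p.toReal) ^ (p.toReal⁻¹)
        ≤ (∑ _i : Fin d, c ^ p.toReal) ^ (p.toReal⁻¹) := by
          gcongr with i
          exact h i
      _ = _ := by
          rw [Finset.sum_const, Finset.card_univ, Fintype.card_fin, nsmul_eq_mul,
            Real.mul_rpow (by positivity) (by positivity), ← Real.rpow_mul hc,
            mul_inv_cancel₀ h0.ne', Real.rpow_one]

/-- The `ℓ_a` norm is at most the `ℓ_p` norm for `p ≤ a`. -/
theorem sum_rpow_le_of_le (hp : 1 ≤ p) {a : ℝ} (hpa : p ≤ ENNReal.ofReal a) {x : Fin d → ℝ} {D : ℝ}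
    (hx : lpNorm p x ≤ D) : ∑ i, |x i| ^ a ≤ D ^ a := by
  have hp' : p ≠ ∞ := ne_top_of_le_ne_top ENNReal.ofReal_ne_top hpa
  have h0 : 0 < p.toReal := ENNReal.toReal_pos (by positivity) hp'
  have hD : 0 ≤ D := (lpNorm_nonneg hp x).trans hx
  have ha0 : 0 ≤ a := by
    by_contra h
    rw [ENNReal.ofReal_of_nonpos (by linarith)] at hpa
    exact absurd (hp.trans hpa) (by simp)
  have hpa' : p.toReal ≤ a := ENNReal.toReal_le_of_le_ofReal ha0 hpa
  have key : ∀ i, |x i| ^ a ≤ D ^ (a - p.toReal) * |x i| ^ p.toReal := fun i => by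
    have h1 : |x i| ^ a = |x i| ^ (a - p.toReal) * |x i| ^ p.toReal := by
      rw [← Real.rpow_add_of_nonneg (abs_nonneg _) (by linarith) h0.le]; ring_nf
    rw [h1]
    gcongr
    · exact (abs_apply_le_lpNorm hp x i).trans hx
  calc ∑ i, |x i| ^ a ≤ ∑ i, D ^ (a - p.toReal) * |x i| ^ p.toReal :=
        Finset.sum_le_sum fun i _ => key i
    _ = D ^ (a - p.toReal) * lpNorm p x ^ p.toReal := by rw [← Finset.mul_sum, lpNorm_rpow hp hp']
    _ ≤ D ^ (a - p.toReal) * D ^ p.toReal := by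
        have := lpNorm_nonneg hp x
        gcongr
    _ = D ^ a := by rw [← Real.rpow_add_of_nonneg hD (by linarith) h0.le]; ring_nf

/-- The `ℓ_b` norm is at most `d ^ (1 / b - 1 / q)` times the `ℓ_q` norm for `b ≤ q`. -/
theorem sum_rpow_le_of_ge (hp : 1 ≤ p) {b : ℝ} (hb : 1 ≤ b) (hbp : ENNReal.ofReal b ≤ p)
    {x : Fin d → ℝ} {D : ℝ} (hx : lpNorm p x ≤ D) :
    ∑ i, |x i| ^ b ≤ (d : ℝ) ^ (1 - b * recip p) * D ^ b := by
  have hD : 0 ≤ D := (lpNorm_nonneg hp x).trans hx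
  rcases Nat.eq_zero_or_pos d with rfl | hd
  · simp only [Finset.univ_eq_empty, Finset.sum_empty]; positivity
  have hd' : (0 : ℝ) < d := by exact_mod_cast hd
  by_cases hp' : p = ∞
  · subst hp'
    rw [recip_top, mul_zero, sub_zero, Real.rpow_one]
    calc ∑ i, |x i| ^ b ≤ ∑ _i : Fin d, D ^ b := by
          gcongr with i
          exact (abs_apply_le_lpNorm hp x i).trans hx
      _ = _ := by simp
  · have h0 : 0 < p.toReal := ENNReal.toReal_pos (by positivity) hp'
    have hbp' : b ≤ p.toReal := by
      rw [← ENNReal.ofReal_le_iff_le_toReal hp']; exact hbp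
    have hb0 : 0 < b := by linarith
    set t := p.toReal / b with ht
    have ht1 : 1 ≤ t := by rw [ht, one_le_div hb0]; exact hbp'
    have h1 := Real.rpow_arith_mean_le_arith_mean_rpow Finset.univ (fun _ : Fin d => (d : ℝ)⁻¹)
      (fun i => |x i| ^ b) (by intros; positivity)
      (by simp [hd'.ne']) (by intros; positivity) ht1
    simp only [← Finset.mul_sum] at h1
    have h2 : ∀ i, (|x i| ^ b) ^ t = |x i| ^ p.toReal := fun i => by
      rw [← Real.rpow_mul (abs_nonneg _), ht, mul_div_cancel₀ _ hb0.ne']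
    simp only [h2] at h1
    rw [← lpNorm_rpow hp hp'] at h1
    set S := ∑ i, |x i| ^ b with hS
    have hS0 : 0 ≤ S := by positivity
    have h3 : ((d : ℝ)⁻¹ * S) ≤ ((d : ℝ)⁻¹ * D ^ p.toReal) ^ t⁻¹ := by
      rw [Real.le_rpow_inv_iff_of_pos (by positivity) (by positivity) (by linarith)]
      refine h1.trans ?_
      have := lpNorm_nonneg hp x
      gcongr
    have h4 : ((d : ℝ)⁻¹ * D ^ p.toReal) ^ t⁻¹ = (d : ℝ) ^ (- (b * recip p)) * D ^ b := by
      rw [Real.mul_rpow (by positivity) (by positivity), ← Real.rpow_mul hD, ← Real.rpow_neg_one,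
        ← Real.rpow_mul hd'.le, recip_eq, ht, inv_div]
      congr 2
      · field_simp
      · field_simp
    rw [h4] at h3
    have h5 : S = d * ((d : ℝ)⁻¹ * S) := by field_simp
    rw [h5]
    calc d * ((d : ℝ)⁻¹ * S) ≤ d * ((d : ℝ) ^ (- (b * recip p)) * D ^ b) := by gcongr
      _ = _ := by
        rw [sub_eq_add_neg, Real.rpow_add hd', Real.rpow_one]; ring

/-- The `ℓ_1` norm is at most `d ^ (1 / p)` times the dual norm of the `ℓ_p` norm. -/
theorem sum_abs_le (hp : 1 ≤ p) {g : Fin d → ℝ} {B : ℝ} (hg : lpNorm (holderConj p) g ≤ B) :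
    ∑ i, |g i| ≤ (d : ℝ) ^ recip p * B := by
  have h := sum_rpow_le_of_ge (one_le_holderConj p) (b := 1) le_rfl
    (by simpa using one_le_holderConj p) hg
  simp only [Real.rpow_one, one_mul] at h
  rwa [← eq_sub_of_add_eq (recip_add_recip_holderConj hp)] at h

end CommOpt

/-! ### Uniform convexity of `ℓ_a` powers and the dual averaging potential. -/

namespace CommOpt

variable {d : ℕ}

/-- The derivative of `|z| ^ a / a - (a - 1) M ^ (a - 2) z ^ 2 / 2` is monotone on `[0, M]`. -/
theorem rpow_sub_mul_le_of_le {c M s t : ℝ} (hc : 0 < c) (hc1 : c ≤ 1) (hs : 0 ≤ s) (hst : s ≤ t)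
    (htM : t ≤ M) : s ^ c - c * M ^ (c - 1) * s ≤ t ^ c - c * M ^ (c - 1) * t := by
  rcases (hs.trans hst).eq_or_lt with h | ht
  · obtain rfl : s = t := le_antisymm hst (h ▸ hs)
    rfl
  -- Bernoulli's inequality at `s / t`: the concave function `z ^ c` lies below its tangent at `t`,
  -- whose slope is at least the slope at `M`.
  have h1 := rpow_one_add_le_one_add_mul_self (s := s / t - 1) (p := c)
    (by have : 0 ≤ s / t := by positivity
        linarith) hc.le hc1
  rw [add_sub_cancel, Real.div_rpow hs ht.le, div_le_iff₀ (by positivity)] at h1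
  have h2 : (1 + c * (s / t - 1)) * t ^ c = t ^ c - c * t ^ (c - 1) * (t - s) := by
    rw [Real.rpow_sub_one ht.ne']; field_simp; ring
  have h3 : M ^ (c - 1) ≤ t ^ (c - 1) := Real.rpow_le_rpow_of_nonpos ht htM (by linarith)
  have h4 : c * M ^ (c - 1) * (t - s) ≤ c * t ^ (c - 1) * (t - s) := by
    have : 0 ≤ t - s := by linarith
    gcongr
  linarith

/-- As `a ≤ 2`, the second derivative of `|z| ^ a` is smallest at the ends of `[-M, M]`. Subtracting
the quadratic with that second derivative leaves a convex function `ψ`, and its midpoint convexity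
is the claim. Monotonicity of `ψ'` replaces the second derivative, which may fail to exist at 0. -/
theorem abs_rpow_midpoint_le {a M x y : ℝ} (ha : 1 < a) (ha2 : a ≤ 2) (hx : |x| ≤ M) (hy : |y| ≤ M) :
    |(x + y) / 2| ^ a ≤ (|x| ^ a + |y| ^ a) / 2 - a * (a - 1) / 8 * M ^ (a - 2) * (x - y) ^ 2 := by
  set ψ : ℝ → ℝ := fun z => |z| ^ a - a * (a - 1) / 2 * M ^ (a - 2) * z ^ 2 with hψ
  have hder : ∀ z, HasDerivAt ψ (a * (|z| ^ (a - 2) * z - (a - 1) * M ^ (a - 1 - 1) * z)) z := by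
    intro z
    have h1 := (hasDerivAt_abs_rpow z ha).sub
      (((hasDerivAt_id z).pow 2).const_mul (a * (a - 1) / 2 * M ^ (a - 2)))
    refine h1.congr_deriv ?_
    rw [show a - 1 - 1 = a - 2 by ring]
    simp
    ring
  have habs : ∀ z : ℝ, 0 ≤ z → |z| ^ (a - 2) * z = z ^ (a - 1) := by
    intro z hz
    rcases hz.eq_or_lt with rfl | hz
    · rw [mul_zero, Real.zero_rpow (by linarith)]
    · rw [abs_of_pos hz, ← Real.rpow_add_one hz.ne']; ring_nf
  have hmono : MonotoneOn (fun z => a * (|z| ^ (a - 2) * z - (a - 1) * M ^ (a - 1 - 1) * z))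
      (Set.Icc (-M) M) := by
    intro s hs t ht hst
    have hc : 0 < a - 1 := by linarith
    have hc1 : a - 1 ≤ 1 := by linarith
    have key : ∀ z : ℝ, z ≤ 0 → |z| ^ (a - 2) * z = -((-z) ^ (a - 1)) := by
      intro z hz
      rw [← habs (-z) (by linarith), abs_neg]; ring
    refine mul_le_mul_of_nonneg_left ?_ (by linarith)
    rcases le_total 0 s with h0 | h0
    · rw [habs s h0, habs t (h0.trans hst)]
      exact rpow_sub_mul_le_of_le hc hc1 h0 hst ht.2
    · rcases le_total 0 t with h1 | h1
      · rw [key s h0, habs t h1]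
        have e1 := rpow_sub_mul_le_of_le hc hc1 le_rfl h1 ht.2
        have e2 := rpow_sub_mul_le_of_le (s := 0) (t := -s) (M := M) hc hc1 le_rfl (by linarith)
          (by linarith [hs.1])
        rw [Real.zero_rpow hc.ne'] at e1 e2
        linarith
      · rw [key s h0, key t h1]
        have e2 := rpow_sub_mul_le_of_le (s := -t) (t := -s) (M := M) hc hc1 (by linarith)
          (by linarith) (by linarith [hs.1])
        linarith
  have hconv : ConvexOn ℝ (Set.Icc (-M) M) ψ := by
    have hd : Differentiable ℝ ψ := fun z => (hder z).differentiableAt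
    refine MonotoneOn.convexOn_of_deriv (convex_Icc _ _) hd.continuous.continuousOn
      hd.differentiableOn ?_
    have : deriv ψ = _ := funext fun z => (hder z).deriv
    rw [this]
    exact hmono.mono interior_subset
  have h := hconv.2 (abs_le.1 hx) (abs_le.1 hy) (half_pos one_pos).le (half_pos one_pos).le
    (add_halves (1 : ℝ))
  simp only [smul_eq_mul, hψ] at h
  rw [show 1 / 2 * x + 1 / 2 * y = (x + y) / 2 by ring] at h
  nlinarith [h]

/-- Hölder's inequality, with the exponents `b / 2` and `a / (2 - a)` for `b = a / (a - 1)`. -/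
theorem sum_sq_mul_rpow_le {a : ℝ} (ha : 1 < a) (ha2 : a ≤ 2) (h M : Fin d → ℝ)
    (hM : ∀ i, 0 ≤ M i) :
    ∑ i, h i ^ 2 * M i ^ (2 - a) ≤
      (∑ i, |h i| ^ (a / (a - 1))) ^ (2 * (a - 1) / a) * (∑ i, M i ^ a) ^ ((2 - a) / a) := by
  have ha0 : 0 < a := by linarith
  have hsq : ∀ i, |h i| ^ (2 : ℝ) = h i ^ 2 := fun i => by
    rw [Real.rpow_two, sq_abs]
  rcases ha2.eq_or_lt with rfl | ha2
  · norm_num [hsq]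
  have hc : 0 < a - 1 := by linarith
  have hc' : 0 < 2 - a := by linarith
  have hpq : (a / (2 * (a - 1))).HolderConjugate (a / (2 - a)) := by
    rw [Real.holderConjugate_iff]
    constructor
    · rw [lt_div_iff₀ (by positivity)]; linarith
    · field_simp; ring
  have := Real.inner_le_Lp_mul_Lq Finset.univ (fun i => h i ^ 2) (fun i => M i ^ (2 - a)) hpq
  refine this.trans (le_of_eq ?_)
  congr 1
  · congr 1
    · refine Finset.sum_congr rfl fun i _ => ?_
      rw [abs_of_nonneg (sq_nonneg _), ← hsq, ← Real.rpow_mul (abs_nonneg _)]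
      congr 1; field_simp
    · field_simp
  · congr 1
    · refine Finset.sum_congr rfl fun i _ => ?_
      rw [abs_of_nonneg (Real.rpow_nonneg (hM i) _), ← Real.rpow_mul (hM i)]
      congr 1; field_simp
    · field_simp

/-- The square of the norm dual to the `ℓ_a` norm. -/
noncomputable def dualNormSq (a : ℝ) (h : Fin d → ℝ) : ℝ :=
  (∑ i, |h i| ^ (a / (a - 1))) ^ (2 * (a - 1) / a)

theorem dualNormSq_nonneg (a : ℝ) (h : Fin d → ℝ) : 0 ≤ dualNormSq a h := by
  unfold dualNormSq; positivity

theorem dualNormSq_smul {a : ℝ} (ha : 1 < a) (η : ℝ) (h : Fin d → ℝ) :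
    dualNormSq a (η • h) = η ^ 2 * dualNormSq a h := by
  have hc : 0 < a - 1 := by linarith
  have : 0 < a := by linarith
  unfold dualNormSq
  simp only [Pi.smul_apply, smul_eq_mul, abs_mul]
  simp only [Real.mul_rpow (abs_nonneg _) (abs_nonneg _), ← Finset.mul_sum]
  rw [Real.mul_rpow (by positivity) (by positivity), ← Real.rpow_mul (abs_nonneg _),
    show a / (a - 1) * (2 * (a - 1) / a) = 2 by field_simp, Real.rpow_two, sq_abs]

theorem dualNormSq_le {a : ℝ} (ha : 1 < a) (h : Fin d → ℝ) :
    dualNormSq a h ≤ (d : ℝ) ^ (2 * (a - 1) / a) * ‖h‖ ^ 2 := by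
  have hc : 0 < a - 1 := by linarith
  have : 0 < a := by linarith
  calc dualNormSq a h ≤ (∑ _i : Fin d, ‖h‖ ^ (a / (a - 1))) ^ (2 * (a - 1) / a) := by
        unfold dualNormSq
        gcongr with i
        exact norm_le_pi_norm h i
    _ = _ := by
        rw [Finset.sum_const, Finset.card_univ, Fintype.card_fin, nsmul_eq_mul,
          Real.mul_rpow (by positivity) (by positivity), ← Real.rpow_mul (norm_nonneg _),
          show a / (a - 1) * (2 * (a - 1) / a) = 2 by field_simp, Real.rpow_two]

theorem continuous_dualNormSq {a : ℝ} (ha : 1 < a) :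
    Continuous (dualNormSq a : (Fin d → ℝ) → ℝ) := by
  have hc : 0 < a - 1 := by linarith
  have h1 : 0 ≤ a / (a - 1) := by positivity
  have h2 : 0 ≤ 2 * (a - 1) / a := by positivity
  unfold dualNormSq
  fun_prop (disch := simp [h1, h2])

/-- Uniform convexity of `x ↦ ∑ i, |x i| ^ a / ρ ^ a` on the `ℓ_a` ball of radius `ρ`. -/
theorem dotProduct_sub_le {a ρ : ℝ} (ha : 1 < a) (ha2 : a ≤ 2) (hρ : 0 < ρ) {x y : Fin d → ℝ}
    (hx : ∑ i, |x i| ^ a ≤ ρ ^ a) (hy : ∑ i, |y i| ^ a ≤ ρ ^ a) (h : Fin d → ℝ) :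
    h ⬝ᵥ (x - y) ≤ (∑ i, |x i| ^ a) / ρ ^ a + (∑ i, |y i| ^ a) / ρ ^ a
      - 2 * ((∑ i, |(x i + y i) / 2| ^ a) / ρ ^ a) + 2 * ρ ^ 2 / (a - 1) * dualNormSq a h := by
  have hc : 0 < a - 1 := by linarith
  have ha0 : 0 < a := by linarith
  -- The convexity modulus is taken at the scale of each coordinate rather than at `ρ`; Hölder's
  -- inequality then recombines the weights `M i ^ (2 - a)` into the dual norm without a dimension
  -- factor.
  set M : Fin d → ℝ := fun i => max |x i| |y i| with hM
  have hM0 : ∀ i, 0 ≤ M i := fun i => (abs_nonneg _).trans (le_max_left _ _)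
  have hMsum : ∑ i, M i ^ a ≤ 2 * ρ ^ a := by
    calc ∑ i, M i ^ a ≤ ∑ i, (|x i| ^ a + |y i| ^ a) := by
          refine Finset.sum_le_sum fun i _ => ?_
          rcases max_choice |x i| |y i| with h | h <;> simp only [hM, h]
          · have : 0 ≤ |y i| ^ a := by positivity
            linarith
          · have : 0 ≤ |x i| ^ a := by positivity
            linarith
      _ ≤ 2 * ρ ^ a := by rw [Finset.sum_add_distrib]; linarith
  have hρa : 0 < ρ ^ a := by positivity
  have key : ∀ i, h i * (x i - y i) ≤ (|x i| ^ a + |y i| ^ a - 2 * |(x i + y i) / 2| ^ a) / ρ ^ a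
      + ρ ^ a / (a - 1) * (h i ^ 2 * M i ^ (2 - a)) := by
    intro i
    have h1 := abs_rpow_midpoint_le ha ha2 (le_max_left |x i| |y i|) (le_max_right |x i| |y i|)
    change _ ≤ _ - _ * M i ^ (a - 2) * _ at h1
    rcases (hM0 i).eq_or_lt with h0 | h0
    · have hx0 : x i = 0 := abs_nonpos_iff.1 (h0 ▸ le_max_left |x i| |y i|)
      have hy0 : y i = 0 := abs_nonpos_iff.1 (h0 ▸ le_max_right |x i| |y i|)
      have : 0 ≤ ρ ^ a / (a - 1) * (h i ^ 2 * M i ^ (2 - a)) := by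
        have := hM0 i
        positivity
      simp [hx0, hy0, Real.zero_rpow ha0.ne'] at this ⊢
      exact this
    · set δ := x i - y i
      have h2 : a * (a - 1) / 4 * M i ^ (a - 2) * δ ^ 2 / ρ ^ a ≤
          (|x i| ^ a + |y i| ^ a - 2 * |(x i + y i) / 2| ^ a) / ρ ^ a := by
        gcongr
        linarith
      set m := M i ^ (a - 2) with hm
      have hm0 : 0 < m := by positivity
      have h3 : M i ^ (2 - a) = m⁻¹ := by
        rw [hm, ← Real.rpow_neg h0.le]; ring_nf
      -- Young's inequality, proved by completing the square, splits `h i * δ` into the convexity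
      -- gain and a quadratic cost in `h i`.
      have h4 : h i * δ ≤ a * (a - 1) / 4 * m * δ ^ 2 / ρ ^ a
          + ρ ^ a / (a * (a - 1)) * (h i ^ 2 * m⁻¹) := by
        have : a * (a - 1) / 4 * m * δ ^ 2 / ρ ^ a
          + ρ ^ a / (a * (a - 1)) * (h i ^ 2 * m⁻¹) - h i * δ =
            (a * (a - 1) * m * δ / 2 - ρ ^ a * h i) ^ 2 / (ρ ^ a * (a * (a - 1)) * m) := by
          field_simp; ring
        have h5 : 0 ≤ (a * (a - 1) * m * δ / 2 - ρ ^ a * h i) ^ 2 / (ρ ^ a * (a * (a - 1)) * m) := by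
          positivity
        linarith
      have h5 : ρ ^ a / (a * (a - 1)) * (h i ^ 2 * m⁻¹) ≤ ρ ^ a / (a - 1) * (h i ^ 2 * m⁻¹) := by
        gcongr
        nlinarith
      rw [h3]
      linarith
  have hsum := Finset.sum_le_sum fun i (_ : i ∈ Finset.univ) => key i
  have hholder := sum_sq_mul_rpow_le ha ha2 h M hM0
  have hlast : ρ ^ a / (a - 1) * ∑ i, h i ^ 2 * M i ^ (2 - a) ≤
      2 * ρ ^ 2 / (a - 1) * dualNormSq a h := by
    have e1 : (∑ i, M i ^ a) ^ ((2 - a) / a) ≤ 2 * ρ ^ (2 - a) := by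
      have e0 : 0 ≤ (2 - a) / a := div_nonneg (by linarith) ha0.le
      calc (∑ i, M i ^ a) ^ ((2 - a) / a) ≤ (2 * ρ ^ a) ^ ((2 - a) / a) := by
            gcongr
        _ = 2 ^ ((2 - a) / a) * ρ ^ (2 - a) := by
            rw [Real.mul_rpow (by norm_num) hρa.le, ← Real.rpow_mul hρ.le, mul_div_cancel₀ _ ha0.ne']
        _ ≤ 2 ^ (1 : ℝ) * ρ ^ (2 - a) := by
            gcongr
            · norm_num
            · rw [div_le_one ha0]; linarith
        _ = _ := by rw [Real.rpow_one]
    calc ρ ^ a / (a - 1) * ∑ i, h i ^ 2 * M i ^ (2 - a)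
        ≤ ρ ^ a / (a - 1) * (dualNormSq a h * (2 * ρ ^ (2 - a))) := by
          have := dualNormSq_nonneg a h
          gcongr
          exact hholder.trans (by unfold dualNormSq at *; gcongr)
      _ = 2 * (ρ ^ a * ρ ^ (2 - a)) / (a - 1) * dualNormSq a h := by ring
      _ = _ := by rw [← Real.rpow_add hρ]; norm_num
  simp only [Finset.sum_add_distrib, ← Finset.sum_div, Finset.sum_sub_distrib, ← Finset.mul_sum] at hsum
  calc h ⬝ᵥ (x - y) = ∑ i, h i * (x i - y i) := rfl
    _ ≤ _ := hsum
    _ ≤ _ := by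
      rw [sub_div, add_div, mul_div_assoc]
      linarith

theorem dotProduct_le_norm_mul_norm (h x : Fin d → ℝ) : h ⬝ᵥ x ≤ d * ‖h‖ * ‖x‖ := by
  calc h ⬝ᵥ x = ∑ i, h i * x i := rfl
    _ ≤ ∑ _i : Fin d, ‖h‖ * ‖x‖ := by
      refine Finset.sum_le_sum fun i _ => (le_abs_self _).trans ?_
      rw [abs_mul]
      exact mul_le_mul (norm_le_pi_norm h i) (norm_le_pi_norm x i) (abs_nonneg _) (norm_nonneg _)
    _ = _ := by simp [mul_assoc]

/-- The potential `Φ θ = min_{x ∈ X} (R x + ⟨θ, x⟩)` of dual averaging with a strongly convex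
regularizer `R`, and the minimizer `A θ`. -/
theorem exists_potential {X : Set (Fin d → ℝ)} (hX : IsCompact X) (hne : X.Nonempty)
    (hconv : Convex ℝ X) {R S : (Fin d → ℝ) → ℝ} {L : ℝ} (hL : 0 < L) (hR : ContinuousOn R X)
    (hR0 : ∀ x ∈ X, 0 ≤ R x) (hR1 : ∀ x ∈ X, R x ≤ 1) (hS : ∀ h, S h ≤ L * ‖h‖ ^ 2)
    (hsc : ∀ x ∈ X, ∀ y ∈ X, ∀ h,
      h ⬝ᵥ (x - y) ≤ R x + R y - 2 * R ((1 / 2 : ℝ) • x + (1 / 2 : ℝ) • y) + S h) :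
    ∃ (A : (Fin d → ℝ) → X) (Φ : (Fin d → ℝ) → ℝ), Continuous A ∧ Continuous Φ ∧ 0 ≤ Φ 0 ∧
      (∀ θ, ∀ x ∈ X, Φ θ ≤ 1 + θ ⬝ᵥ x) ∧
      ∀ θ h, Φ θ + h ⬝ᵥ (A θ : Fin d → ℝ) ≤ Φ (θ + h) + S h := by
  have hmin : ∀ θ : Fin d → ℝ, ∃ x : X, ∀ y ∈ X, R x + θ ⬝ᵥ (x : Fin d → ℝ) ≤ R y + θ ⬝ᵥ y := by
    intro θ
    obtain ⟨x, hx, hx'⟩ := hX.exists_isMinOn hne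
      (f := fun x => R x + θ ⬝ᵥ x) (hR.add (by fun_prop))
    exact ⟨⟨x, hx⟩, hx'⟩
  choose A hA using hmin
  have hmid : ∀ x ∈ X, ∀ y ∈ X, (1 / 2 : ℝ) • x + (1 / 2 : ℝ) • y ∈ X := fun x hx y hy =>
    hconv hx hy (by norm_num) (by norm_num) (by norm_num)
  -- strong convexity at the minimizer
  have hgap : ∀ θ, ∀ y ∈ X, ∀ h, R (A θ) + θ ⬝ᵥ (A θ : Fin d → ℝ) + h ⬝ᵥ ((A θ : Fin d → ℝ) - y) ≤
      R y + θ ⬝ᵥ y + S h := by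
    intro θ y hy h
    have h1 := hsc _ (A θ).2 y hy h
    have h2 := hA θ _ (hmid _ (A θ).2 y hy)
    rw [dotProduct_add, dotProduct_smul, dotProduct_smul] at h2
    simp only [smul_eq_mul] at h2
    linarith
  -- Taking `h = δ / (2L)` in `hgap` optimizes `h ⬝ᵥ δ - L ‖h‖²` and turns it into quadratic growth
  -- around the minimizer.
  have hgap' : ∀ θ, ∀ y ∈ X, R (A θ) + θ ⬝ᵥ (A θ : Fin d → ℝ) + ‖(A θ : Fin d → ℝ) - y‖ ^ 2 / (4 * L) ≤
      R y + θ ⬝ᵥ y := by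
    intro θ y hy
    set δ := (A θ : Fin d → ℝ) - y with hδ
    have h1 := hgap θ y hy ((1 / (2 * L)) • δ)
    have h2 := hS ((1 / (2 * L)) • δ)
    rw [norm_smul, Real.norm_of_nonneg (by positivity)] at h2
    rw [smul_dotProduct, smul_eq_mul] at h1
    have h3 : ‖δ‖ ^ 2 ≤ δ ⬝ᵥ δ := by
      by_cases hδ0 : ‖δ‖ = 0
      · rw [hδ0, norm_eq_zero.1 hδ0]; simp
      rw [← Real.le_sqrt' (lt_of_le_of_ne (norm_nonneg _) (Ne.symm hδ0))]
      refine (pi_norm_le_iff_of_nonneg (Real.sqrt_nonneg _)).2 fun i => ?_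
      refine Real.le_sqrt_of_sq_le ?_
      rw [Real.norm_eq_abs, sq_abs, sq]
      exact Finset.single_le_sum (f := fun i => δ i * δ i) (fun i _ => mul_self_nonneg _)
        (Finset.mem_univ i)
    have h4 : 1 / (2 * L) * ‖δ‖ ^ 2 ≤ 1 / (2 * L) * (δ ⬝ᵥ δ) := by gcongr
    have h5 : L * (1 / (2 * L) * ‖δ‖) ^ 2 = ‖δ‖ ^ 2 / (4 * L) := by field_simp; ring
    have h6 : 1 / (2 * L) * ‖δ‖ ^ 2 = ‖δ‖ ^ 2 / (4 * L) + ‖δ‖ ^ 2 / (4 * L) := by field_simp; ring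
    linarith
  -- Adding the quadratic growth at the minimizers for `θ` and `θ'` makes `A` Lipschitz; continuity
  -- is what makes the queries measurable.
  have hcont : Continuous fun θ => (A θ : Fin d → ℝ) := by
    have : LipschitzWith (2 * L * d).toNNReal fun θ => (A θ : Fin d → ℝ) := by
      refine LipschitzWith.of_dist_le_mul fun θ θ' => ?_
      rw [dist_eq_norm, dist_eq_norm, Real.coe_toNNReal _ (by positivity)]
      have h1 := hgap' θ _ (A θ').2
      have h2 := hgap' θ' _ (A θ).2
      rw [norm_sub_rev] at h2
      set δ := (A θ : Fin d → ℝ) - A θ' with hδ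
      have h3 : ‖δ‖ ^ 2 / (2 * L) ≤ (θ' - θ) ⬝ᵥ δ := by
        rw [hδ, dotProduct_sub, sub_dotProduct, sub_dotProduct]
        have : ‖δ‖ ^ 2 / (2 * L) = ‖δ‖ ^ 2 / (4 * L) + ‖δ‖ ^ 2 / (4 * L) := by field_simp; ring
        linarith
      have h4 := h3.trans (dotProduct_le_norm_mul_norm _ _)
      rw [norm_sub_rev θ' θ, div_le_iff₀ (by positivity)] at h4
      rcases (norm_nonneg δ).eq_or_lt with h0 | h0
      · rw [← h0]; positivity
      · refine le_of_mul_le_mul_right ?_ h0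
        nlinarith
    exact this.continuous
  have hcontA : Continuous A := continuous_induced_rng.2 hcont
  refine ⟨A, fun θ => R (A θ) + θ ⬝ᵥ (A θ : Fin d → ℝ), hcontA, ?_, ?_, ?_, ?_⟩
  · exact ((continuousOn_iff_continuous_domRestrict.1 hR).comp hcontA).add (by fun_prop)
  · simpa using hR0 _ (A 0).2
  · intro θ x hx
    have := hA θ x hx
    have := hR1 x hx
    linarith
  · intro θ h
    have := hgap θ _ (A (θ + h)).2 h
    simp only [dotProduct_sub, add_dotProduct] at this ⊢
    linarith

end CommOpt

/-! ### Laws of protocols and the expected regret of dual averaging. -/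

namespace CommOpt

variable {d : ℕ} {p : ℝ≥0∞}

namespace Protocol

variable {X : Set (Fin d → ℝ)} {𝒴 : Type} [MeasurableSpace 𝒴]
  {𝒲 : Set (Kernel (Fin d → ℝ) 𝒴)} {T : ℕ}

instance isMarkovKernel_step (P : Protocol X 𝒲 T) (O : ℕ → Kernel X (Fin d → ℝ))
    [∀ n, IsMarkovKernel (O n)] (n : ℕ) : IsMarkovKernel (P.step O n) := by
  have := P.isMarkovKernel_channel n
  unfold step
  infer_instance

theorem measurable_snoc (n : ℕ) : Measurable
    fun w : (ℝ × (Fin n → 𝒴)) × 𝒴 => (w.1.1, (Fin.snoc w.1.2 w.2 : Fin (n + 1) → 𝒴)) := by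
  refine measurable_fst.fst.prodMk (measurable_pi_iff.2 fun i => ?_)
  refine Fin.lastCases ?_ (fun j => ?_) i
  · simpa using measurable_snd
  · simpa [Function.comp_def] using (measurable_pi_apply j).comp measurable_fst.snd

instance isProbabilityMeasure_law (P : Protocol X 𝒲 T) (O : ℕ → Kernel X (Fin d → ℝ))
    [∀ n, IsMarkovKernel (O n)] (n : ℕ) : IsProbabilityMeasure (P.law O n) := by
  induction n with
  | zero =>
    have := P.isProbabilityMeasure_seed
    exact Measure.isProbabilityMeasure_map (by fun_prop)
  | succ n ih => exact Measure.isProbabilityMeasure_map (measurable_snoc n).aemeasurable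

theorem integral_law_zero (P : Protocol X 𝒲 T) (O : ℕ → Kernel X (Fin d → ℝ))
    {F : ℝ × (Fin 0 → 𝒴) → ℝ} (hF : Measurable F) :
    ∫ z, F z ∂(P.law O 0) = ∫ u, F (u, Fin.elim0) ∂P.seed := by
  rw [law, integral_map (by fun_prop) hF.aestronglyMeasurable]

theorem integral_law_succ (P : Protocol X 𝒲 T) (O : ℕ → Kernel X (Fin d → ℝ))
    [∀ n, IsMarkovKernel (O n)] (n : ℕ) {F : ℝ × (Fin (n + 1) → 𝒴) → ℝ} (hF : Measurable F)
    {C : ℝ} (hC : ∀ z, |F z| ≤ C) :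
    ∫ z, F z ∂(P.law O (n + 1)) =
      ∫ w, ∫ y, F (w.1, (Fin.snoc w.2 y : Fin (n + 1) → 𝒴)) ∂(P.step O n w) ∂(P.law O n) := by
  rw [law, integral_map (measurable_snoc n).aemeasurable hF.aestronglyMeasurable,
    Measure.integral_compProd]
  exact .of_bound (hF.comp (measurable_snoc n)).aestronglyMeasurable C (ae_of_all _ fun _ => hC _)

theorem integral_step (P : Protocol X 𝒲 T) (O : ℕ → Kernel X (Fin d → ℝ))
    [∀ n, IsMarkovKernel (O n)] (n : ℕ) (w : ℝ × (Fin n → 𝒴)) {h : 𝒴 → ℝ} (hh : Measurable h)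
    {C : ℝ} (hC : ∀ y, |h y| ≤ C) :
    ∫ y, h y ∂(P.step O n w) = ∫ g, ∫ y, h y ∂(P.channel n (w, g)) ∂(O n (P.query n w)) := by
  have := P.isMarkovKernel_channel n
  rw [step, Kernel.integral_comp, Kernel.prod_apply, Kernel.id_apply, Kernel.comap_apply,
    Measure.dirac_prod, integral_map (by fun_prop)]
  · exact hh.stronglyMeasurable.integral_kernel.aestronglyMeasurable
  · exact .of_bound hh.aestronglyMeasurable C (ae_of_all _ fun _ => hC _)

end Protocol

theorem integral_dotProduct {α : Type*} [MeasurableSpace α] {μ : Measure α} {φ : α → Fin d → ℝ}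
    (hφ : Integrable φ μ) (v : Fin d → ℝ) : ∫ z, φ z ⬝ᵥ v ∂μ = (∫ z, φ z ∂μ) ⬝ᵥ v := by
  have h : ∀ i, Integrable (fun z => φ z i) μ := fun i => hφ.eval i
  simp only [dotProduct]
  rw [integral_finsetSum _ fun i _ => (h i).mul_const _]
  simp only [integral_mul_const, eval_integral h]

theorem domains_isCompact {D : ℝ} {X : Set (Fin d → ℝ)} (hp : 1 ≤ p) (hX : X ∈ domains d p D) :
    IsCompact X := by
  obtain ⟨⟨x, hx⟩, hcl, -, hD⟩ := hX
  refine Metric.isCompact_of_isClosed_isBounded hcl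
    (Metric.isBounded_iff.2 ⟨D, fun y hy z hz => ?_⟩)
  have h0 : 0 ≤ D := (lpNorm_nonneg hp _).trans (hD y hy z hz)
  rw [dist_eq_norm]
  exact (pi_norm_le_iff_of_nonneg h0).2 fun i =>
    (abs_apply_le_lpNorm hp (y - z) i).trans (hD y hy z hz)

section Family

variable {B : ℝ} {X : Set (Fin d → ℝ)} {fO : ((Fin d → ℝ) → ℝ) × (ℕ → Kernel X (Fin d → ℝ))}

theorem ae_lpNorm_le (hB : 0 < B) (h : fO ∈ convexLipschitzFamily p B X) (n : ℕ) (x : X) :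
    ∀ᵐ g ∂(fO.2 n x), lpNorm (holderConj p) g ≤ B := by
  filter_upwards [((h.2 n).2 x).2] with g hg
  exact le_of_sq_le_sq hg hB.le

theorem integrable_oracle (hB : 0 < B) (h : fO ∈ convexLipschitzFamily p B X) (n : ℕ) (x : X) :
    Integrable (fun g => g) (fO.2 n x) := by
  have := (h.2 n).1
  refine .of_bound measurable_id.aestronglyMeasurable B ?_
  filter_upwards [ae_lpNorm_le hB h n x] with g hg
  exact (pi_norm_le_iff_of_nonneg hB.le).2 fun i =>
    (abs_apply_le_lpNorm (one_le_holderConj p) g i).trans hg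

/-- Convexity alone gives no continuity at the boundary of `X`. Here every point of `X` has a
subgradient, the mean oracle answer, with entries at most `B`; applied at both points this makes the
function Lipschitz. -/
theorem continuousOn_of_mem_family (hB : 0 < B) (h : fO ∈ convexLipschitzFamily p B X) :
    ContinuousOn fO.1 X := by
  have key : ∀ x ∈ X, ∀ y ∈ X, fO.1 x - fO.1 y ≤ d * B * ‖x - y‖ := by
    intro x hx y hy
    have := (h.2 0).1
    have hsub := ((h.2 0).2 ⟨x, hx⟩).1 y hy
    set m := ∫ g, g ∂(fO.2 0 ⟨x, hx⟩)
    have hm : ‖m‖ ≤ B := by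
      have := norm_integral_le_of_norm_le_const (μ := fO.2 0 ⟨x, hx⟩) (f := fun g => g) (C := B) (by
        filter_upwards [ae_lpNorm_le hB h 0 ⟨x, hx⟩] with g hg
        exact (pi_norm_le_iff_of_nonneg hB.le).2 fun i =>
          (abs_apply_le_lpNorm (one_le_holderConj p) g i).trans hg)
      simpa using this
    have h1 : m ⬝ᵥ (x - y) ≤ d * B * ‖x - y‖ := (dotProduct_le_norm_mul_norm _ _).trans (by gcongr)
    rw [dotProduct_sub] at h1 hsub
    linarith
  have hd : (0 : ℝ) ≤ d * B := by positivity
  have : LipschitzOnWith (d * B).toNNReal fO.1 X := by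
    refine LipschitzOnWith.of_dist_le_mul fun x hx y hy => ?_
    rw [Real.coe_toNNReal _ hd, Real.dist_eq, dist_eq_norm, abs_le']
    refine ⟨key x hx y hy, ?_⟩
    have := key y hy x hx
    rw [norm_sub_rev] at this
    linarith
  exact this.continuousOn

end Family

section DualAveraging

variable {X : Set (Fin d → ℝ)} {𝒴 : Type} [MeasurableSpace 𝒴]

/-- The dual averaging protocol: round `n` queries the image under `A` of the sum of the decoded
outputs of the earlier rounds, and all channels equal `W`. The output is the average query. -/
noncomputable def dualAveraging (hconv : Convex ℝ X) {𝒲 : Set (Kernel (Fin d → ℝ) 𝒴)}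
    {W : Kernel (Fin d → ℝ) 𝒴} (hW : W ∈ 𝒲) [IsMarkovKernel W] {dec : 𝒴 → Fin d → ℝ}
    (hdec : Measurable dec) {A : (Fin d → ℝ) → X} (hA : Measurable A) (T : ℕ) (hT : 1 ≤ T) :
    Protocol X 𝒲 T where
  -- Shared randomness is not needed: all randomness of the quantizer sits inside the channel.
  seed := Measure.dirac 0
  isProbabilityMeasure_seed := inferInstance
  query n z := A (∑ t, dec (z.2 t))
  measurable_query n := by fun_prop
  channel n := Kernel.prodMkLeft _ W
  isMarkovKernel_channel n := inferInstance
  channel_mem n z := by rwa [Kernel.sectR_prodMkLeft]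
  output z := ⟨∑ t : Fin T, (T : ℝ)⁻¹ • (A (∑ s : Fin t, dec (z.2 (s.castLE t.2.le))) : Fin d → ℝ),
    hconv.sum_mem (fun _ _ => by positivity)
      (by simp [show (T : ℝ) ≠ 0 by positivity]) fun _ _ => (A _).2⟩
  measurable_output := by
    refine Measurable.subtype_mk (Finset.measurable_sum _ fun t _ => ?_)
    refine (measurable_subtype_coe.comp (hA.comp ?_)).const_smul (T : ℝ)⁻¹
    exact Finset.measurable_sum _ fun s _ =>
      hdec.comp ((measurable_pi_apply _).comp measurable_snd)

/-- The sum of `φ` over the queries of the dual averaging protocol. -/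
noncomputable def querySum {𝒴 : Type} (dec : 𝒴 → Fin d → ℝ) (A : (Fin d → ℝ) → X) (φ : X → ℝ) (n : ℕ)
    (y : Fin n → 𝒴) : ℝ :=
  ∑ t : Fin n, φ (A (∑ s : Fin t, dec (y (s.castLE t.2.le))))

theorem querySum_snoc {𝒴 : Type} (dec : 𝒴 → Fin d → ℝ) (A : (Fin d → ℝ) → X) (φ : X → ℝ) (n : ℕ)
    (y : Fin n → 𝒴) (b : 𝒴) :
    querySum dec A φ (n + 1) (Fin.snoc y b : Fin (n + 1) → 𝒴) =
      querySum dec A φ n y + φ (A (∑ s, dec (y s))) := by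
  have h : ∀ (m : ℕ) (hm : m ≤ n) (s : Fin m),
      (Fin.snoc y b : Fin (n + 1) → 𝒴) (s.castLE (hm.trans n.le_succ)) = y (s.castLE hm) :=
    fun m hm s => Fin.snoc_castSucc (α := fun _ => 𝒴) b y (s.castLE hm)
  rw [querySum, Fin.sum_univ_castSucc]
  congr 1
  · refine Finset.sum_congr rfl fun t _ => ?_
    congr 2
    exact Finset.sum_congr rfl fun s _ => by rw [← h _ t.2.le]
  · congr 2
    exact Finset.sum_congr rfl fun s _ => congrArg dec (h n le_rfl s)

theorem measurable_querySum {dec : 𝒴 → Fin d → ℝ} (hdec : Measurable dec)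
    {A : (Fin d → ℝ) → X} (hA : Measurable A) {φ : X → ℝ} (hφ : Measurable φ) (n : ℕ) :
    Measurable (querySum dec A φ n) := by
  refine Finset.measurable_sum _ fun t _ => hφ.comp (hA.comp ?_)
  exact Finset.measurable_sum _ fun s _ => hdec.comp (measurable_pi_apply _)

theorem abs_querySum_le {𝒴 : Type} (dec : 𝒴 → Fin d → ℝ) (A : (Fin d → ℝ) → X) {φ : X → ℝ} {C : ℝ}
    (hφ : ∀ x, |φ x| ≤ C) (n : ℕ) (y : Fin n → 𝒴) : |querySum dec A φ n y| ≤ n * C := by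
  refine (Finset.abs_sum_le_sum_abs _ _).trans ?_
  refine (Finset.sum_le_sum fun t _ => hφ _).trans ?_
  simp

/-- The expected regret of dual averaging with unbiased gradient estimates. -/
theorem integral_querySum_le {B : ℝ} (hB : 0 < B)
    {fO : ((Fin d → ℝ) → ℝ) × (ℕ → Kernel X (Fin d → ℝ))} (h : fO ∈ convexLipschitzFamily p B X)
    (hX : IsCompact X) (hconv : Convex ℝ X) {𝒲 : Set (Kernel (Fin d → ℝ) 𝒴)}
    {W : Kernel (Fin d → ℝ) 𝒴} (hW : W ∈ 𝒲) [IsMarkovKernel W] {dec : 𝒴 → Fin d → ℝ}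
    (hdec : Measurable dec) {M : ℝ} (hM : ∀ y, ‖dec y‖ ≤ M) {A : (Fin d → ℝ) → X}
    (hA : Continuous A) {T : ℕ} (hT : 1 ≤ T) {Φ : (Fin d → ℝ) → ℝ} (hΦ : Continuous Φ)
    (hΦ0 : 0 ≤ Φ 0) (hΦ1 : ∀ θ, ∀ x ∈ X, Φ θ ≤ 1 + θ ⬝ᵥ x) {S : (Fin d → ℝ) → ℝ}
    (hS : Continuous S)
    (hstep : ∀ θ h, Φ θ + h ⬝ᵥ (A θ : Fin d → ℝ) ≤ Φ (θ + h) + S h) {η σ : ℝ} (hη : 0 ≤ η)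
    (hmean : ∀ g, lpNorm (holderConj p) g ≤ B → ∫ y, dec y ∂(W g) = η • g)
    (hvar : ∀ g, lpNorm (holderConj p) g ≤ B → ∫ y, S (dec y) ∂(W g) ≤ σ) {x : Fin d → ℝ}
    (hx : x ∈ X) (n : ℕ) :
    η * ∫ z, querySum dec A (fun w => fO.1 w - fO.1 x) n z.2
      ∂((dualAveraging hconv hW hdec hA.measurable T hT).law fO.2 n) ≤ 1 + n * σ := by
  set P := dualAveraging hconv hW hdec hA.measurable T hT with hP
  have hMk : ∀ n, IsMarkovKernel (fO.2 n) := fun n => (h.2 n).1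
  have hf := continuousOn_of_mem_family hB h
  set φ : X → ℝ := fun w => fO.1 w - fO.1 x with hφ
  have hφc : Continuous φ :=
    (continuousOn_iff_continuous_domRestrict.1 hf).sub continuous_const
  obtain ⟨C₀, hC₀⟩ := hX.exists_bound_of_continuousOn hf
  have hφb : ∀ w, |φ w| ≤ C₀ + C₀ := fun w =>
    (abs_sub _ _).trans (add_le_add (hC₀ _ w.2) (hC₀ _ hx))
  have hbdd : ∀ K, ∃ C, ∀ θ : Fin d → ℝ, ‖θ‖ ≤ K → |Φ θ - θ ⬝ᵥ x| ≤ C := by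
    intro K
    obtain ⟨C, hC⟩ := (isCompact_closedBall (0 : Fin d → ℝ) K).exists_bound_of_continuousOn
      (f := fun θ => Φ θ - θ ⬝ᵥ x) (by fun_prop)
    exact ⟨C, fun θ hθ => hC θ (by simpa using hθ)⟩
  have hθ : ∀ n (y : Fin n → 𝒴), ‖∑ t, dec (y t)‖ ≤ n * M := fun n y => by
    refine (norm_sum_le _ _).trans ((Finset.sum_le_sum fun t _ => hM _).trans ?_)
    simp
  obtain ⟨CS, hCS⟩ := (isCompact_closedBall (0 : Fin d → ℝ) M).exists_bound_of_continuousOn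
      (f := S) hS.continuousOn
  -- the potential of the analysis
  set gap : (n : ℕ) → ℝ × (Fin n → 𝒴) → ℝ := fun n z =>
    (Φ (∑ t, dec (z.2 t)) - (∑ t, dec (z.2 t)) ⬝ᵥ x) - η * querySum dec A φ n z.2 with hgap
  have hgapm : ∀ n, Measurable (gap n) := by
    intro n
    have h1 : Measurable fun z : ℝ × (Fin n → 𝒴) => ∑ t, dec (z.2 t) := by fun_prop
    have h2 : Continuous fun θ : Fin d → ℝ => Φ θ - θ ⬝ᵥ x := by fun_prop
    exact (h2.measurable.comp h1).sub
      (((measurable_querySum hdec hA.measurable hφc.measurable n).comp measurable_snd).const_mul _)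
  have hgapb : ∀ n, ∃ C, ∀ z, |gap n z| ≤ C := by
    intro n
    obtain ⟨C, hC⟩ := hbdd (n * M)
    refine ⟨C + η * (n * (C₀ + C₀)), fun z => (abs_sub _ _).trans (add_le_add (hC _ (hθ n _)) ?_)⟩
    rw [abs_mul, abs_of_nonneg hη]
    exact mul_le_mul_of_nonneg_left (abs_querySum_le dec A hφb n z.2) hη
  have hgap_int : ∀ n, Integrable (gap n) (P.law fO.2 n) := fun n => by
    obtain ⟨C, hC⟩ := hgapb n
    exact .of_bound (hgapm n).aestronglyMeasurable C (ae_of_all _ hC)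
  have hmain : ∀ n, 0 ≤ ∫ z, gap n z ∂(P.law fO.2 n) + n * σ := by
    intro n
    induction n with
    | zero =>
      rw [P.integral_law_zero _ (hgapm 0)]
      simp [hgap, querySum, hP, dualAveraging, hΦ0]
    | succ n ih =>
      obtain ⟨C, hC⟩ := hgapb (n + 1)
      rw [P.integral_law_succ _ n (hgapm _) hC]
      -- One round lowers the conditional expectation of the gap by at most `σ`: the mean decoded
      -- vector is `η` times a subgradient, and its inner product with `A θ - x` pays for the new
      -- term `η * φ (A θ)` of the regret.
      have hlow : ∀ w, gap n w - σ ≤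
          ∫ y, gap (n + 1) (w.1, (Fin.snoc w.2 y : Fin (n + 1) → 𝒴)) ∂(P.step fO.2 n w) := by
        intro w
        set θ := ∑ t, dec (w.2 t) with hθdef
        have hq : P.query n w = A θ := rfl
        have hmeas : Measurable fun y => gap (n + 1) (w.1, (Fin.snoc w.2 y : Fin (n + 1) → 𝒴)) :=
          (hgapm _).comp ((Protocol.measurable_snoc n).comp measurable_prodMk_left)
        rw [P.integral_step fO.2 n w hmeas fun y => hC _, hq]
        have hpt : ∀ y, gap n w - η * φ (A θ) + dec y ⬝ᵥ ((A θ : Fin d → ℝ) - x) - S (dec y) ≤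
            gap (n + 1) (w.1, (Fin.snoc w.2 y : Fin (n + 1) → 𝒴)) := by
          intro y
          have h1 := hstep θ (dec y)
          simp only [hgap, querySum_snoc, Fin.sum_univ_castSucc, Fin.snoc_castSucc, Fin.snoc_last,
            ← hθdef]
          rw [dotProduct_sub, add_dotProduct]
          linarith
        have hinner : ∀ g, lpNorm (holderConj p) g ≤ B →
            gap n w - η * φ (A θ) - σ + η * (g ⬝ᵥ ((A θ : Fin d → ℝ) - x)) ≤
            ∫ y, gap (n + 1) (w.1, (Fin.snoc w.2 y : Fin (n + 1) → 𝒴)) ∂(P.channel n (w, g)) := by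
          intro g hg
          have hch : P.channel n (w, g) = W g := rfl
          rw [hch]
          have hdi : Integrable dec (W g) := .of_bound hdec.aestronglyMeasurable M (ae_of_all _ hM)
          have hi1 : Integrable (fun y => dec y ⬝ᵥ ((A θ : Fin d → ℝ) - x)) (W g) := by
            simp only [dotProduct]
            exact integrable_finsetSum _ fun i _ => (hdi.eval i).mul_const _
          have hi2 : Integrable (fun y => S (dec y)) (W g) :=
            .of_bound (hS.measurable.comp hdec).aestronglyMeasurable CS
              (ae_of_all _ fun y => hCS _ (by simpa using hM y))
          calc _ ≤ ∫ y, (gap n w - η * φ (A θ) + dec y ⬝ᵥ ((A θ : Fin d → ℝ) - x) - S (dec y))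
                ∂(W g) := by
                rw [integral_sub (f := fun y => gap n w - η * φ (A θ) + dec y ⬝ᵥ
                    ((A θ : Fin d → ℝ) - x)) ((integrable_const _).add hi1) hi2,
                  integral_add (integrable_const _) hi1, integral_dotProduct hdi, hmean g hg,
                  smul_dotProduct, smul_eq_mul]
                have := hvar g hg
                simp only [integral_const, probReal_univ, one_smul]
                linarith
            _ ≤ _ := by
                refine integral_mono (((integrable_const _).add hi1).sub hi2) ?_ hpt
                exact .of_bound hmeas.aestronglyMeasurable C (ae_of_all _ fun y => hC _)
        have hgi := integrable_oracle hB h n (A θ)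
        have hi1 : Integrable (fun g => g ⬝ᵥ ((A θ : Fin d → ℝ) - x)) (fO.2 n (A θ)) := by
          simp only [dotProduct]
          exact integrable_finsetSum _ fun i _ => (hgi.eval i).mul_const _
        have hsub := ((h.2 n).2 (A θ)).1 x hx
        have hMc := P.isMarkovKernel_channel n
        calc gap n w - σ ≤ ∫ g, (gap n w - η * φ (A θ) - σ + η * (g ⬝ᵥ ((A θ : Fin d → ℝ) - x)))
              ∂(fO.2 n (A θ)) := by
              rw [integral_add (integrable_const _) (hi1.const_mul _), integral_const_mul,
                integral_dotProduct hgi]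
              simp only [integral_const, probReal_univ, one_smul, hφ]
              rw [dotProduct_sub] at hsub ⊢
              nlinarith
          _ ≤ _ := by
              refine integral_mono_ae ((integrable_const _).add (hi1.const_mul _)) ?_ ?_
              · refine .of_bound (C := C) ?_ (ae_of_all _ fun g => ?_)
                · have : StronglyMeasurable fun z : (ℝ × (Fin n → 𝒴)) × (Fin d → ℝ) =>
                    ∫ y, gap (n + 1) (w.1, (Fin.snoc w.2 y : Fin (n + 1) → 𝒴)) ∂(P.channel n z) :=
                    hmeas.stronglyMeasurable.integral_kernel
                  exact (this.comp_measurable measurable_prodMk_left).aestronglyMeasurable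
                · refine (norm_integral_le_of_norm_le_const (ae_of_all _ fun y => hC _)).trans ?_
                  simp
              · filter_upwards [ae_lpNorm_le hB h n (A θ)] with g hg using hinner g hg
      have hmono : ∫ w, (gap n w - σ) ∂(P.law fO.2 n) ≤ ∫ w, ∫ y,
          gap (n + 1) (w.1, (Fin.snoc w.2 y : Fin (n + 1) → 𝒴)) ∂(P.step fO.2 n w) ∂(P.law fO.2 n) := by
        refine integral_mono ((hgap_int n).sub (integrable_const _)) ?_ hlow
        refine .of_bound (C := C) ?_ (ae_of_all _ fun g => ?_)
        · exact (StronglyMeasurable.integral_kernel_prod_right'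
            (f := fun z : (ℝ × (Fin n → 𝒴)) × 𝒴 =>
              gap (n + 1) (z.1.1, (Fin.snoc z.1.2 z.2 : Fin (n + 1) → 𝒴)))
            ((hgapm _).comp (Protocol.measurable_snoc n)).stronglyMeasurable).aestronglyMeasurable
        · refine (norm_integral_le_of_norm_le_const (ae_of_all _ fun y => hC _)).trans ?_
          simp
      rw [integral_sub (hgap_int n) (integrable_const _)] at hmono
      simp only [integral_const, probReal_univ, one_smul] at hmono
      push_cast
      linarith
  have hqi : Integrable (fun z : ℝ × (Fin n → 𝒴) => querySum dec A φ n z.2) (P.law fO.2 n) :=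
    .of_bound ((measurable_querySum hdec hA.measurable hφc.measurable n).comp
      measurable_snd).aestronglyMeasurable _ (ae_of_all _ fun z => abs_querySum_le dec A hφb n z.2)
  -- The potential at the cumulative vector is at most `1` plus its inner product with `x`, so the
  -- gap bounds the regret from above.
  have hle : ∫ z, gap n z ∂(P.law fO.2 n) ≤ ∫ z, (1 - η * querySum dec A φ n z.2) ∂(P.law fO.2 n) := by
    refine integral_mono (hgap_int n) ((integrable_const _).sub (hqi.const_mul _)) fun z => ?_
    have := hΦ1 (∑ t, dec (z.2 t)) x hx
    simp only [hgap]
    linarith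
  rw [integral_sub (integrable_const _) (hqi.const_mul _), integral_const_mul] at hle
  simp only [integral_const, probReal_univ, one_smul] at hle
  have := hmain n
  linarith

end DualAveraging

/-- Upper bound on the minmax error from an unbiased decoder of a fixed channel, when `X` has `ℓ_a`
diameter at most `ρ` and the second moment of the decoder in the dual norm is at most `G ^ 2`. -/
theorem minmaxError_le {D B : ℝ} (hp : 1 ≤ p) (hB : 0 < B) {X : Set (Fin d → ℝ)}
    (hX : X ∈ domains d p D) {𝒴 : Type} [MeasurableSpace 𝒴] {𝒲 : Set (Kernel (Fin d → ℝ) 𝒴)}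
    {W : Kernel (Fin d → ℝ) 𝒴} (hW : W ∈ 𝒲) [IsMarkovKernel W] {dec : 𝒴 → Fin d → ℝ}
    (hdec : Measurable dec) {M : ℝ} (hM : ∀ y, ‖dec y‖ ≤ M) {T : ℕ} (hT : 1 ≤ T)
    (hmean : ∀ g, lpNorm (holderConj p) g ≤ B → ∫ y, dec y ∂(W g) = g)
    {a ρ G : ℝ} (ha : 1 < a) (ha2 : a ≤ 2) (hρ : 0 < ρ) (hG : 0 < G)
    (hρX : ∀ x ∈ X, ∀ y ∈ X, ∑ i, |x i - y i| ^ a ≤ ρ ^ a)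
    (hvar : ∀ g, lpNorm (holderConj p) g ≤ B → ∫ y, dualNormSq a (dec y) ∂(W g) ≤ G ^ 2) :
    minmaxError p B T 𝒲 X ≤ ((2 * √(2 / (a - 1)) * ρ * G / √T : ℝ) : EReal) := by
  have hc : 0 < a - 1 := by linarith
  have ha0 : 0 < a := by linarith
  have hT0 : (0 : ℝ) < T := by exact_mod_cast hT
  have hcomp := domains_isCompact hp hX
  obtain ⟨hne, hcl, hconv, hD⟩ := hX
  obtain ⟨x₀, hx₀⟩ := hne
  set c := 2 * ρ ^ 2 / (a - 1) with hcdef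
  have hc0 : 0 < c := by positivity
  -- Centring at a point of `X` makes the diameter bound give `R ≤ 1` on `X`. In the next step the
  -- summand `1` in `L` keeps it positive even for `d = 0`.
  set R : (Fin d → ℝ) → ℝ := fun x => (∑ i, |x i - x₀ i| ^ a) / ρ ^ a with hR
  have hRc : Continuous R := by
    simp only [hR]
    fun_prop (disch := simp [ha0.le])
  obtain ⟨A, Φ, hA, hΦ, hΦ0, hΦ1, hstep⟩ := exists_potential (X := X) hcomp ⟨x₀, hx₀⟩ hconv
    (R := R) (S := fun h => c * dualNormSq a h) (L := c * ((d : ℝ) ^ (2 * (a - 1) / a) + 1))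
    (by positivity) hRc.continuousOn
    (fun x _ => by positivity)
    (fun x hx => by
      simp only [hR]
      rw [div_le_one (by positivity)]
      exact hρX x hx x₀ hx₀)
    (fun h => by
      rw [mul_assoc]
      refine mul_le_mul_of_nonneg_left ((dualNormSq_le ha h).trans ?_) hc0.le
      gcongr
      linarith)
    (fun x hx y hy h => by
      have := dotProduct_sub_le ha ha2 hρ (x := x - x₀) (y := y - x₀)
        (by simpa using hρX x hx x₀ hx₀) (by simpa using hρX y hy x₀ hx₀) h
      simp only [sub_sub_sub_cancel_right, Pi.sub_apply] at this
      have e : ∀ i, (x i - x₀ i + (y i - x₀ i)) / 2 =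
          ((1 / 2 : ℝ) • x + (1 / 2 : ℝ) • y) i - x₀ i := fun i => by
        simp; ring
      simp only [e] at this
      exact this)
  -- This step size makes the total variance term `T c η² G²` equal to 1, the same as the range of
  -- the regularizer, so the regret is at most `2 / η`.
  set η := 1 / (√c * G * √T) with hη
  have hη0 : 0 < η := by positivity
  have hdec' : Measurable fun y => η • dec y := hdec.const_smul η
  refine iInf_le_of_le (dualAveraging hconv hW hdec' hA.measurable T hT) ?_
  refine iSup₂_le fun fO hfO => EReal.coe_le_coe_iff.2 ?_
  have hMk : ∀ n, IsMarkovKernel (fO.2 n) := fun n => (hfO.2 n).1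
  have hf := continuousOn_of_mem_family hB hfO
  obtain ⟨x, hx, hxmin⟩ := hcomp.exists_isMinOn ⟨x₀, hx₀⟩ hf
  have hinf : ⨅ w : X, fO.1 w = fO.1 x := by
    have : Nonempty X := ⟨⟨x, hx⟩⟩
    refine le_antisymm (ciInf_le ⟨fO.1 x, ?_⟩ (⟨x, hx⟩ : X)) (le_ciInf fun w => hxmin w.2)
    rintro _ ⟨w, rfl⟩
    exact hxmin w.2
  have hreg := integral_querySum_le hB hfO hcomp hconv hW hdec' (M := η * M)
    (fun y => by
      rw [norm_smul, Real.norm_of_nonneg hη0.le]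
      exact mul_le_mul_of_nonneg_left (hM y) hη0.le)
    hA hT hΦ hΦ0 hΦ1 (continuous_const.mul (continuous_dualNormSq ha)) hstep hη0.le
    (fun g hg => by rw [integral_smul, hmean g hg])
    (σ := c * (η ^ 2 * G ^ 2))
    (fun g hg => by
      change ∫ y, c * dualNormSq a (η • dec y) ∂(W g) ≤ _
      simp only [dualNormSq_smul ha, integral_const_mul]
      have := hvar g hg
      gcongr) hx T
  set P := dualAveraging hconv hW hdec' hA.measurable T hT with hP
  have hT' : (T : ℝ) * (c * (η ^ 2 * G ^ 2)) = 1 := by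
    rw [hη, div_pow, mul_pow, mul_pow, Real.sq_sqrt hc0.le, Real.sq_sqrt hT0.le]
    field_simp
  rw [hT'] at hreg
  have hfm : Measurable fun w : X => fO.1 w :=
    (continuousOn_iff_continuous_domRestrict.1 hf).measurable
  obtain ⟨C₀, hC₀⟩ := hcomp.exists_bound_of_continuousOn hf
  have hle : P.error fO.1 fO.2 ≤ ∫ z, (T : ℝ)⁻¹ * querySum (fun y => η • dec y) A
      (fun w => fO.1 w - fO.1 x) T z.2 ∂(P.law fO.2 T) := by
    unfold Protocol.error
    rw [hinf]
    refine integral_mono ?_ ?_ fun z => ?_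
    · exact .of_bound ((hfm.comp P.measurable_output).sub_const _).aestronglyMeasurable (C₀ + C₀)
        (ae_of_all _ fun z => (norm_sub_le _ _).trans
          (add_le_add (hC₀ _ (P.output z).2) (hC₀ _ hx)))
    · refine Integrable.const_mul ?_ _
      exact .of_bound ((measurable_querySum hdec' hA.measurable (hfm.sub_const _) T).comp
        measurable_snd).aestronglyMeasurable (T * (C₀ + C₀)) (ae_of_all _ fun z =>
          abs_querySum_le _ A (fun w => (abs_sub _ _).trans
            (add_le_add (hC₀ _ w.2) (hC₀ _ hx))) T z.2)
    -- Jensen's inequality for the average of the queries.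
    · have hj := hfO.1.map_sum_le (t := Finset.univ) (w := fun _ : Fin T => (T : ℝ)⁻¹)
        (p := fun t => (A (∑ s : Fin t, η • dec (z.2 (s.castLE t.2.le))) : Fin d → ℝ))
        (fun _ _ => by positivity) (by simp [hT0.ne']) fun _ _ => (A _).2
      have ho : (P.output z : Fin d → ℝ) = ∑ t : Fin T, (T : ℝ)⁻¹ •
          (A (∑ s : Fin t, η • dec (z.2 (s.castLE t.2.le))) : Fin d → ℝ) := rfl
      simp only [ho, querySum, Finset.sum_sub_distrib, mul_sub, Finset.sum_const, Finset.card_univ,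
        Fintype.card_fin, nsmul_eq_mul, inv_mul_cancel_left₀ hT0.ne', Finset.mul_sum]
      simpa using hj
  rw [integral_const_mul] at hle
  refine hle.trans ?_
  have h2 : ∫ z, querySum (fun y => η • dec y) A (fun w => fO.1 w - fO.1 x) T z.2 ∂(P.law fO.2 T) ≤
      2 / η := by
    rw [le_div_iff₀ hη0]; linarith
  calc _ ≤ (T : ℝ)⁻¹ * (2 / η) := by gcongr
    _ = 2 * √c * G / √T := by
      rw [hη]
      field_simp
      rw [Real.sq_sqrt hT0.le]
    _ = _ := by
      rw [hcdef, show 2 * ρ ^ 2 / (a - 1) = 2 / (a - 1) * ρ ^ 2 by ring,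
        Real.sqrt_mul (by positivity), Real.sqrt_sq hρ.le]
      ring

end CommOpt

/-! ### An unbiased quantizer by systematic rounding. -/

namespace CommOpt

variable {d : ℕ}

theorem abs_floor_le (x : ℝ) : |(⌊x⌋ : ℝ)| ≤ |x| + 1 := by
  have h1 := Int.floor_le x
  have h2 := Int.lt_floor_add_one x
  have h3 := le_abs_self x
  have h4 := neg_abs_le x
  rw [abs_le]
  constructor <;> linarith

theorem intervalIntegrable_floor_add (c : ℝ) :
    IntervalIntegrable (fun u : ℝ => (⌊c + u⌋ : ℝ)) volume 0 1 := by
  rw [intervalIntegrable_iff, Set.uIoc_of_le zero_le_one]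
  have hm : Measurable fun u : ℝ => (⌊c + u⌋ : ℝ) :=
    (measurable_from_top (f := fun n : ℤ => (n : ℝ))).comp (by fun_prop)
  refine Measure.integrableOn_of_bounded (M := |c| + 1 + 1) (by simp) hm.aestronglyMeasurable ?_
  filter_upwards [ae_restrict_mem measurableSet_Ioc] with u hu
  refine (abs_floor_le _).trans ?_
  have := abs_add_le c u
  have : |u| ≤ 1 := abs_le.2 ⟨by linarith [hu.1], hu.2⟩
  linarith

/-- The fractional part of `c + u` has mean `1/2` by periodicity, which cancels the mean of `u`. -/
theorem integral_floor_add (c : ℝ) : ∫ u in (0 : ℝ)..1, (⌊c + u⌋ : ℝ) = c := by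
  have hper : Function.Periodic (fun u : ℝ => Int.fract u) 1 := fun u => Int.fract_add_one u
  have h0 : ∫ u in (0 : ℝ)..1, Int.fract u = 1 / 2 := by
    have : ∫ u in (0 : ℝ)..1, Int.fract u = ∫ u in (0 : ℝ)..1, u := by
      rw [intervalIntegral.integral_of_le zero_le_one, intervalIntegral.integral_of_le zero_le_one,
        integral_Ioc_eq_integral_Ioo, integral_Ioc_eq_integral_Ioo]
      refine setIntegral_congr_fun measurableSet_Ioo fun u hu => ?_
      exact Int.fract_eq_self.2 ⟨hu.1.le, hu.2⟩
    rw [this, integral_id]; norm_num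
  have h1 : ∫ u in (0 : ℝ)..1, Int.fract (c + u) = 1 / 2 := by
    rw [intervalIntegral.integral_comp_add_left (fun u => Int.fract u), add_zero,
      hper.intervalIntegral_add_eq c 0, zero_add, h0]
  have h2 : ∫ u in (0 : ℝ)..1, Int.fract (c + u) = ∫ u in (0 : ℝ)..1, ((c + u) - (⌊c + u⌋ : ℝ)) := rfl
  rw [intervalIntegral.integral_sub ((by fun_prop : Continuous fun u : ℝ => c + u).intervalIntegrable _ _)
      (intervalIntegrable_floor_add c),
    intervalIntegral.integral_add (by simp) (by simp)] at h2
  rw [h1, intervalIntegral.integral_const, integral_id] at h2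
  norm_num at h2
  linarith

/-- Stochastic rounding of `x` with the threshold `c + u` for `u` uniform on `[0, 1]`. -/
noncomputable def roundStep (c x u : ℝ) : ℤ := ⌊c + x + u⌋ - ⌊c + u⌋

theorem roundStep_nonneg {x : ℝ} (hx : 0 ≤ x) (c u : ℝ) : 0 ≤ roundStep c x u := by
  unfold roundStep
  have : ⌊c + u⌋ ≤ ⌊c + x + u⌋ := Int.floor_le_floor (by linarith)
  linarith

theorem abs_roundStep_sub_le (c x u : ℝ) : |(roundStep c x u : ℝ) - x| ≤ 1 := by
  unfold roundStep
  have h1 := Int.floor_le (c + u)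
  have h2 := Int.lt_floor_add_one (c + u)
  have h3 := Int.floor_le (c + x + u)
  have h4 := Int.lt_floor_add_one (c + x + u)
  push_cast
  rw [abs_le]
  constructor <;> linarith

/-- Only the values `⌊x⌋` and `⌊x⌋ + 1` occur, and this is the quadratic equation they satisfy. It
makes the second moment an affine function of the mean. -/
theorem roundStep_sq (c x u : ℝ) :
    (roundStep c x u : ℝ) ^ 2 = (2 * ⌊x⌋ + 1) * roundStep c x u - ⌊x⌋ * (⌊x⌋ + 1) := by
  have h1 := Int.floor_le (c + u)
  have h2 := Int.lt_floor_add_one (c + u)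
  have h3 := Int.floor_le (c + x + u)
  have h4 := Int.lt_floor_add_one (c + x + u)
  have h5 := Int.floor_le x
  have h6 := Int.lt_floor_add_one x
  have h7 : ⌊x⌋ ≤ roundStep c x u := by
    rw [← Int.lt_add_one_iff]
    have : (⌊x⌋ : ℝ) < (roundStep c x u + 1 : ℤ) := by
      unfold roundStep; push_cast; linarith
    exact_mod_cast this
  have h8 : roundStep c x u ≤ ⌊x⌋ + 1 := by
    rw [← Int.lt_add_one_iff]
    have : (roundStep c x u : ℝ) < (⌊x⌋ + 1 + 1 : ℤ) := by
      unfold roundStep; push_cast; linarith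
    exact_mod_cast this
  have h9 : roundStep c x u = ⌊x⌋ ∨ roundStep c x u = ⌊x⌋ + 1 := by omega
  rcases h9 with h | h <;> rw [h] <;> push_cast <;> ring

theorem intervalIntegrable_roundStep (c x : ℝ) :
    IntervalIntegrable (fun u : ℝ => (roundStep c x u : ℝ)) volume 0 1 := by
  unfold roundStep
  push_cast
  exact (intervalIntegrable_floor_add _).sub (intervalIntegrable_floor_add _)

theorem integral_roundStep (c x : ℝ) : ∫ u in (0 : ℝ)..1, (roundStep c x u : ℝ) = x := by
  unfold roundStep
  push_cast
  rw [intervalIntegral.integral_sub (intervalIntegrable_floor_add _)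
    (intervalIntegrable_floor_add _), integral_floor_add, integral_floor_add]
  ring

theorem integral_roundStep_sq_le {x : ℝ} (hx : 0 ≤ x) (c : ℝ) :
    ∫ u in (0 : ℝ)..1, (roundStep c x u : ℝ) ^ 2 ≤ x ^ 2 + x := by
  simp only [roundStep_sq]
  rw [intervalIntegral.integral_sub ((intervalIntegrable_roundStep c x).const_mul _) (by simp),
    intervalIntegral.integral_const_mul, integral_roundStep]
  have h0 : (0 : ℝ) ≤ ⌊x⌋ := by exact_mod_cast Int.floor_nonneg.2 hx
  simp
  nlinarith [sq_nonneg (x - ⌊x⌋)]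

/-- The sum of the first `j` absolute values of the entries of `g`, divided by `s`. -/
noncomputable def cumAbs (s : ℝ) (g : Fin d → ℝ) (j : ℕ) : ℝ :=
  ∑ m ∈ Finset.range j, (if h : m < d then |g ⟨m, h⟩| else 0) / s

theorem cumAbs_succ (s : ℝ) (g : Fin d → ℝ) (i : Fin d) :
    cumAbs s g (i + 1) = cumAbs s g i + |g i| / s := by
  rw [cumAbs, Finset.sum_range_succ]
  simp [cumAbs]

theorem cumAbs_self (s : ℝ) (g : Fin d → ℝ) : cumAbs s g d = (∑ i, |g i|) / s := by
  rw [cumAbs, Finset.sum_range, Finset.sum_div]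
  simp

theorem measurable_cumAbs (s : ℝ) (j : ℕ) : Measurable fun g : Fin d → ℝ => cumAbs s g j := by
  refine Finset.measurable_sum _ fun m _ => ?_
  split_ifs with h <;> fun_prop

/-- Systematic rounding of `g / s` to an integer vector, with a common uniform `u` for all
coordinates. -/
noncomputable def systematicRound (s : ℝ) (g : Fin d → ℝ) (u : ℝ) (i : Fin d) : ℤ :=
  if 0 ≤ g i then roundStep (cumAbs s g i) (|g i| / s) u
  else - roundStep (cumAbs s g i) (|g i| / s) u

theorem measurable_systematicRound (s : ℝ) :
    Measurable fun z : (Fin d → ℝ) × ℝ => systematicRound s z.1 z.2 := by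
  refine measurable_pi_iff.2 fun i => ?_
  have h1 : Measurable fun z : (Fin d → ℝ) × ℝ => cumAbs s z.1 i :=
    (measurable_cumAbs s i).comp measurable_fst
  have h2 : Measurable fun z : (Fin d → ℝ) × ℝ =>
      roundStep (cumAbs s z.1 i) (|z.1 i| / s) z.2 := by
    unfold roundStep
    fun_prop
  exact Measurable.ite (measurableSet_le measurable_const (by fun_prop)) h2 h2.neg

theorem systematicRound_eq (s : ℝ) (g : Fin d → ℝ) (u : ℝ) (i : Fin d) :
    (systematicRound s g u i : ℝ) =
      (if 0 ≤ g i then 1 else -1) * (roundStep (cumAbs s g i) (|g i| / s) u : ℝ) := by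
  unfold systematicRound
  split_ifs <;> simp

theorem natAbs_systematicRound {s : ℝ} (hs : 0 < s) (g : Fin d → ℝ) (u : ℝ) (i : Fin d) :
    ((systematicRound s g u i).natAbs : ℤ) =
      ⌊cumAbs s g (i + 1) + u⌋ - ⌊cumAbs s g i + u⌋ := by
  have h := roundStep_nonneg (x := |g i| / s) (by positivity) (cumAbs s g i) u
  rw [cumAbs_succ]
  change _ = roundStep _ _ u
  unfold systematicRound
  split_ifs <;> simp [abs_of_nonneg h]

/-- The absolute values of the entries are the increments of one floor function along the cumulative
sums, so they telescope to `⌊‖g‖₁ / s + u⌋ - ⌊u⌋`. This sure bound is why all coordinates share the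
same `u`. -/
theorem sum_natAbs_systematicRound_le {s : ℝ} (hs : 0 < s) {g : Fin d → ℝ} {k : ℕ}
    (hg : ∑ i, |g i| ≤ k * s) (u : ℝ) : ∑ i, (systematicRound s g u i).natAbs ≤ k := by
  zify
  have : ∑ i, |systematicRound s g u i| =
      ∑ i : Fin d, (⌊cumAbs s g (i + 1) + u⌋ - ⌊cumAbs s g i + u⌋) :=
    Finset.sum_congr rfl fun i _ => by
      rw [← natAbs_systematicRound hs, Int.natCast_natAbs]
  rw [this, Fin.sum_univ_eq_sum_range (fun i => ⌊cumAbs s g (i + 1) + u⌋ - ⌊cumAbs s g i + u⌋),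
    Finset.sum_range_sub (fun i => ⌊cumAbs s g i + u⌋), cumAbs_self]
  have h0 : cumAbs s g 0 = 0 := by simp [cumAbs]
  have h1 : ⌊(∑ i, |g i|) / s + u⌋ ≤ ⌊u + (k : ℤ)⌋ := by
    refine Int.floor_le_floor ?_
    have : (∑ i, |g i|) / s ≤ k := by rwa [div_le_iff₀ hs]
    push_cast
    linarith
  rw [Int.floor_add_intCast] at h1
  rw [h0, zero_add]
  linarith

theorem abs_mul_systematicRound_sub_le {s : ℝ} (hs : 0 < s) (g : Fin d → ℝ) (u : ℝ) (i : Fin d) :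
    |s * systematicRound s g u i - g i| ≤ s := by
  have h := abs_roundStep_sub_le (cumAbs s g i) (|g i| / s) u
  have h2 : |s * ((roundStep (cumAbs s g i) (|g i| / s) u : ℝ) - |g i| / s)| ≤ s := by
    rw [abs_mul, abs_of_pos hs]
    nlinarith
  rw [mul_sub, mul_div_cancel₀ _ hs.ne'] at h2
  rw [systematicRound_eq]
  set z : ℝ := (roundStep (cumAbs s g i) (|g i| / s) u : ℝ)
  split_ifs with h0
  · rwa [abs_of_nonneg h0, ← one_mul z] at h2
  · rw [← abs_neg]
    rw [abs_of_neg (not_le.1 h0)] at h2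
    convert h2 using 2
    ring

theorem integral_mul_systematicRound {s : ℝ} (hs : 0 < s) (g : Fin d → ℝ) (i : Fin d) :
    ∫ u in (0 : ℝ)..1, s * (systematicRound s g u i : ℝ) = g i := by
  simp only [systematicRound_eq, intervalIntegral.integral_const_mul, integral_roundStep]
  split_ifs with h0
  · rw [abs_of_nonneg h0]; field_simp
  · rw [abs_of_neg (not_le.1 h0)]; field_simp

theorem intervalIntegrable_mul_systematicRound_sq (s : ℝ) (g : Fin d → ℝ) (i : Fin d) :
    IntervalIntegrable (fun u => (s * (systematicRound s g u i : ℝ)) ^ 2) volume 0 1 := by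
  have h1 : ∀ u, (s * (systematicRound s g u i : ℝ)) ^ 2 =
      s ^ 2 * (roundStep (cumAbs s g i) (|g i| / s) u : ℝ) ^ 2 := fun u => by
    rw [systematicRound_eq]
    split_ifs <;> ring
  simp only [h1, roundStep_sq]
  exact (((intervalIntegrable_roundStep _ _).const_mul _).sub (by simp)).const_mul _

theorem integral_mul_systematicRound_sq_le {s : ℝ} (hs : 0 < s) (g : Fin d → ℝ) (i : Fin d) :
    ∫ u in (0 : ℝ)..1, (s * (systematicRound s g u i : ℝ)) ^ 2 ≤ g i ^ 2 + s * |g i| := by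
  have h1 : ∀ u, (s * (systematicRound s g u i : ℝ)) ^ 2 =
      s ^ 2 * (roundStep (cumAbs s g i) (|g i| / s) u : ℝ) ^ 2 := fun u => by
    rw [systematicRound_eq]
    split_ifs <;> ring
  simp only [h1, intervalIntegral.integral_const_mul]
  have h2 := integral_roundStep_sq_le (x := |g i| / s) (by positivity) (cumAbs s g i)
  calc _ ≤ s ^ 2 * ((|g i| / s) ^ 2 + |g i| / s) := by gcongr
    _ = _ := by
      rw [← sq_abs (g i)]
      field_simp

/-- The integer vectors of `ℓ_1` norm at most `k` can be encoded in `r` bits if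
`(2 d + k).choose k ≤ 2 ^ r`. -/
theorem exists_code (d : ℕ) {k r : ℕ} (h : (2 * d + k).choose k ≤ 2 ^ r) :
    ∃ (code : (Fin d → ℤ) → Fin r → Bool) (dec : (Fin r → Bool) → Fin d → ℤ),
      ∀ z, ∑ i, (z i).natAbs ≤ k → dec (code z) = z := by
  classical
  have hcard : Fintype.card (Sym (Option (Fin d × Bool)) k) ≤ Fintype.card (Fin r → Bool) := by
    rw [Sym.card_sym_eq_choose]
    simp only [Fintype.card_option, Fintype.card_prod, Fintype.card_fin, Fintype.card_bool,
      Fintype.card_pi, Finset.prod_const, Finset.card_univ]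
    convert h using 2
    omega
  obtain ⟨e⟩ := Function.Embedding.nonempty_of_card_le hcard
  -- An integer vector is a multiset of signed unit coordinates, filled up to size `k` with the
  -- blank symbol `none`. With `2d + 1` symbols there are `(2 * d + k).choose k` multisets.
  set val : Sym (Option (Fin d × Bool)) k → Fin d → ℤ := fun S i =>
    ((S : Multiset _).count (some (i, true)) : ℤ) - (S : Multiset _).count (some (i, false)) with hval
  have hsurj : ∀ z : Fin d → ℤ, ∑ i, (z i).natAbs ≤ k → ∃ S, val S = z := by
    intro z hz
    set m : Multiset (Option (Fin d × Bool)) :=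
      ∑ i, Multiset.replicate (z i).natAbs (some (i, decide (0 ≤ z i))) +
        Multiset.replicate (k - ∑ i, (z i).natAbs) none with hm
    have hmc : Multiset.card m = k := by
      simp [hm, Multiset.card_sum]
      omega
    refine ⟨⟨m, hmc⟩, funext fun i => ?_⟩
    have hcount : ∀ b, m.count (some (i, b)) = if b = decide (0 ≤ z i) then (z i).natAbs else 0 := by
      intro b
      simp only [hm, Multiset.count_add, Multiset.count_sum', Multiset.count_replicate]
      rw [Finset.sum_eq_single i]
      · simp [eq_comm]
      · intro j _ hj
        simp [hj]
      · simp
    simp only [hval, Sym.coe_mk, hcount]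
    by_cases h0 : 0 ≤ z i
    · simp [h0, abs_of_nonneg h0]
    · have h1 : z i < 0 := not_le.1 h0
      simp [h0, abs_of_neg h1]
  have hne : Nonempty (Sym (Option (Fin d × Bool)) k) := ⟨Sym.replicate k none⟩
  choose! S hS using hsurj
  refine ⟨fun z => e (S z), fun y => val (Function.invFun e y), fun z hz => ?_⟩
  simp only [Function.leftInverse_invFun e.injective (S z)]
  exact hS z hz

/-- A quantizer with `r` bits: an unbiased decoder with error at most `s` in each coordinate. -/
theorem exists_quantizer {s : ℝ} (hs : 0 < s) {k r : ℕ} (h : (2 * d + k).choose k ≤ 2 ^ r) :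
    ∃ (W : Kernel (Fin d → ℝ) (Fin r → Bool)) (dec : (Fin r → Bool) → Fin d → ℝ),
      IsMarkovKernel W ∧ ∀ g : Fin d → ℝ, ∑ i, |g i| ≤ k * s → ∫ y, dec y ∂(W g) = g ∧
        (∀ᵐ y ∂(W g), ∀ i, |dec y i - g i| ≤ s) ∧
        ∫ y, ∑ i, dec y i ^ 2 ∂(W g) ≤ ∑ i, g i ^ 2 + s * ∑ i, |g i| := by
  obtain ⟨code, idec, hdec⟩ := exists_code d h
  set μ : Measure ℝ := volume.restrict (Set.Ioc 0 1) with hμ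
  have hμp : IsProbabilityMeasure μ := ⟨by simp [hμ]⟩
  set F : (Fin d → ℝ) × ℝ → Fin r → Bool := fun z => code (systematicRound s z.1 z.2) with hF
  have hFm : Measurable F := (Measurable.of_discrete (f := code)).comp (measurable_systematicRound s)
  set W : Kernel (Fin d → ℝ) (Fin r → Bool) := (Kernel.id ×ₖ Kernel.const _ μ).map F with hW
  have hWm : IsMarkovKernel W := by rw [hW]; exact Kernel.IsMarkovKernel.map _ hFm
  set dec : (Fin r → Bool) → Fin d → ℝ := fun y i => s * idec y i with hdecdef
  have hWg : ∀ g, W g = μ.map fun u => F (g, u) := fun g => by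
    rw [hW, Kernel.map_apply _ hFm, Kernel.prod_apply, Kernel.id_apply, Kernel.const_apply,
      Measure.dirac_prod, Measure.map_map hFm (by fun_prop)]
    rfl
  have hFg : ∀ g, Measurable fun u => F (g, u) := fun g => hFm.comp (by fun_prop)
  have hint : ∀ (f : (Fin r → Bool) → ℝ) g, ∫ y, f y ∂(W g) = ∫ u in (0 : ℝ)..1, f (F (g, u)) :=
    fun f g => by
      rw [hWg, integral_map (hFg g).aemeasurable (Measurable.of_discrete.aestronglyMeasurable),
        intervalIntegral.integral_of_le zero_le_one]
  refine ⟨W, dec, hWm, fun g hg => ?_⟩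
  have hval : ∀ u i, dec (F (g, u)) i = s * systematicRound s g u i := fun u i => by
    simp only [hdecdef, hF]
    rw [hdec _ (sum_natAbs_systematicRound_le hs hg u)]
  refine ⟨funext fun i => ?_, ?_, ?_⟩
  · rw [eval_integral fun i => Integrable.of_finite, hint]
    simp only [hval]
    exact integral_mul_systematicRound hs g i
  · rw [hWg]
    refine (ae_map_iff (hFg g).aemeasurable (Set.toFinite _).measurableSet).2
      (ae_of_all _ fun u i => ?_)
    rw [hval]
    exact abs_mul_systematicRound_sub_le hs g u i
  · rw [hint]
    simp only [hval]
    rw [intervalIntegral.integral_finsetSum fun i _ =>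
      intervalIntegrable_mul_systematicRound_sq s g i, Finset.mul_sum, ← Finset.sum_add_distrib]
    exact Finset.sum_le_sum fun i _ => integral_mul_systematicRound_sq_le hs g i

end CommOpt

/-! ### Upper bounds on the worst-case error. -/

namespace CommOpt

variable {d : ℕ} {p : ℝ≥0∞}

theorem classicRate_nonneg (d T : ℕ) (p : ℝ≥0∞) {D B : ℝ} (hD : 0 < D) (hB : 0 < B) :
    0 ≤ classicRate d T p D B := by
  unfold classicRate
  split_ifs <;> positivity

theorem dualNormSq_two (h : Fin d → ℝ) : dualNormSq 2 h = ∑ i, h i ^ 2 := by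
  unfold dualNormSq
  norm_num

theorem holderConj_le_two (hp : 2 ≤ p) : holderConj p ≤ 2 := by
  have h : (p - 1)⁻¹ ≤ 1 := by
    rw [ENNReal.inv_le_one]
    exact ENNReal.le_sub_of_add_le_right ENNReal.one_ne_top (by rwa [one_add_one_eq_two])
  calc holderConj p = 1 + (p - 1)⁻¹ := rfl
    _ ≤ 1 + 1 := by gcongr
    _ = 2 := one_add_one_eq_two

theorem sum_sq_le_of_two_le (hp : 2 ≤ p) {B : ℝ} {g : Fin d → ℝ}
    (hg : lpNorm (holderConj p) g ≤ B) : ∑ i, g i ^ 2 ≤ B ^ 2 := by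
  have := sum_rpow_le_of_le (one_le_holderConj p) (a := 2) (by simpa using holderConj_le_two hp) hg
  simpa using this

theorem ofReal_conj_le_holderConj {a : ℝ} (ha : 1 < a) (hpa : p ≤ ENNReal.ofReal a) :
    ENNReal.ofReal (a / (a - 1)) ≤ holderConj p := by
  have h0 : 0 < a - 1 := by linarith
  have h1 : p - 1 ≤ ENNReal.ofReal (a - 1) := by
    rw [ENNReal.ofReal_sub _ zero_le_one, ENNReal.ofReal_one]
    gcongr
  calc ENNReal.ofReal (a / (a - 1)) = 1 + (ENNReal.ofReal (a - 1))⁻¹ := by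
        rw [← ENNReal.ofReal_inv_of_pos h0, ← ENNReal.ofReal_one,
          ← ENNReal.ofReal_add zero_le_one (by positivity)]
        congr 1
        field_simp
        ring
    _ ≤ 1 + (p - 1)⁻¹ := by gcongr

/-- For `p ≤ 2` there is an exponent `a ≥ p` whose dual norm is, up to a factor `2`, at most the
dual of the `ℓ_p` norm, and for which the modulus of convexity costs at most `log₂ d`. -/
theorem exists_exponent (hp : 1 ≤ p) (hp2 : p ≤ 2) (hd : 2 ≤ d) :
    ∃ a : ℝ, 1 < a ∧ a ≤ 2 ∧ p ≤ ENNReal.ofReal a ∧ 1 / (a - 1) ≤ Real.logb 2 d ∧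
      ∀ (g : Fin d → ℝ) (B : ℝ), lpNorm (holderConj p) g ≤ B → dualNormSq a g ≤ (2 * B) ^ 2 := by
  have hd' : (2 : ℝ) ≤ d := by exact_mod_cast hd
  have hd0 : (0 : ℝ) < d := by linarith
  have hL : 1 ≤ Real.logb 2 d := by
    rw [Real.le_logb_iff_rpow_le (by norm_num) hd0]; simpa using hd'
  set L := Real.logb 2 d with hLdef
  have hL0 : 0 < L := by linarith
  have hptop : p ≠ ∞ := ne_top_of_le_ne_top (by simp) hp2
  have hpr1 : 1 ≤ p.toReal := by simpa using ENNReal.toReal_mono hptop hp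
  have hpr2 : p.toReal ≤ 2 := by simpa using ENNReal.toReal_mono (by simp) hp2
  -- Raising `p` to `1 + 1 / L` keeps `1 / (a - 1)` at most `L = log₂ d`; the exponent of `d` lost
  -- in the squared dual norm is at most `2 / L`, a factor `d ^ (2 / L) = 4`.
  set a := max p.toReal (1 + 1 / L) with ha
  have h1L : 0 < 1 / L := by positivity
  have ha1 : 1 + 1 / L ≤ a := le_max_right _ _
  have ha1' : 1 < a := by linarith
  have hc : 0 < a - 1 := by linarith
  have hpa : p ≤ ENNReal.ofReal a := by
    rw [← ENNReal.ofReal_toReal hptop]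
    exact ENNReal.ofReal_le_ofReal (le_max_left _ _)
  refine ⟨a, ha1', max_le hpr2 ?_, hpa, ?_, fun g B hg => ?_⟩
  · have : 1 / L ≤ 1 := by rw [div_le_one hL0]; exact hL
    linarith
  · rw [div_le_iff₀ hc]
    have : L * (1 / L) = 1 := by field_simp
    nlinarith
  · have ha0 : 0 < a := by linarith
    have hB : 0 ≤ B := (lpNorm_nonneg (one_le_holderConj p) g).trans hg
    have hb1 : 1 ≤ a / (a - 1) := by rw [one_le_div hc]; linarith
    have h1 := sum_rpow_le_of_ge (one_le_holderConj p) hb1 (ofReal_conj_le_holderConj ha1' hpa) hg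
    have he : 2 * (a - 1) / a - 2 * recip (holderConj p) ≤ 2 / L := by
      have hr := recip_add_recip_holderConj hp
      rw [recip_eq p] at hr
      have e1 : 2 * (a - 1) / a - 2 * recip (holderConj p) = 2 * (p.toReal⁻¹ - a⁻¹) := by
        rw [eq_sub_of_add_eq' hr]
        field_simp
        ring
      rw [e1]
      rcases le_total p.toReal (1 + 1 / L) with h | h
      · have hmax : a = 1 + 1 / L := max_eq_right h
        have e2 : p.toReal⁻¹ ≤ 1 := inv_le_one_of_one_le₀ hpr1
        have e3 : 1 - a⁻¹ ≤ 1 / L := by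
          have : 1 - a⁻¹ = (a - 1) / a := by field_simp
          rw [this, hmax, add_sub_cancel_left]
          exact div_le_self h1L.le (by linarith)
        calc 2 * (p.toReal⁻¹ - a⁻¹) ≤ 2 * (1 / L) := by linarith
          _ = 2 / L := by ring
      · have hmax : a = p.toReal := max_eq_left h
        rw [hmax, sub_self, mul_zero]
        positivity
    calc dualNormSq a g ≤ ((d : ℝ) ^ (1 - a / (a - 1) * recip (holderConj p)) *
          B ^ (a / (a - 1))) ^ (2 * (a - 1) / a) := by
          unfold dualNormSq
          gcongr
      _ = (d : ℝ) ^ (2 * (a - 1) / a - 2 * recip (holderConj p)) * B ^ 2 := by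
          rw [Real.mul_rpow (by positivity) (by positivity), ← Real.rpow_mul hB,
            ← Real.rpow_mul hd0.le,
            show a / (a - 1) * (2 * (a - 1) / a) = 2 by field_simp, Real.rpow_two]
          congr 2
          field_simp
      _ ≤ (d : ℝ) ^ (2 / L) * B ^ 2 := by
          gcongr
          linarith
      _ = 2 ^ 2 * B ^ 2 := by
          congr 1
          have : (d : ℝ) = 2 ^ L := (Real.rpow_logb (by norm_num) (by norm_num) hd0).symm
          rw [this, ← Real.rpow_mul (by norm_num), mul_div_cancel₀ _ hL0.ne', Real.rpow_two]
      _ = (2 * B) ^ 2 := by ring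

section

variable {D B : ℝ} {T : ℕ} {𝒴 : Type} [MeasurableSpace 𝒴] {𝒲 : Set (Kernel (Fin d → ℝ) 𝒴)}
  {W : Kernel (Fin d → ℝ) 𝒴} [IsMarkovKernel W] {dec : 𝒴 → Fin d → ℝ} {M : ℝ}

/-- Euclidean dual averaging: the `ℓ_2` diameter is at most `d ^ (1/2 - 1/p) D`, which is the
dimension factor of the rate. The constant 3 absorbs `2√2`. -/
theorem worstError_le_of_two_le (hp : 2 ≤ p) (hd : 1 ≤ d) (hT : 1 ≤ T) (hD : 0 < D) (hB : 0 < B)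
    (hW : W ∈ 𝒲) (hdec : Measurable dec) (hM : ∀ y, ‖dec y‖ ≤ M)
    (hmean : ∀ g, lpNorm (holderConj p) g ≤ B → ∫ y, dec y ∂(W g) = g) {γ : ℝ} (hγ : 0 < γ)
    (hvar : ∀ g, lpNorm (holderConj p) g ≤ B → ∫ y, ∑ i, dec y i ^ 2 ∂(W g) ≤ (γ * B) ^ 2) :
    worstError p D B T 𝒲 ≤ ((3 * γ * classicRate d T p D B : ℝ) : EReal) := by
  have hp1 : 1 ≤ p := one_le_two.trans hp
  have hd0 : (0 : ℝ) < d := by exact_mod_cast hd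
  refine iSup₂_le fun X hX => (minmaxError_le hp1 hB hX hW hdec hM hT hmean (a := 2)
    (ρ := (d : ℝ) ^ (1 / 2 - recip p) * D) (G := γ * B) (by norm_num) le_rfl (by positivity)
    (by positivity) (fun x hx y hy => ?_) (by simpa only [dualNormSq_two] using hvar)).trans
    (EReal.coe_le_coe_iff.2 ?_)
  · have h1 := sum_rpow_le_of_ge hp1 (b := 2) (by norm_num) (by simpa using hp) (hX.2.2.2 x hx y hy)
    refine h1.trans (le_of_eq ?_)
    rw [Real.mul_rpow (by positivity) hD.le, ← Real.rpow_mul hd0.le]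
    congr 2
    ring
  · rw [classicRate, if_pos hp]
    have h2 : 2 * √(2 / (2 - 1)) ≤ 3 := by
      norm_num
      nlinarith [Real.sq_sqrt (show (0 : ℝ) ≤ 2 by norm_num), Real.sqrt_nonneg (2 : ℝ)]
    calc _ = (2 * √(2 / (2 - 1))) * (γ * ((d : ℝ) ^ (1 / 2 - recip p) * D * B / √T)) := by ring
      _ ≤ 3 * (γ * ((d : ℝ) ^ (1 / 2 - recip p) * D * B / √T)) := by gcongr
      _ = _ := by ring

/-- The exponent from `exists_exponent` doubles the almost sure norm bound `2 * B`, so the dual norm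
of the decoder is at most `4 * B`; the constant 12 absorbs `8√2`. -/
theorem worstError_le_of_lt_two (hp1 : 1 ≤ p) (hp : p < 2) (hd : 2 ≤ d) (hT : 1 ≤ T) (hD : 0 < D)
    (hB : 0 < B) (hW : W ∈ 𝒲) (hdec : Measurable dec) (hM : ∀ y, ‖dec y‖ ≤ M)
    (hmean : ∀ g, lpNorm (holderConj p) g ≤ B → ∫ y, dec y ∂(W g) = g)
    (hnorm : ∀ g, lpNorm (holderConj p) g ≤ B →
      ∀ᵐ y ∂(W g), lpNorm (holderConj p) (dec y) ≤ 2 * B) :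
    worstError p D B T 𝒲 ≤ ((12 * classicRate d T p D B : ℝ) : EReal) := by
  obtain ⟨a, ha, ha2, hpa, haL, hdual⟩ := exists_exponent hp1 hp.le hd
  have hc : 0 < a - 1 := by linarith
  refine iSup₂_le fun X hX => (minmaxError_le hp1 hB hX hW hdec hM hT hmean (a := a)
    (ρ := D) (G := 2 * (2 * B)) ha ha2 hD (by positivity)
    (fun x hx y hy => sum_rpow_le_of_le hp1 hpa (hX.2.2.2 x hx y hy)) fun g hg => ?_).trans
    (EReal.coe_le_coe_iff.2 ?_)
  · have : ∫ y, dualNormSq a (dec y) ∂(W g) ≤ ∫ _y, (2 * (2 * B)) ^ 2 ∂(W g) := by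
      refine integral_mono_of_nonneg (ae_of_all _ fun y => dualNormSq_nonneg a _)
        (integrable_const _) ?_
      filter_upwards [hnorm g hg] with y hy using hdual _ _ hy
    simpa using this
  · rw [classicRate, if_neg (not_le.2 hp)]
    have h1 : √(2 / (a - 1)) ≤ √2 * √(Real.logb 2 d) := by
      rw [← Real.sqrt_mul (by norm_num)]
      apply Real.sqrt_le_sqrt
      calc 2 / (a - 1) = 2 * (1 / (a - 1)) := by ring
        _ ≤ _ := by gcongr
    have h2 : 8 * √2 ≤ 12 := by
      nlinarith [Real.sq_sqrt (show (0 : ℝ) ≤ 2 by norm_num), Real.sqrt_nonneg (2 : ℝ)]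
    calc _ = 8 * √(2 / (a - 1)) * (D * B / √T) := by ring
      _ ≤ 8 * (√2 * √(Real.logb 2 d)) * (D * B / √T) := by gcongr
      _ = (8 * √2) * (√(Real.logb 2 d) * (D * B / √T)) := by ring
      _ ≤ 12 * (√(Real.logb 2 d) * (D * B / √T)) := by gcongr
      _ = _ := by ring

end

theorem worstError_idChannel_le {D B : ℝ} {T : ℕ} (hp : 1 ≤ p) (hd : 1 ≤ d) (hT : 1 ≤ T)
    (hD : 0 < D) (hB : 0 < B) (h : 2 ≤ p ∨ 2 ≤ d) :
    worstError p D B T (idChannel d) ≤ ((12 * classicRate d T p D B : ℝ) : EReal) := by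
  have hq := one_le_holderConj p
  -- The decoder must be bounded everywhere, while the oracle is bounded only almost surely; hence
  -- the truncation.
  set dec : (Fin d → ℝ) → Fin d → ℝ := fun g => if lpNorm (holderConj p) g ≤ B then g else 0
    with hdec
  have hdecm : Measurable dec :=
    Measurable.ite (measurableSet_le (continuous_lpNorm hq).measurable measurable_const)
      measurable_id measurable_const
  have hM : ∀ y, ‖dec y‖ ≤ B := fun y => by
    simp only [hdec]
    split_ifs with h
    · exact (pi_norm_le_iff_of_nonneg hB.le).2 fun i => (abs_apply_le_lpNorm hq y i).trans h
    · simpa using hB.le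
  have hW : Kernel.id ∈ idChannel d := rfl
  have hval : ∀ g, lpNorm (holderConj p) g ≤ B → dec g = g := fun g hg => by simp [hdec, hg]
  have hmean : ∀ g, lpNorm (holderConj p) g ≤ B →
      ∫ y, dec y ∂((Kernel.id : Kernel (Fin d → ℝ) (Fin d → ℝ)) g) = g := fun g hg => by
    rw [Kernel.id_apply, integral_dirac, hval g hg]
  rcases le_or_gt 2 p with hp2 | hp2
  · refine (worstError_le_of_two_le hp2 hd hT hD hB hW hdecm hM hmean one_pos
      fun g hg => ?_).trans (EReal.coe_le_coe_iff.2 ?_)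
    · rw [Kernel.id_apply, integral_dirac, hval g hg, one_mul]
      exact sum_sq_le_of_two_le hp2 hg
    · have := classicRate_nonneg d T p hD hB
      linarith
  · have hd2 : 2 ≤ d := h.resolve_left (not_le.2 hp2)
    refine worstError_le_of_lt_two hp hp2 hd2 hT hD hB hW hdecm hM hmean fun g hg => ?_
    rw [Kernel.id_apply]
    refine (ae_dirac_iff (p := fun y => lpNorm (holderConj p) (dec y) ≤ 2 * B) (measurableSet_le
      ((continuous_lpNorm hq).measurable.comp hdecm) measurable_const)).2 ?_
    rw [hval g hg]
    linarith

theorem minPrecision_le {c₁ : ℝ} {d T : ℕ} {p : ℝ≥0∞} {D B : ℝ} {r : ℕ} (hr : 1 ≤ r)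
    (h : worstError p D B T (comChannels d r) ≤ ((4 * c₁ * classicRate d T p D B : ℝ) : EReal))
    {b : ℝ} (hb : (r : ℝ) ≤ b) : minPrecision c₁ d T p D B ≤ (b : EReal) :=
  (iInf₂_le r ⟨hr, h⟩).trans (EReal.coe_le_coe_iff.2 hb)

theorem exists_norm_le_of_finite {α : Type*} [Finite α] (f : α → Fin d → ℝ) :
    ∃ M, ∀ y, ‖f y‖ ≤ M := by
  obtain ⟨M, hM⟩ := (Set.finite_range fun y => ‖f y‖).bddAbove
  exact ⟨M, fun y => hM ⟨y, rfl⟩⟩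

/-- For `p ≥ 2`, the number of bits needed for `d ^ (2 / p)`-sparse rounding. -/
theorem worstError_comChannels_le_of_two_le {D B : ℝ} {T r : ℕ} (hp : 2 ≤ p) (hd : 1 ≤ d)
    (hT : 1 ≤ T) (hD : 0 < D) (hB : 0 < B)
    (h : (2 * d + ⌈(d : ℝ) ^ (2 * recip p) / 4⌉₊).choose ⌈(d : ℝ) ^ (2 * recip p) / 4⌉₊ ≤ 2 ^ r) :
    worstError p D B T (comChannels d r) ≤ ((9 * classicRate d T p D B : ℝ) : EReal) := by
  have hp1 : 1 ≤ p := one_le_two.trans hp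
  have hd0 : (0 : ℝ) < d := by exact_mod_cast hd
  set k := ⌈(d : ℝ) ^ (2 * recip p) / 4⌉₊ with hk
  -- The scale is dictated by two needs: `k * s` must reach the `ℓ_1` bound `d ^ (1/p) B`, and the
  -- extra variance `s * ‖g‖₁` is then at most `4B²`, for a second moment of at most `5B² ≤ (3B)²`.
  -- The factor 4 saves bits.
  set s := 4 * B * (d : ℝ) ^ (- recip p) with hs
  obtain ⟨W, dec, hW, hq⟩ := exists_quantizer (d := d) (s := s) (by positivity) h
  obtain ⟨M, hM⟩ := exists_norm_le_of_finite dec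
  have hsum : ∀ g : Fin d → ℝ, lpNorm (holderConj p) g ≤ B → ∑ i, |g i| ≤ k * s := by
    intro g hg
    calc ∑ i, |g i| ≤ (d : ℝ) ^ recip p * B := sum_abs_le hp1 hg
      _ = (d : ℝ) ^ (2 * recip p) / 4 * s := by
        rw [hs, two_mul, Real.rpow_add hd0, Real.rpow_neg hd0.le]
        field_simp
      _ ≤ k * s := by
        gcongr
        exact Nat.le_ceil _
  refine (worstError_le_of_two_le (W := W) hp hd hT hD hB hW .of_discrete hM
    (fun g hg => (hq g (hsum g hg)).1) (γ := 3) (by norm_num) fun g hg => ?_).trans_eq ?_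
  · have h1 := (hq g (hsum g hg)).2.2
    have h2 := sum_sq_le_of_two_le hp hg
    have h3 : s * ∑ i, |g i| ≤ 4 * B ^ 2 := by
      calc s * ∑ i, |g i| ≤ s * ((d : ℝ) ^ recip p * B) := by
            gcongr
            exact sum_abs_le hp1 hg
        _ = _ := by
          rw [hs, Real.rpow_neg hd0.le]
          field_simp
    nlinarith
  · norm_num

/-- For `p ≤ 2`, three bits per coordinate suffice. -/
theorem worstError_comChannels_le_of_le_two {D B : ℝ} {T : ℕ} (hp1 : 1 ≤ p) (hp : p ≤ 2)
    (hd : 2 ≤ d) (hT : 1 ≤ T) (hD : 0 < D) (hB : 0 < B) :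
    worstError p D B T (comChannels d (3 * d)) ≤ ((12 * classicRate d T p D B : ℝ) : EReal) := by
  have hd0 : (0 : ℝ) < d := by exact_mod_cast (by omega : 0 < d)
  have hq1 := one_le_holderConj p
  -- With this scale a coordinatewise error of at most `s` is an error of at most `B` in the dual
  -- norm, and `k = d` reaches the `ℓ_1` bound.
  set s := B * (d : ℝ) ^ (- recip (holderConj p)) with hs
  have hcard : (2 * d + d).choose d ≤ 2 ^ (3 * d) := by
    rw [show 2 * d + d = 3 * d by ring]
    exact Nat.choose_le_two_pow _ _
  obtain ⟨W, dec, hW, hq⟩ := exists_quantizer (d := d) (s := s) (by positivity) hcard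
  obtain ⟨M, hM⟩ := exists_norm_le_of_finite dec
  have hds : (d : ℝ) ^ recip (holderConj p) * s = B := by
    rw [hs, Real.rpow_neg hd0.le]; field_simp
  have hsum : ∀ g : Fin d → ℝ, lpNorm (holderConj p) g ≤ B → ∑ i, |g i| ≤ d * s := by
    intro g hg
    refine (sum_abs_le hp1 hg).trans (le_of_eq ?_)
    rw [eq_sub_of_add_eq (recip_add_recip_holderConj hp1), sub_eq_add_neg, Real.rpow_add hd0,
      Real.rpow_one, hs]
    ring
  -- At `p = 2` the rate has no logarithm, so the second moment bound is used in place of the norm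
  -- bound.
  rcases hp.eq_or_lt with rfl | hp
  · refine (worstError_le_of_two_le (W := W) le_rfl (by omega) hT hD hB hW .of_discrete hM
      (fun g hg => (hq g (hsum g hg)).1) (γ := 2) (by norm_num) fun g hg => ?_).trans
      (EReal.coe_le_coe_iff.2 ?_)
    · have h1 := (hq g (hsum g hg)).2.2
      have h2 := sum_sq_le_of_two_le le_rfl hg
      have hr := recip_add_recip_holderConj (p := 2) hp1
      rw [recip_two] at hr
      have hr' : recip (holderConj 2) = recip 2 := by rw [recip_two]; linarith
      have h3 : s * ∑ i, |g i| ≤ B ^ 2 := by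
        have h4 := sum_abs_le hp1 hg
        rw [← hr'] at h4
        calc s * ∑ i, |g i| ≤ s * ((d : ℝ) ^ recip (holderConj 2) * B) := by gcongr
          _ = ((d : ℝ) ^ recip (holderConj 2) * s) * B := by ring
          _ = _ := by rw [hds]; ring
      nlinarith
    · have := classicRate_nonneg d T 2 hD hB
      linarith
  · refine worstError_le_of_lt_two (W := W) hp1 hp hd hT hD hB hW .of_discrete hM
      (fun g hg => (hq g (hsum g hg)).1) fun g hg => ?_
    filter_upwards [(hq g (hsum g hg)).2.1] with y hy
    have h1 := lpNorm_add_le hq1 g (dec y - g)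
    have h2 := lpNorm_le_of_abs_le hq1 (x := dec y - g) (c := s) (by positivity) hy
    rw [hds] at h2
    rw [add_sub_cancel] at h1
    linarith

/-- The bit count of `worstError_comChannels_le_of_two_le`. -/
theorem exists_bits {d : ℕ} (hd : 1 ≤ d) {K : ℝ} (hK1 : 1 ≤ K) (hKd : K ≤ d) :
    ∃ r : ℕ, 1 ≤ r ∧ (2 * d + ⌈K / 4⌉₊).choose ⌈K / 4⌉₊ ≤ 2 ^ r ∧
      (r : ℝ) ≤ K * Real.logb 2 (2 * Real.exp 1 * (d / K) + 2 * Real.exp 1) := by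
  have hd1 : (1 : ℝ) ≤ d := by exact_mod_cast hd
  have he : (2.7 : ℝ) < Real.exp 1 := lt_trans (by norm_num) Real.exp_one_gt_d9
  have hK0 : 0 < K := by linarith
  set k := ⌈K / 4⌉₊ with hk
  have hk1 : 1 ≤ k := Nat.one_le_iff_ne_zero.2 (Nat.ceil_pos.2 (by positivity)).ne'
  set N := (2 * d + k).choose k with hN
  have hN2 : 2 ≤ N := by
    calc 2 ≤ k + 1 := by omega
      _ = (k + 1).choose k := (Nat.choose_succ_self_right k).symm
      _ ≤ N := Nat.choose_le_choose k (by omega)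
  have hN0 : (0 : ℝ) < N := by exact_mod_cast (by omega : 0 < N)
  have hlogN : 0 < Real.logb 2 N := Real.logb_pos (by norm_num) (by exact_mod_cast hN2)
  set Y := 2 * Real.exp 1 * (d / K) + 2 * Real.exp 1 with hY
  have hdK : 1 ≤ d / K := by rwa [one_le_div hK0]
  have hY8 : 8 ≤ Y := by nlinarith
  refine ⟨⌈Real.logb 2 N⌉₊, Nat.one_le_iff_ne_zero.2 (Nat.ceil_pos.2 hlogN).ne', ?_, ?_⟩
  · have h1 := Nat.le_ceil (Real.logb 2 N)
    rw [Real.logb_le_iff_le_rpow (by norm_num) hN0, Real.rpow_natCast] at h1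
    exact_mod_cast h1
  · refine (Nat.ceil_lt_add_one hlogN.le).le.trans ?_
    rcases le_or_gt K 4 with hK4 | hK4
    -- Here `N = 2d + 1`. The factor 2 pays for rounding up to an integer, and Bernoulli's
    -- inequality compares `2N` with `Y ^ K`.
    · have hk1' : k = 1 := le_antisymm (Nat.ceil_le.2 (by rw [Nat.cast_one]; linarith)) hk1
      have hN' : (N : ℝ) = 2 * d + 1 := by
        rw [hN, hk1', Nat.choose_one_right]; push_cast; ring
      have h1 : (N : ℝ) * 2 ≤ Y ^ K := by
        have hb := one_add_mul_self_le_rpow_one_add (s := d / K) (by linarith) hK1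
        rw [mul_div_cancel₀ _ hK0.ne'] at hb
        have hY' : Y = 2 * Real.exp 1 * (1 + d / K) := by rw [hY]; ring
        rw [hY', Real.mul_rpow (by positivity) (by positivity)]
        have h2 : 2 * Real.exp 1 ≤ (2 * Real.exp 1) ^ K :=
          Real.self_le_rpow_of_one_le (by linarith) hK1
        calc (N : ℝ) * 2 ≤ 2 * Real.exp 1 * (1 + d) := by rw [hN']; nlinarith
          _ ≤ _ := by gcongr
      have h2 := Real.logb_le_logb_of_le (b := 2) (by norm_num) (by positivity) h1
      rwa [Real.logb_mul hN0.ne' (by norm_num), Real.logb_self_eq_one (by norm_num),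
        Real.logb_rpow_eq_mul_logb_of_pos (by linarith)] at h2
    -- The estimate `C(n, k) ≤ (e n / k) ^ k` gives at most `k (2 + log₂ Y) + 1` bits; since `k ≤ K
    -- / 2` and `log₂ Y ≥ 3`, this fits under `K log₂ Y`.
    · have hk0 : (0 : ℝ) < k := by exact_mod_cast hk1
      have hkK : K / 4 ≤ k := Nat.le_ceil _
      have hkK2 : (k : ℝ) ≤ K / 2 := by
        have := Nat.ceil_lt_add_one (show 0 ≤ K / 4 by positivity)
        linarith
      have h1 : (N : ℝ) ≤ (4 * Y) ^ k := by
        have e1 : (N : ℝ) ≤ ((2 * d + k : ℕ) : ℝ) ^ k / k.factorial := Nat.choose_le_pow_div _ _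
        have e2 := Real.pow_div_factorial_le_exp (k : ℝ) hk0.le k
        have e3 : (0 : ℝ) < k.factorial := by exact_mod_cast k.factorial_pos
        have e4 : Real.exp (k : ℝ) = Real.exp 1 ^ k := by rw [← Real.exp_nat_mul, mul_one]
        rw [e4, div_le_iff₀ e3] at e2
        have e5 : ((2 * d + k : ℕ) : ℝ) ^ k / k.factorial ≤
            (Real.exp 1 * (2 * d + k) / k) ^ k := by
          rw [div_pow, mul_pow, div_le_div_iff₀ e3 (by positivity)]
          push_cast
          calc (2 * (d : ℝ) + k) ^ k * (k : ℝ) ^ k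
              ≤ (2 * (d : ℝ) + k) ^ k * (Real.exp 1 ^ k * k.factorial) := by gcongr
            _ = _ := by ring
        refine e1.trans (e5.trans ?_)
        gcongr
        rw [div_le_iff₀ hk0, hY]
        have e6 : (d : ℝ) ≤ 4 * (d / K) * k := by
          calc (d : ℝ) = 4 * (d / K) * (K / 4) := by field_simp
            _ ≤ _ := by gcongr
        nlinarith [mul_le_mul_of_nonneg_left e6 (Real.exp_pos 1).le,
          mul_pos (Real.exp_pos 1) hk0]
      have h2 := Real.logb_le_logb_of_le (b := 2) (by norm_num) hN0 h1
      rw [Real.logb_pow, Real.logb_mul (by norm_num) (by linarith)] at h2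
      have h4 : Real.logb 2 4 = 2 := by
        rw [show (4 : ℝ) = 2 ^ (2 : ℝ) by norm_num, Real.logb_rpow (by norm_num) (by norm_num)]
      have h8 : 3 ≤ Real.logb 2 Y := by
        rw [Real.le_logb_iff_rpow_le (by norm_num) (by linarith)]
        norm_num
        exact hY8
      rw [h4] at h2
      nlinarith

end CommOpt

namespace CommOpt

/-! ### Assouad's method on a tree with finite branching -/

section Tree

variable {𝒴 : Type}

/-- The probability of the sequence of outputs `y` for the conditional probabilities `k`. -/
def treeDensity (k : (n : ℕ) → (Fin n → 𝒴) → 𝒴 → ℝ) : (n : ℕ) → (Fin n → 𝒴) → ℝ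
  | 0, _ => 1
  | n + 1, y => treeDensity k n (Fin.init y) * k n (Fin.init y) (y (Fin.last n))

theorem treeDensity_snoc (k : (n : ℕ) → (Fin n → 𝒴) → 𝒴 → ℝ) (n : ℕ) (y : Fin n → 𝒴) (b : 𝒴) :
    treeDensity k (n + 1) (Fin.snoc y b : Fin (n + 1) → 𝒴) = treeDensity k n y * k n y b := by
  simp [treeDensity]

theorem treeDensity_nonneg {k : (n : ℕ) → (Fin n → 𝒴) → 𝒴 → ℝ} (h0 : ∀ n y b, 0 ≤ k n y b) (n : ℕ)
    (y : Fin n → 𝒴) : 0 ≤ treeDensity k n y := by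
  induction n with
  | zero => simp [treeDensity]
  | succ n ih => exact mul_nonneg (ih _) (h0 _ _ _)

variable [Fintype 𝒴]

theorem sum_snoc {n : ℕ} (F : (Fin (n + 1) → 𝒴) → ℝ) :
    ∑ y, F y = ∑ y : Fin n → 𝒴, ∑ b, F (Fin.snoc y b : Fin (n + 1) → 𝒴) := by
  rw [← (Fin.snocEquiv fun _ => 𝒴).sum_comp, Fintype.sum_prod_type, Finset.sum_comm]
  rfl

theorem sum_treeDensity {k : (n : ℕ) → (Fin n → 𝒴) → 𝒴 → ℝ} (h1 : ∀ n y, ∑ b, k n y b = 1) (n : ℕ) :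
    ∑ y, treeDensity k n y = 1 := by
  induction n with
  | zero => simp [treeDensity]
  | succ n ih => simp only [sum_snoc, treeDensity_snoc, ← Finset.mul_sum, h1, mul_one, ih]

theorem treeDensity_le_one {k : (n : ℕ) → (Fin n → 𝒴) → 𝒴 → ℝ} (h0 : ∀ n y b, 0 ≤ k n y b)
    (h1 : ∀ n y, ∑ b, k n y b = 1) (n : ℕ) (y : Fin n → 𝒴) : treeDensity k n y ≤ 1 := by
  rw [← sum_treeDensity h1 n]
  exact Finset.single_le_sum (fun y _ => treeDensity_nonneg h0 n y) (Finset.mem_univ y)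

variable {d : ℕ}

/-- The sign vector `v` with its `i`-th sign flipped. -/
def flip (v : Fin d → Bool) (i : Fin d) : Fin d → Bool := Function.update v i (!v i)

theorem flip_flip (v : Fin d → Bool) (i : Fin d) : flip (flip v i) i = v := by
  simp [flip]

theorem flip_self (v : Fin d → Bool) (i : Fin d) : flip v i i = !v i := by
  simp [flip]

theorem flip_of_ne {v : Fin d → Bool} {i j : Fin d} (h : j ≠ i) : flip v i j = v j := by
  simp [flip, h]

theorem sum_flip (F : (Fin d → Bool) → ℝ) (i : Fin d) : ∑ v, F (flip v i) = ∑ v, F v :=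
  Equiv.sum_comp (Function.Involutive.toPerm (fun v => flip v i) fun v => flip_flip v i) F

theorem sqrt_mul_le_half_add {x y : ℝ} (hx : 0 ≤ x) (hy : 0 ≤ y) : √(x * y) ≤ (x + y) / 2 := by
  rw [Real.sqrt_mul hx]
  nlinarith [sq_nonneg (√x - √y), Real.sq_sqrt hx, Real.sq_sqrt hy]

/-- After summation this bounds the error of a two-point test from below linearly in the affinity,
without passing through total variation. -/
theorem sqrt_mul_le_min_add {x y : ℝ} (hx : 0 ≤ x) (hy : 0 ≤ y) :
    √(x * y) - (x + y) / 4 ≤ min x y := by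
  rw [Real.sqrt_mul hx, le_min_iff]
  constructor
  · nlinarith [sq_nonneg (√x - √y / 2), Real.sq_sqrt hx, Real.sq_sqrt hy]
  · nlinarith [sq_nonneg (√x / 2 - √y), Real.sq_sqrt hx, Real.sq_sqrt hy]

variable {k : (Fin d → Bool) → (n : ℕ) → (Fin n → 𝒴) → 𝒴 → ℝ}

/-- At each node the affinity is multiplied by `1 - h / 2`, with `h` the squared Hellinger distance
of the two conditional laws. Replacing the geometric mean of the two densities by the arithmetic
mean and using the symmetry of `h` under the flip, the loss summed over all pairs is at most `2 ^ d
* J / 2` per round. Adaptivity is harmless because `J` bounds every node. -/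
theorem le_sum_affinity (h0 : ∀ v n y b, 0 ≤ k v n y b) (h1 : ∀ v n y, ∑ b, k v n y b = 1) {J : ℝ}
    (hJ : ∀ v n y, ∑ i, ∑ b, (√(k v n y b) - √(k (flip v i) n y b)) ^ 2 ≤ J) (n : ℕ) :
    2 ^ d * (d - n * J / 2) ≤
      ∑ v, ∑ i, ∑ y, √(treeDensity (k v) n y * treeDensity (k (flip v i)) n y) := by
  induction n with
  | zero => simp [treeDensity]
  | succ n ih =>
    set h : (Fin d → Bool) → Fin d → (Fin n → 𝒴) → ℝ := fun v i y =>
      ∑ b, (√(k v n y b) - √(k (flip v i) n y b)) ^ 2 with hh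
    have hh0 : ∀ v i y, 0 ≤ h v i y := fun v i y => Finset.sum_nonneg fun b _ => sq_nonneg _
    have hsymm : ∀ v i y, h (flip v i) i y = h v i y := fun v i y => by
      simp only [hh, flip_flip]
      exact Finset.sum_congr rfl fun b _ => by ring
    set ℓ : (Fin d → Bool) → (Fin n → 𝒴) → ℝ := fun v y => treeDensity (k v) n y with hℓ
    have hℓ0 : ∀ v y, 0 ≤ ℓ v y := fun v y => treeDensity_nonneg (h0 v) n y
    have hstep : ∀ v i, ∑ y, √(treeDensity (k v) (n + 1) y * treeDensity (k (flip v i)) (n + 1) y) ≥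
        ∑ y, √(ℓ v y * ℓ (flip v i) y) -
          1 / 4 * (∑ y, ℓ v y * h v i y + ∑ y, ℓ (flip v i) y * h v i y) := by
      intro v i
      rw [sum_snoc, ← Finset.sum_add_distrib, Finset.mul_sum, ← Finset.sum_sub_distrib]
      refine Finset.sum_le_sum fun y _ => ?_
      have e1 : ∀ b, √(treeDensity (k v) (n + 1) (Fin.snoc y b : Fin (n + 1) → 𝒴) *
          treeDensity (k (flip v i)) (n + 1) (Fin.snoc y b : Fin (n + 1) → 𝒴)) =
          √(ℓ v y * ℓ (flip v i) y) * (√(k v n y b) * √(k (flip v i) n y b)) := fun b => by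
        rw [treeDensity_snoc, treeDensity_snoc, ← Real.sqrt_mul (h0 _ _ _ _), ← Real.sqrt_mul
          (mul_nonneg (hℓ0 _ _) (hℓ0 _ _))]
        congr 1
        ring
      simp only [e1, ← Finset.mul_sum]
      have e2 : ∑ b, √(k v n y b) * √(k (flip v i) n y b) = 1 - h v i y / 2 := by
        have : h v i y = ∑ b, (k v n y b + k (flip v i) n y b -
            2 * (√(k v n y b) * √(k (flip v i) n y b))) := by
          refine Finset.sum_congr rfl fun b _ => ?_
          rw [sub_sq, Real.sq_sqrt (h0 _ _ _ _), Real.sq_sqrt (h0 _ _ _ _)]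
          ring
        rw [this, Finset.sum_sub_distrib, Finset.sum_add_distrib, h1, h1, ← Finset.mul_sum]
        ring
      rw [e2]
      nlinarith [mul_le_mul_of_nonneg_right (sqrt_mul_le_half_add (hℓ0 v y) (hℓ0 (flip v i) y))
        (hh0 v i y)]
    have hA : ∑ v, ∑ i, ∑ y, ℓ v y * h v i y ≤ 2 ^ d * J := by
      calc ∑ v, ∑ i, ∑ y, ℓ v y * h v i y = ∑ v, ∑ y, ℓ v y * ∑ i, h v i y := by
            refine Finset.sum_congr rfl fun v _ => ?_
            rw [Finset.sum_comm]
            simp only [Finset.mul_sum]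
        _ ≤ ∑ v, ∑ y, ℓ v y * J := by
            gcongr with v _ y _
            · exact hℓ0 v y
            · exact hJ v n y
        _ = 2 ^ d * J := by
            simp only [← Finset.sum_mul, hℓ, sum_treeDensity (h1 _)]
            simp
    have hB : ∑ v, ∑ i, ∑ y, ℓ (flip v i) y * h v i y = ∑ v, ∑ i, ∑ y, ℓ v y * h v i y := by
      rw [Finset.sum_comm, Finset.sum_comm (f := fun v i => ∑ y, ℓ v y * h v i y)]
      refine Finset.sum_congr rfl fun i _ => ?_
      rw [← sum_flip (fun v => ∑ y, ℓ v y * h v i y) i]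
      simp only [hsymm]
    have hsum := Finset.sum_le_sum fun v (_ : v ∈ Finset.univ) =>
      Finset.sum_le_sum fun i (_ : i ∈ Finset.univ) => hstep v i
    simp only [Finset.sum_sub_distrib, ← Finset.mul_sum, Finset.sum_add_distrib] at hsum
    rw [hB] at hsum
    push_cast
    linarith

/-- Pairing `v` with `flip v i` counts the total loss twice, and each pair is a two-point test with
the soft decision `t`. The affinities sum to at least `2 ^ d * 3d/4`; subtracting `2 ^ d * d/2`
leaves twice the claimed bound. -/
theorem le_sum_loss (h0 : ∀ v n y b, 0 ≤ k v n y b) (h1 : ∀ v n y, ∑ b, k v n y b = 1) {J : ℝ}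
    (hJ : ∀ v n y, ∑ i, ∑ b, (√(k v n y b) - √(k (flip v i) n y b)) ^ 2 ≤ J) {T : ℕ}
    (hTJ : T * J ≤ d / 2) {t : Fin d → (Fin T → 𝒴) → ℝ} (ht0 : ∀ i y, 0 ≤ t i y)
    (ht1 : ∀ i y, t i y ≤ 1) :
    2 ^ d * (d / 8 : ℝ) ≤ ∑ v, ∑ y, treeDensity (k v) T y *
      ∑ i, if v i then t i y else 1 - t i y := by
  set ℓ : (Fin d → Bool) → (Fin T → 𝒴) → ℝ := fun v y => treeDensity (k v) T y with hℓ
  have hℓ0 : ∀ v y, 0 ≤ ℓ v y := fun v y => treeDensity_nonneg (h0 v) T y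
  set τ : (Fin d → Bool) → Fin d → (Fin T → 𝒴) → ℝ := fun v i y =>
    if v i then t i y else 1 - t i y with hτ
  have hτflip : ∀ v i y, τ (flip v i) i y = 1 - τ v i y := fun v i y => by
    simp only [hτ, flip_self]
    cases v i <;> simp
  have hτ0 : ∀ v i y, 0 ≤ τ v i y ∧ τ v i y ≤ 1 := fun v i y => by
    have := ht0 i y
    have := ht1 i y
    simp only [hτ]
    split_ifs <;> constructor <;> linarith
  have hS : ∑ v, ∑ y, ℓ v y * ∑ i, τ v i y = ∑ v, ∑ i, ∑ y, ℓ v y * τ v i y := by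
    refine Finset.sum_congr rfl fun v _ => ?_
    rw [Finset.sum_comm]
    simp only [Finset.mul_sum]
  have hS' : ∑ v, ∑ i, ∑ y, ℓ (flip v i) y * (1 - τ v i y) = ∑ v, ∑ i, ∑ y, ℓ v y * τ v i y := by
    rw [Finset.sum_comm, Finset.sum_comm (f := fun v i => ∑ y, ℓ v y * τ v i y)]
    refine Finset.sum_congr rfl fun i _ => ?_
    rw [← sum_flip (fun v => ∑ y, ℓ v y * τ v i y) i]
    simp only [hτflip]
  have hpt : ∀ v i y, √(ℓ v y * ℓ (flip v i) y) - (ℓ v y + ℓ (flip v i) y) / 4 ≤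
      ℓ v y * τ v i y + ℓ (flip v i) y * (1 - τ v i y) := fun v i y => by
    refine (sqrt_mul_le_min_add (hℓ0 v y) (hℓ0 (flip v i) y)).trans ?_
    have h2 := min_le_left (ℓ v y) (ℓ (flip v i) y)
    have h3 := min_le_right (ℓ v y) (ℓ (flip v i) y)
    nlinarith [mul_le_mul_of_nonneg_right h2 (hτ0 v i y).1,
      mul_le_mul_of_nonneg_right h3 (sub_nonneg.2 (hτ0 v i y).2)]
  have hsum := Finset.sum_le_sum fun v (_ : v ∈ Finset.univ) =>
    Finset.sum_le_sum fun i (_ : i ∈ Finset.univ) =>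
      Finset.sum_le_sum fun y (_ : y ∈ Finset.univ) => hpt v i y
  simp only [Finset.sum_sub_distrib, Finset.sum_add_distrib, ← Finset.sum_div] at hsum
  rw [hS'] at hsum
  have hone : ∀ v, ∑ y, ℓ v y = 1 := fun v => sum_treeDensity (h1 v) T
  simp only [hone] at hsum
  have haff := le_sum_affinity h0 h1 hJ T
  rw [hS]
  simp at hsum
  have : (2 : ℝ) ^ d * (d - T * J / 2) ≥ 2 ^ d * (d - (d / 2) / 2) := by gcongr
  linarith

end Tree

/-! ### Information bounds -/

section Information

variable {ι Ω : Type*} [Fintype ι] [Fintype Ω]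

/-- Hellinger distance is dominated by the chi-square distance, because `(κ' - κ)² = (√κ - √κ')² (√κ
+ √κ')²`. If `κ = 0`, the hypothesis forces all `κ' i` to vanish. -/
theorem sum_sqrt_sub_sq_le {κ S : ℝ} {κ' : ι → ℝ} (hκ : 0 ≤ κ) (hκ' : ∀ i, 0 ≤ κ' i) (hS : 0 ≤ S)
    (h : ∑ i, (κ' i - κ) ^ 2 ≤ S * κ) : ∑ i, (√κ - √(κ' i)) ^ 2 ≤ S := by
  rcases hκ.eq_or_lt with h0 | h0
  · rw [← h0, mul_zero] at h
    have h1 := (Finset.sum_eq_zero_iff_of_nonneg fun i _ => sq_nonneg _).1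
      (le_antisymm h (Finset.sum_nonneg fun i _ => sq_nonneg (κ' i - 0)))
    have h2 : ∀ i, κ' i = 0 := fun i => by simpa using h1 i (Finset.mem_univ i)
    simpa [← h0, h2] using hS
  · refine le_of_mul_le_mul_right (le_trans ?_ h) h0
    rw [Finset.sum_mul]
    refine Finset.sum_le_sum fun i _ => ?_
    have e1 : (κ' i - κ) ^ 2 = (√κ - √(κ' i)) ^ 2 * (√κ + √(κ' i)) ^ 2 := by
      rw [← mul_pow]
      have : (√κ - √(κ' i)) * (√κ + √(κ' i)) = √κ ^ 2 - √(κ' i) ^ 2 := by ring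
      rw [this, Real.sq_sqrt hκ, Real.sq_sqrt (hκ' i)]
      ring
    rw [e1]
    gcongr
    calc κ = √κ ^ 2 := (Real.sq_sqrt hκ).symm
      _ ≤ _ := by
        have := Real.sqrt_nonneg (κ' i)
        gcongr
        linarith

/-- For a centred bounded variable the linear term integrates to zero, which leaves a subgaussian
moment generating function. -/
theorem exp_le_add_exp_sq (x : ℝ) : Real.exp x ≤ x + Real.exp (x ^ 2) := by
  rcases le_or_gt |x| 1 with h | h
  · have h1 := (abs_le.1 (Real.abs_exp_sub_one_sub_id_le h)).2
    have h2 := Real.add_one_le_exp (x ^ 2)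
    linarith
  · rcases le_total 0 x with h0 | h0
    · rw [abs_of_nonneg h0] at h
      have : Real.exp x ≤ Real.exp (x ^ 2) := Real.exp_le_exp.2 (by nlinarith)
      linarith
    · rw [abs_of_nonpos h0] at h
      have h1 : Real.exp x ≤ 1 := Real.exp_le_one_iff.2 h0
      have h2 := Real.add_one_le_exp (x ^ 2)
      nlinarith

/-- The level-one inequality for functions with subgaussian joint moment generating function. -/
theorem sum_sq_le_log {w W : Ω → ℝ} (hw : ∀ ω, 0 ≤ w ω) (hW0 : ∀ ω, 0 ≤ W ω) (hW1 : ∀ ω, W ω ≤ 1)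
    {φ : ι → Ω → ℝ} {τ : ℝ} (hτ : 0 < τ)
    (hφ : ∀ c : ι → ℝ, ∑ ω, w ω * Real.exp (∑ i, c i * φ i ω) ≤ Real.exp (τ * ∑ i, c i ^ 2))
    (hα : 0 < ∑ ω, w ω * W ω) :
    ∑ i, (∑ ω, w ω * W ω * φ i ω) ^ 2 ≤
      4 * τ * (∑ ω, w ω * W ω) ^ 2 * -Real.log (∑ ω, w ω * W ω) := by
  set α := ∑ ω, w ω * W ω with hαdef
  set a : ι → ℝ := fun i => (∑ ω, w ω * W ω * φ i ω) / α with ha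
  set S := ∑ i, a i ^ 2 with hS
  -- This `c` maximizes `∑ i, c i * a i - τ * ∑ i, c i ^ 2`. Jensen's inequality under the law with
  -- weights `w W / α` and the bound `W ≤ 1` limit that maximum by `-log α`.
  set c : ι → ℝ := fun i => 1 / (2 * τ) * a i with hc
  have hlin : ∑ ω, w ω * W ω / α * (∑ i, c i * φ i ω) = 1 / (2 * τ) * S := by
    calc ∑ ω, w ω * W ω / α * (∑ i, c i * φ i ω)
        = ∑ ω, ∑ i, c i * (w ω * W ω * φ i ω / α) := by
          refine Finset.sum_congr rfl fun ω _ => ?_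
          rw [Finset.mul_sum]
          exact Finset.sum_congr rfl fun i _ => by ring
      _ = ∑ i, c i * a i := by
          rw [Finset.sum_comm]
          simp only [← Finset.mul_sum, ha, Finset.sum_div]
      _ = 1 / (2 * τ) * S := by
          simp only [hc, hS, Finset.mul_sum]
          exact Finset.sum_congr rfl fun i _ => by ring
  have hjensen := convexOn_exp.map_sum_le (t := Finset.univ) (w := fun ω => w ω * W ω / α)
    (p := fun ω => ∑ i, c i * φ i ω)
    (fun ω _ => div_nonneg (mul_nonneg (hw ω) (hW0 ω)) hα.le)
    (by rw [← Finset.sum_div, ← hαdef, div_self hα.ne']) (fun _ _ => Set.mem_univ _)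
  simp only [smul_eq_mul] at hjensen
  rw [hlin] at hjensen
  have h2 : ∑ ω, w ω * W ω / α * Real.exp (∑ i, c i * φ i ω) ≤
      1 / α * Real.exp (τ * ∑ i, c i ^ 2) := by
    refine le_trans ?_ (mul_le_mul_of_nonneg_left (hφ c) (by positivity))
    rw [Finset.mul_sum]
    refine Finset.sum_le_sum fun ω _ => ?_
    calc w ω * W ω / α * Real.exp (∑ i, c i * φ i ω)
        = 1 / α * (w ω * Real.exp (∑ i, c i * φ i ω)) * W ω := by ring
      _ ≤ 1 / α * (w ω * Real.exp (∑ i, c i * φ i ω)) * 1 := by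
        have := hw ω
        gcongr
        exact hW1 ω
      _ = _ := mul_one _
  have h3 : ∑ i, c i ^ 2 = (1 / (2 * τ)) ^ 2 * S := by
    simp only [hc, hS, mul_pow, Finset.mul_sum]
  have h4 := Real.log_le_log (Real.exp_pos _) (hjensen.trans h2)
  rw [Real.log_mul (by positivity) (Real.exp_pos _).ne', Real.log_exp, Real.log_exp, h3,
    one_div α, Real.log_inv] at h4
  have h5 : τ * ((1 / (2 * τ)) ^ 2 * S) = 1 / (4 * τ) * S := by field_simp; ring
  have h6 : 1 / (2 * τ) * S = 1 / (4 * τ) * S + 1 / (4 * τ) * S := by field_simp; ring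
  have h7 : S ≤ 4 * τ * -Real.log α := by
    have : 1 / (4 * τ) * S ≤ -Real.log α := by linarith
    calc S = 4 * τ * (1 / (4 * τ) * S) := by field_simp
      _ ≤ _ := by gcongr
  have h8 : ∑ i, (∑ ω, w ω * W ω * φ i ω) ^ 2 = α ^ 2 * S := by
    simp only [hS, ha, Finset.mul_sum]
    refine Finset.sum_congr rfl fun i _ => ?_
    rw [div_pow]
    field_simp
  rw [h8]
  nlinarith [mul_le_mul_of_nonneg_left h7 (sq_nonneg α)]

theorem sum_negMulLog_le {𝒴 : Type*} [Fintype 𝒴] [Nonempty 𝒴] {κ : 𝒴 → ℝ} (h0 : ∀ b, 0 ≤ κ b)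
    (h1 : ∑ b, κ b = 1) : ∑ b, κ b * -Real.log (κ b) ≤ Real.log (Fintype.card 𝒴) := by
  have hN : (0 : ℝ) < Fintype.card 𝒴 := by exact_mod_cast Fintype.card_pos
  set N : ℝ := (Fintype.card 𝒴 : ℝ) with hNdef
  have h : ∀ b, κ b * -Real.log (κ b) ≤ κ b * Real.log N + (1 / N - κ b) := by
    intro b
    rcases (h0 b).eq_or_lt with hb | hb
    · rw [← hb]; simp [hN.le]
    · have := Real.log_le_sub_one_of_pos (show 0 < 1 / (κ b * N) by positivity)
      rw [one_div, Real.log_inv, Real.log_mul hb.ne' hN.ne'] at this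
      have h2 := mul_le_mul_of_nonneg_left this hb.le
      have h3 : κ b * ((κ b * N)⁻¹ - 1) = 1 / N - κ b := by field_simp
      linarith
  refine (Finset.sum_le_sum fun b _ => h b).trans (le_of_eq ?_)
  rw [Finset.sum_add_distrib, ← Finset.sum_mul, h1, Finset.sum_sub_distrib, h1]
  simp [← hNdef, hN.ne']

end Information

end CommOpt

namespace CommOpt

variable {d : ℕ} {p : ℝ≥0∞}

/-! ### Oracles with finitely many values -/

section FiniteOracle

variable {Ω : Type} [Fintype Ω]

/-- The law of `val ω` for `ω` drawn with probability `w ω`. -/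
noncomputable def finiteLaw (w : Ω → ℝ) (val : Ω → Fin d → ℝ) : Measure (Fin d → ℝ) :=
  ∑ ω, ENNReal.ofReal (w ω) • Measure.dirac (val ω)

theorem isProbabilityMeasure_finiteLaw {w : Ω → ℝ} (hw0 : ∀ ω, 0 ≤ w ω) (hw1 : ∑ ω, w ω = 1)
    (val : Ω → Fin d → ℝ) : IsProbabilityMeasure (finiteLaw w val) := by
  constructor
  simp only [finiteLaw, Measure.coe_finsetSum, Finset.sum_apply, Measure.smul_apply, measure_univ,
    smul_eq_mul, mul_one]
  rw [← ENNReal.ofReal_sum_of_nonneg fun ω _ => hw0 ω, hw1, ENNReal.ofReal_one]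

theorem integral_finiteLaw {E : Type*} [NormedAddCommGroup E] [NormedSpace ℝ E] [CompleteSpace E]
    {w : Ω → ℝ} (hw0 : ∀ ω, 0 ≤ w ω) (val : Ω → Fin d → ℝ) (f : (Fin d → ℝ) → E) :
    ∫ g, f g ∂(finiteLaw w val) = ∑ ω, w ω • f (val ω) := by
  rw [finiteLaw, integral_finsetSum_measure fun ω _ =>
    (integrable_dirac enorm_lt_top).smul_measure ENNReal.ofReal_ne_top]
  simp only [integral_smul_measure, integral_dirac, ENNReal.toReal_ofReal (hw0 _)]

theorem ae_finiteLaw (w : Ω → ℝ) {val : Ω → Fin d → ℝ} {q : (Fin d → ℝ) → Prop}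
    (h : ∀ ω, q (val ω)) : ∀ᵐ g ∂(finiteLaw w val), q g := by
  rw [ae_iff, finiteLaw]
  simp only [Measure.coe_finsetSum, Finset.sum_apply, Measure.smul_apply, smul_eq_mul]
  refine Finset.sum_eq_zero fun ω _ => ?_
  simp [h ω]

variable {X : Set (Fin d → ℝ)} {𝒴 : Type} [MeasurableSpace 𝒴] {𝒲 : Set (Kernel (Fin d → ℝ) 𝒴)}
  {T : ℕ}

namespace Protocol

/-- The conditional probability of the output `b` in round `n`, given the seed `u` and the earlier
outputs `y`, when the oracle returns `val ω` with probability `w ω`. -/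
noncomputable def stepProb (P : Protocol X 𝒲 T) (w : Ω → ℝ) (val : Ω → Fin d → ℝ) (u : ℝ) (n : ℕ)
    (y : Fin n → 𝒴) (b : 𝒴) : ℝ :=
  ∑ ω, w ω * (P.channel n ((u, y), val ω)).real {b}

theorem stepProb_nonneg (P : Protocol X 𝒲 T) {w : Ω → ℝ} (hw0 : ∀ ω, 0 ≤ w ω)
    (val : Ω → Fin d → ℝ) (u : ℝ) (n : ℕ) (y : Fin n → 𝒴) (b : 𝒴) :
    0 ≤ P.stepProb w val u n y b :=
  Finset.sum_nonneg fun ω _ => mul_nonneg (hw0 ω) measureReal_nonneg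

variable [MeasurableSingletonClass 𝒴]

theorem measurable_stepProb (P : Protocol X 𝒲 T) (w : Ω → ℝ) (val : Ω → Fin d → ℝ) (n : ℕ) (b : 𝒴) :
    Measurable fun z : ℝ × (Fin n → 𝒴) => P.stepProb w val z.1 n z.2 b := by
  refine Finset.measurable_sum _ fun ω _ => Measurable.const_mul ?_ _
  exact ((P.channel n).measurable_coe (measurableSet_singleton b)).ennreal_toReal.comp
    measurable_prodMk_right

theorem measurable_treeDensity (P : Protocol X 𝒲 T) (w : Ω → ℝ) (val : Ω → Fin d → ℝ) (n : ℕ)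
    (y : Fin n → 𝒴) : Measurable fun u => treeDensity (P.stepProb w val u) n y := by
  induction n with
  | zero => exact measurable_const
  | succ n ih =>
    simp only [treeDensity]
    generalize (Fin.init y : Fin n → 𝒴) = y'
    have h : Measurable fun u : ℝ => (u, y') := by fun_prop
    generalize y (Fin.last n) = b
    have h' := (P.measurable_stepProb w val n b).comp h
    simp only [Function.comp_def] at h'
    exact (ih y').mul h'

variable [Fintype 𝒴]

theorem sum_channel_real (P : Protocol X 𝒲 T) (n : ℕ) (z : (ℝ × (Fin n → 𝒴)) × (Fin d → ℝ)) :
    ∑ b, (P.channel n z).real {b} = 1 := by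
  have := P.isMarkovKernel_channel n
  simp

theorem sum_stepProb (P : Protocol X 𝒲 T) {w : Ω → ℝ} (hw1 : ∑ ω, w ω = 1)
    (val : Ω → Fin d → ℝ) (u : ℝ) (n : ℕ) (y : Fin n → 𝒴) :
    ∑ b, P.stepProb w val u n y b = 1 := by
  unfold stepProb
  rw [Finset.sum_comm]
  simp only [← Finset.mul_sum, sum_channel_real, mul_one, hw1]

/-- The law of the channel outputs for an oracle with finitely many values. -/
theorem integral_law_eq (P : Protocol X 𝒲 T) {w : Ω → ℝ} (hw0 : ∀ ω, 0 ≤ w ω)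
    (hw1 : ∑ ω, w ω = 1) (val : Ω → Fin d → ℝ) (n : ℕ) {F : ℝ × (Fin n → 𝒴) → ℝ} (hF : Measurable F)
    {C : ℝ} (hC : ∀ z, |F z| ≤ C) :
    ∫ z, F z ∂(P.law (fun _ => Kernel.const X (finiteLaw w val)) n) =
      ∫ u, ∑ y, treeDensity (P.stepProb w val u) n y * F (u, y) ∂P.seed := by
  have := isProbabilityMeasure_finiteLaw hw0 hw1 val
  induction n generalizing C with
  | zero =>
    rw [P.integral_law_zero _ hF]
    refine integral_congr_ae (ae_of_all _ fun u => ?_)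
    simp [treeDensity, Subsingleton.elim (default : Fin 0 → 𝒴) Fin.elim0]
  | succ n ih =>
    have hFs : Measurable fun z : (ℝ × (Fin n → 𝒴)) × 𝒴 =>
        F (z.1.1, (Fin.snoc z.1.2 z.2 : Fin (n + 1) → 𝒴)) := hF.comp (measurable_snoc n)
    have hinner : ∀ z : ℝ × (Fin n → 𝒴), ∫ b, F (z.1, (Fin.snoc z.2 b : Fin (n + 1) → 𝒴))
        ∂(P.step (fun _ => Kernel.const X (finiteLaw w val)) n z) =
        ∑ b, P.stepProb w val z.1 n z.2 b * F (z.1, (Fin.snoc z.2 b : Fin (n + 1) → 𝒴)) := by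
      intro z
      have := P.isMarkovKernel_channel n
      rw [P.integral_step _ n z (h := fun b => F (z.1, (Fin.snoc z.2 b : Fin (n + 1) → 𝒴)))
        (hFs.comp measurable_prodMk_left) fun b => hC _, Kernel.const_apply,
        integral_finiteLaw hw0]
      simp only [integral_fintype Integrable.of_finite, smul_eq_mul, stepProb, Finset.sum_mul,
        Finset.mul_sum]
      rw [Finset.sum_comm]
      exact Finset.sum_congr rfl fun b _ => Finset.sum_congr rfl fun ω _ => by ring
    rw [P.integral_law_succ _ n hF hC]
    simp only [hinner]
    rw [ih (C := C)]
    · refine integral_congr_ae (ae_of_all _ fun u => ?_)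
      simp only [sum_snoc, treeDensity_snoc, Finset.mul_sum, mul_assoc]
    · exact Finset.measurable_sum _ fun b _ => (P.measurable_stepProb w val n b).mul
        (hFs.comp measurable_prodMk_right)
    · intro z
      rw [← hinner]
      refine (norm_integral_le_of_norm_le_const (C := C)
        (f := fun b => F (z.1, (Fin.snoc z.2 b : Fin (n + 1) → 𝒴)))
        (ae_of_all _ fun b => hC _)).trans ?_
      simp

end Protocol

end FiniteOracle

/-! ### The lower bound for linear functions on a cube -/

/-- The sign of a bit. -/
def sgn (b : Bool) : ℝ := if b then 1 else -1

theorem sgn_not (b : Bool) : sgn (!b) = - sgn b := by cases b <;> simp [sgn]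

theorem sgn_mul_self (b : Bool) : sgn b * sgn b = 1 := by cases b <;> simp [sgn]

theorem abs_sgn (b : Bool) : |sgn b| = 1 := by cases b <;> simp [sgn]

/-- The cube with half side `a`. -/
def cube (d : ℕ) (a : ℝ) : Set (Fin d → ℝ) := {x | ∀ i, |x i| ≤ a}

theorem cube_eq_Icc (d : ℕ) (a : ℝ) : cube d a = Set.Icc (fun _ => -a) (fun _ => a) := by
  ext x
  simp only [cube, Set.mem_ofPred_eq, abs_le, Set.mem_Icc, Pi.le_def, forall_and]

theorem cube_mem_domains (hp : 1 ≤ p) (hd : 1 ≤ d) {D : ℝ} (hD : 0 < D) :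
    cube d (D / (2 * (d : ℝ) ^ recip p)) ∈ domains d p D := by
  have hd0 : (0 : ℝ) < d := by exact_mod_cast hd
  set a := D / (2 * (d : ℝ) ^ recip p) with ha
  have ha0 : 0 < a := by positivity
  refine ⟨⟨0, fun i => by simpa using ha0.le⟩, ?_, ?_, fun x hx y hy => ?_⟩
  · rw [cube_eq_Icc]; exact isClosed_Icc
  · rw [cube_eq_Icc]; exact convex_Icc _ _
  · refine (lpNorm_le_of_abs_le hp (c := 2 * a) (by positivity) fun i => ?_).trans (le_of_eq ?_)
    · refine (abs_sub _ _).trans ?_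
      have := hx i
      have := hy i
      linarith
    · rw [ha]; field_simp

variable {𝒴 : Type} [MeasurableSpace 𝒴] [MeasurableSingletonClass 𝒴] [Fintype 𝒴]

/-- Assouad's lower bound for linear functions `κ ⟨v, x⟩` on a cube, for a family of oracles indexed
by the sign vectors `v`. -/
theorem le_minmaxError_cube {Ω : Type} [Fintype Ω] {B a κ J : ℝ} (ha : 0 < a) (hκ : 0 < κ)
    {w : (Fin d → Bool) → Ω → ℝ} (hw0 : ∀ v ω, 0 ≤ w v ω) (hw1 : ∀ v, ∑ ω, w v ω = 1)
    {val : Ω → Fin d → ℝ} (hval : ∀ ω, lpNorm (holderConj p) (val ω) ≤ B)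
    (hmean : ∀ v i, ∑ ω, w v ω * val ω i = κ * sgn (v i))
    (hJ : ∀ W : Ω → 𝒴 → ℝ, (∀ ω b, 0 ≤ W ω b) → (∀ ω, ∑ b, W ω b = 1) → ∀ v,
      ∑ i, ∑ b, (√(∑ ω, w v ω * W ω b) - √(∑ ω, w (flip v i) ω * W ω b)) ^ 2 ≤ J)
    {T : ℕ} (hTJ : T * J ≤ d / 2) (𝒲 : Set (Kernel (Fin d → ℝ) 𝒴)) :
    ((κ * a * d / 4 : ℝ) : EReal) ≤ minmaxError p B T 𝒲 (cube d a) := by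
  refine le_iInf fun P => ?_
  set f : (Fin d → Bool) → (Fin d → ℝ) → ℝ := fun v x => (fun i => κ * sgn (v i)) ⬝ᵥ x with hf
  set O : (Fin d → Bool) → ℕ → Kernel (cube d a) (Fin d → ℝ) := fun v _ =>
    Kernel.const _ (finiteLaw (w v) val) with hO
  have hprob := fun v => isProbabilityMeasure_finiteLaw (hw0 v) (hw1 v) val
  have hcube : Convex ℝ (cube d a) := by
    rw [cube_eq_Icc]; exact convex_Icc _ _
  have hfam : ∀ v, (f v, O v) ∈ convexLipschitzFamily p B (cube d a) := by
    intro v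
    have hm : ∫ g, g ∂(finiteLaw (w v) val) = fun i => κ * sgn (v i) := by
      rw [integral_finiteLaw (hw0 v)]
      funext i
      rw [← hmean, Finset.sum_apply]
      rfl
    refine ⟨⟨hcube, fun x _ y _ s t _ _ _ => ?_⟩, fun n => ⟨by simp only [hO]; infer_instance,
      fun x => ⟨?_, ?_⟩⟩⟩
    · simp only [hf, dotProduct_add, dotProduct_smul]
      exact le_rfl
    · simp only [hO, Kernel.const_apply]
      rw [hm]
      intro y _
      simp only [hf, dotProduct_sub]
      linarith
    · simp only [hO, Kernel.const_apply]
      refine ae_finiteLaw _ fun ω => ?_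
      have := lpNorm_nonneg (one_le_holderConj p) (val ω)
      have := hval ω
      gcongr
  have hfb : ∀ v, ∀ x : cube d a, |f v x| ≤ d * (κ * a) := by
    intro v x
    simp only [hf, dotProduct]
    refine (Finset.abs_sum_le_sum_abs _ _).trans ?_
    calc ∑ i, |κ * sgn (v i) * (x : Fin d → ℝ) i| ≤ ∑ _i : Fin d, κ * a := by
          refine Finset.sum_le_sum fun i _ => ?_
          rw [abs_mul, abs_mul, abs_sgn, mul_one, abs_of_pos hκ]
          have := x.2 i
          gcongr
      _ = _ := by simp
  have hinf : ∀ v, ⨅ x : cube d a, f v x ≤ -(κ * a * d) := by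
    intro v
    have hmem : (fun i => -a * sgn (v i)) ∈ cube d a := fun i => by
      rw [abs_mul, abs_neg, abs_sgn, abs_of_pos ha, mul_one]
    have hbdd : BddBelow (Set.range fun x : cube d a => f v x) :=
      ⟨-(d * (κ * a)), by rintro _ ⟨x, rfl⟩; exact (abs_le.1 (hfb v x)).1⟩
    refine (ciInf_le hbdd ⟨_, hmem⟩).trans (le_of_eq ?_)
    simp only [hf, dotProduct]
    have : ∀ i, κ * sgn (v i) * (-a * sgn (v i)) = -(κ * a) := fun i => by
      have := sgn_mul_self (v i)
      linear_combination (-κ * a) * this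
    simp only [this, Finset.sum_const, Finset.card_univ, Fintype.card_fin, nsmul_eq_mul]
    ring
  -- The output coordinate, rescaled to `[0, 1]`, serves as a soft guess of the `i`-th sign: the
  -- minimizer has coordinate `-a` when the sign is positive. The excess error is `2 * a * κ` times
  -- the total soft loss.
  set t : ℝ → Fin d → (Fin T → 𝒴) → ℝ := fun u i y => ((P.output (u, y) : Fin d → ℝ) i + a) / (2 * a)
    with ht
  have ht0 : ∀ u i y, 0 ≤ t u i y := fun u i y => by
    have := (abs_le.1 ((P.output (u, y)).2 i)).1
    exact div_nonneg (by linarith) (by positivity)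
  have ht1 : ∀ u i y, t u i y ≤ 1 := fun u i y => by
    have := (abs_le.1 ((P.output (u, y)).2 i)).2
    simp only [ht]
    rw [div_le_one (by positivity)]
    linarith
  set G : (Fin d → Bool) → ℝ × (Fin T → 𝒴) → ℝ := fun v z => f v (P.output z) + κ * a * d with hG
  have hGm : ∀ v, Measurable (G v) := fun v => by
    have h1 : Continuous (f v) := by simp only [hf]; fun_prop
    exact (h1.measurable.comp (measurable_subtype_coe.comp P.measurable_output)).add_const _
  have hGb : ∀ v z, |G v z| ≤ d * (κ * a) + κ * a * d := fun v z => by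
    refine (abs_add_le _ _).trans ?_
    rw [abs_of_nonneg (show 0 ≤ κ * a * d by positivity)]
    have := hfb v (P.output z)
    linarith
  have hGt : ∀ v u y, G v (u, y) = 2 * a * κ * ∑ i, if v i then t u i y else 1 - t u i y := by
    intro v u y
    have e : κ * a * d = ∑ _i : Fin d, κ * a := by simp; ring
    simp only [hG, hf, dotProduct, e]
    rw [← Finset.sum_add_distrib, Finset.mul_sum]
    refine Finset.sum_congr rfl fun i _ => ?_
    simp only [ht]
    cases v i
    · simp [sgn]; field_simp; ring
    · simp [sgn]; field_simp
  have herr : ∀ v, ∫ u, ∑ y, treeDensity (P.stepProb (w v) val u) T y * G v (u, y) ∂P.seed ≤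
      P.error (f v) (O v) := by
    intro v
    rw [← P.integral_law_eq (hw0 v) (hw1 v) val T (hGm v) (hGb v)]
    have hMk : ∀ n, IsMarkovKernel (O v n) := fun n => by simp only [hO]; infer_instance
    have hGi : Integrable (G v) (P.law (O v) T) :=
      .of_bound (hGm v).aestronglyMeasurable _ (ae_of_all _ (hGb v))
    refine integral_mono hGi ?_ fun z => ?_
    · have : (fun z => f v (P.output z) - ⨅ x : cube d a, f v x) =
          fun z => G v z - (κ * a * d + ⨅ x : cube d a, f v x) := by
        funext z; simp only [hG]; ring
      rw [this]
      exact hGi.sub (integrable_const _)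
    · have := hinf v
      simp only [hG]
      linarith
  have hsum : ∑ v : Fin d → Bool, κ * a * d / 4 ≤ ∑ v, P.error (f v) (O v) := by
    have hseed := P.isProbabilityMeasure_seed
    refine le_trans ?_ (Finset.sum_le_sum fun v _ => herr v)
    rw [← integral_finsetSum]
    · have hpt : ∀ u, ∑ v : Fin d → Bool, κ * a * d / 4 ≤
          ∑ v, ∑ y, treeDensity (P.stepProb (w v) val u) T y * G v (u, y) := by
        intro u
        -- For a fixed seed and history the chosen channel is a fixed stochastic matrix, so `hJ`
        -- applies at every node.
        have h := le_sum_loss (k := fun v => P.stepProb (w v) val u)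
          (fun v n y b => P.stepProb_nonneg (hw0 v) val u n y b)
          (fun v n y => P.sum_stepProb (hw1 v) val u n y)
          (fun v n y => hJ (fun ω b => (P.channel n ((u, y), val ω)).real {b})
            (fun _ _ => measureReal_nonneg) (fun ω => P.sum_channel_real n _) v)
          hTJ (ht0 u) (ht1 u)
        have e : ∀ v y, treeDensity (P.stepProb (w v) val u) T y * G v (u, y) =
            2 * a * κ * (treeDensity (P.stepProb (w v) val u) T y *
              ∑ i, if v i then t u i y else 1 - t u i y) := fun v y => by
          rw [hGt]; ring
        simp only [e, ← Finset.mul_sum]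
        calc ∑ v : Fin d → Bool, κ * a * d / 4 = 2 * a * κ * (2 ^ d * (d / 8 : ℝ)) := by
              simp; ring
          _ ≤ _ := by gcongr
      calc ∑ v : Fin d → Bool, κ * a * d / 4
          = ∫ _u, ∑ v : Fin d → Bool, κ * a * d / 4 ∂P.seed := by simp
        _ ≤ _ := by
          refine integral_mono (integrable_const _) ?_ hpt
          refine integrable_finsetSum _ fun v _ => integrable_finsetSum _ fun y _ => ?_
          refine .of_bound ((P.measurable_treeDensity (w v) val T y).mul
            ((hGm v).comp measurable_prodMk_right)).aestronglyMeasurable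
            (1 * (d * (κ * a) + κ * a * d)) (ae_of_all _ fun u => ?_)
          rw [norm_mul]
          refine mul_le_mul ?_ (hGb v _) (norm_nonneg _) zero_le_one
          rw [Real.norm_of_nonneg (treeDensity_nonneg (P.stepProb_nonneg (hw0 v) val u) T y)]
          exact treeDensity_le_one (P.stepProb_nonneg (hw0 v) val u)
            (P.sum_stepProb (hw1 v) val u) T y
    · intro v _
      refine integrable_finsetSum _ fun y _ => ?_
      refine .of_bound ((P.measurable_treeDensity (w v) val T y).mul
        ((hGm v).comp measurable_prodMk_right)).aestronglyMeasurable
        (1 * (d * (κ * a) + κ * a * d)) (ae_of_all _ fun u => ?_)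
      rw [norm_mul]
      refine mul_le_mul ?_ (hGb v _) (norm_nonneg _) zero_le_one
      rw [Real.norm_of_nonneg (treeDensity_nonneg (P.stepProb_nonneg (hw0 v) val u) T y)]
      exact treeDensity_le_one (P.stepProb_nonneg (hw0 v) val u)
        (P.sum_stepProb (hw1 v) val u) T y
  obtain ⟨v, -, hv⟩ := Finset.exists_le_of_sum_le Finset.univ_nonempty hsum
  exact le_iSup₂_of_le (f v, O v) (hfam v) (EReal.coe_le_coe_iff.2 hv)

end CommOpt

namespace CommOpt

variable {d : ℕ} {p : ℝ≥0∞}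

theorem one_add_mul_sgn_mul_sgn_bounds {δ : ℝ} (hδ0 : 0 ≤ δ) (hδ : δ ≤ 1 / 2) (b s : Bool) :
    1 / 2 ≤ 1 + δ * sgn b * sgn s := by
  cases b <;> cases s <;> simp [sgn] <;> linarith

theorem sum_one_add_mul_sgn (δ : ℝ) (b : Bool) : ∑ s, (1 + δ * sgn b * sgn s) / 2 = 1 := by
  simp [sgn]; ring

theorem sum_one_add_mul_sgn_mul_sgn (δ : ℝ) (b : Bool) :
    ∑ s, (1 + δ * sgn b * sgn s) / 2 * sgn s = δ * sgn b := by
  simp [sgn]; ring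

/-! ### The oracle that returns one random coordinate -/

section SingleCoordinate

/-- The probabilities of the random coordinate and sign. -/
noncomputable def singleProb (δ : ℝ) (v : Fin d → Bool) (ω : Fin d × Bool) : ℝ :=
  (1 + δ * sgn (v ω.1) * sgn ω.2) / 2 / d

theorem singleProb_nonneg {δ : ℝ} (hδ0 : 0 ≤ δ) (hδ : δ ≤ 1 / 2) (v : Fin d → Bool)
    (ω : Fin d × Bool) : 0 ≤ singleProb δ v ω := by
  have := one_add_mul_sgn_mul_sgn_bounds hδ0 hδ (v ω.1) ω.2
  unfold singleProb
  exact div_nonneg (by linarith) (Nat.cast_nonneg d)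

theorem sum_singleProb (hd : 1 ≤ d) (δ : ℝ) (v : Fin d → Bool) : ∑ ω, singleProb δ v ω = 1 := by
  have hd0 : (d : ℝ) ≠ 0 := by positivity
  simp only [singleProb]
  rw [Fintype.sum_prod_type]
  simp only [← Finset.sum_div]
  simp only [Finset.sum_div, sum_one_add_mul_sgn]
  simp [hd0]

theorem sum_singleProb_mul (δ B : ℝ) (v : Fin d → Bool) (i : Fin d) :
    ∑ ω, singleProb δ v ω * (Pi.single ω.1 (B * sgn ω.2) : Fin d → ℝ) i = B * δ / d * sgn (v i) := by
  rw [Fintype.sum_prod_type, Finset.sum_eq_single i]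
  · simp only [singleProb, Pi.single_eq_same]
    calc ∑ s, (1 + δ * sgn (v i) * sgn s) / 2 / d * (B * sgn s)
        = ∑ s, B / d * ((1 + δ * sgn (v i) * sgn s) / 2 * sgn s) :=
          Finset.sum_congr rfl fun s _ => by ring
      _ = _ := by rw [← Finset.mul_sum, sum_one_add_mul_sgn_mul_sgn]; ring
  · intro j _ hj
    exact Finset.sum_eq_zero fun s _ => by simp [Pi.single_eq_of_ne (Ne.symm hj)]
  · simp

/-- Flipping `v i` affects only the two outcomes with coordinate `i`. For each output `b` the
squared changes of its probability sum to at most `(δ/d)² ∑ W`, whereas the probability itself is at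
least `∑ W / (4d)`. Each output thus contributes at most `4δ²/d`, whence the factor `Fintype.card
𝒴`. -/
theorem sum_sqrt_singleProb_le {𝒴 : Type} [Fintype 𝒴] (hd : 1 ≤ d) {δ : ℝ} (hδ0 : 0 ≤ δ)
    (hδ : δ ≤ 1 / 2) {W : Fin d × Bool → 𝒴 → ℝ} (hW0 : ∀ ω b, 0 ≤ W ω b)
    (hW1 : ∀ ω, ∑ b, W ω b = 1) (v : Fin d → Bool) :
    ∑ i, ∑ b, (√(∑ ω, singleProb δ v ω * W ω b) - √(∑ ω, singleProb δ (flip v i) ω * W ω b)) ^ 2 ≤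
      4 * δ ^ 2 / d * Fintype.card 𝒴 := by
  have hd0 : (0 : ℝ) < d := by exact_mod_cast hd
  have hWle : ∀ ω b, W ω b ≤ 1 := fun ω b => by
    rw [← hW1 ω]
    exact Finset.single_le_sum (fun b _ => hW0 ω b) (Finset.mem_univ b)
  have key : ∀ b, ∑ i, (√(∑ ω, singleProb δ v ω * W ω b) -
      √(∑ ω, singleProb δ (flip v i) ω * W ω b)) ^ 2 ≤ 4 * δ ^ 2 / d := by
    intro b
    refine sum_sqrt_sub_sq_le
      (Finset.sum_nonneg fun ω _ => mul_nonneg (singleProb_nonneg hδ0 hδ v ω) (hW0 ω b))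
      (fun i => Finset.sum_nonneg fun ω _ => mul_nonneg (singleProb_nonneg hδ0 hδ _ ω) (hW0 ω b))
      (by positivity) ?_
    have hdiff : ∀ i, ∑ ω, singleProb δ (flip v i) ω * W ω b - ∑ ω, singleProb δ v ω * W ω b =
        δ / d * sgn (v i) * (W (i, false) b - W (i, true) b) := by
      intro i
      rw [← Finset.sum_sub_distrib, Fintype.sum_prod_type, Finset.sum_eq_single i]
      · simp only [Fintype.sum_bool, singleProb, flip_self, sgn_not, show sgn true = 1 from rfl,
          show sgn false = -1 from rfl]
        ring
      · intro j _ hj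
        exact Finset.sum_eq_zero fun s _ => by simp [singleProb, flip_of_ne hj]
      · simp
    simp only [hdiff]
    have h1 : ∀ i, (δ / d * sgn (v i) * (W (i, false) b - W (i, true) b)) ^ 2 ≤
        (δ / d) ^ 2 * (W (i, false) b + W (i, true) b) := by
      intro i
      have e : sgn (v i) ^ 2 = 1 := by rw [sq, sgn_mul_self]
      rw [mul_pow, mul_pow, e, mul_one]
      gcongr
      nlinarith [hW0 (i, false) b, hW0 (i, true) b, hWle (i, false) b, hWle (i, true) b,
        mul_nonneg (hW0 (i, false) b) (hW0 (i, true) b)]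
    have h2 : 1 / (4 * d) * ∑ i, (W (i, false) b + W (i, true) b) ≤
        ∑ ω, singleProb δ v ω * W ω b := by
      rw [Fintype.sum_prod_type, Finset.mul_sum]
      refine Finset.sum_le_sum fun i _ => ?_
      have h3 : ∀ s, 1 / (4 * d) * W (i, s) b ≤ singleProb δ v (i, s) * W (i, s) b := fun s => by
        have := one_add_mul_sgn_mul_sgn_bounds hδ0 hδ (v i) s
        refine mul_le_mul_of_nonneg_right ?_ (hW0 _ _)
        unfold singleProb
        rw [div_div, div_le_div_iff₀ (by positivity) (by positivity)]
        nlinarith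
      have := h3 true
      have := h3 false
      simp only [Fintype.sum_bool]
      linarith
    calc ∑ i, (δ / d * sgn (v i) * (W (i, false) b - W (i, true) b)) ^ 2
        ≤ (δ / d) ^ 2 * ∑ i, (W (i, false) b + W (i, true) b) := by
          rw [Finset.mul_sum]
          exact Finset.sum_le_sum fun i _ => h1 i
      _ = 4 * δ ^ 2 / d * (1 / (4 * d) * ∑ i, (W (i, false) b + W (i, true) b)) := by
          field_simp
      _ ≤ _ := by gcongr
  rw [Finset.sum_comm]
  refine (Finset.sum_le_sum fun b _ => key b).trans (le_of_eq ?_)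
  simp only [Finset.sum_const, Finset.card_univ, nsmul_eq_mul]
  ring

end SingleCoordinate

/-! ### The oracle with independent coordinates -/

section Independent

theorem sum_prod_eq {g : Fin d → Bool → ℝ} :
    ∑ ω : Fin d → Bool, ∏ j, g j (ω j) = ∏ j, ∑ s, g j s := by
  rw [Finset.prod_univ_sum, Fintype.piFinset_univ]

theorem sum_prod_mul_apply {g : Fin d → Bool → ℝ} (hg : ∀ j, ∑ s, g j s = 1) (h : Bool → ℝ)
    (i : Fin d) : ∑ ω : Fin d → Bool, (∏ j, g j (ω j)) * h (ω i) = ∑ s, g i s * h s := by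
  have h1 : ∀ ω : Fin d → Bool, (∏ j, g j (ω j)) * h (ω i) =
      ∏ j, (g j (ω j) * if j = i then h (ω j) else 1) := fun ω => by
    rw [Finset.prod_mul_distrib]
    simp
  simp only [h1]
  rw [sum_prod_eq (g := fun j s => g j s * if j = i then h s else 1), Finset.prod_eq_single i]
  · simp
  · intro j _ hj
    simp only [if_neg hj, mul_one, hg]
  · simp

/-- The probabilities of the random sign vector. -/
noncomputable def signProb (δ : ℝ) (v ω : Fin d → Bool) : ℝ :=
  ∏ j, (1 + δ * sgn (v j) * sgn (ω j)) / 2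

theorem signProb_pos {δ : ℝ} (hδ0 : 0 ≤ δ) (hδ : δ ≤ 1 / 2) (v ω : Fin d → Bool) :
    0 < signProb δ v ω :=
  Finset.prod_pos fun j _ => by
    have := one_add_mul_sgn_mul_sgn_bounds hδ0 hδ (v j) (ω j)
    linarith

theorem sum_signProb (δ : ℝ) (v : Fin d → Bool) : ∑ ω, signProb δ v ω = 1 := by
  simp only [signProb]
  rw [sum_prod_eq (g := fun j s => (1 + δ * sgn (v j) * sgn s) / 2)]
  simp only [sum_one_add_mul_sgn, Finset.prod_const_one]

theorem sum_signProb_mul (δ c : ℝ) (v : Fin d → Bool) (i : Fin d) :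
    ∑ ω, signProb δ v ω * (c * sgn (ω i)) = c * δ * sgn (v i) := by
  simp only [signProb]
  rw [sum_prod_mul_apply (g := fun j s => (1 + δ * sgn (v j) * sgn s) / 2)
    (fun j => sum_one_add_mul_sgn _ _) (fun s => c * sgn s)]
  calc ∑ s, (1 + δ * sgn (v i) * sgn s) / 2 * (c * sgn s)
      = ∑ s, c * ((1 + δ * sgn (v i) * sgn s) / 2 * sgn s) :=
        Finset.sum_congr rfl fun s _ => by ring
    _ = _ := by rw [← Finset.mul_sum, sum_one_add_mul_sgn_mul_sgn]; ring

/-- The relative change of the probability of the sign `s` when the bias `b` is flipped. -/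
noncomputable def relChange (δ : ℝ) (b s : Bool) : ℝ :=
  -(2 * δ * sgn b * sgn s) / (1 + δ * sgn b * sgn s)

theorem relChange_sq_le {δ : ℝ} (hδ0 : 0 ≤ δ) (hδ : δ ≤ 1 / 2) (b s : Bool) :
    relChange δ b s ^ 2 ≤ 16 * δ ^ 2 := by
  have h := one_add_mul_sgn_mul_sgn_bounds hδ0 hδ b s
  set x := 1 + δ * sgn b * sgn s
  have e : (2 * δ * sgn b * sgn s) ^ 2 = 4 * δ ^ 2 := by
    have h1 := sgn_mul_self b
    have h2 := sgn_mul_self s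
    calc (2 * δ * sgn b * sgn s) ^ 2 = 4 * δ ^ 2 * (sgn b * sgn b) * (sgn s * sgn s) := by ring
      _ = _ := by rw [h1, h2]; ring
  rw [relChange, div_pow, neg_sq, e, div_le_iff₀ (by positivity)]
  have : 1 ≤ 4 * x ^ 2 := by nlinarith
  nlinarith [sq_nonneg δ]

/-- The relative change has mean zero, since both biased laws have total mass 1, and its square is
at most `16δ²`; `exp_le_add_exp_sq` does the rest. -/
theorem sum_mul_exp_relChange_le {δ : ℝ} (hδ0 : 0 ≤ δ) (hδ : δ ≤ 1 / 2) (b : Bool) (c : ℝ) :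
    ∑ s, (1 + δ * sgn b * sgn s) / 2 * Real.exp (c * relChange δ b s) ≤
      Real.exp (16 * δ ^ 2 * c ^ 2) := by
  have hpos := one_add_mul_sgn_mul_sgn_bounds hδ0 hδ b
  have h1 : ∀ s, (1 + δ * sgn b * sgn s) / 2 * Real.exp (c * relChange δ b s) ≤
      -(c * δ * sgn b) * sgn s +
        (1 + δ * sgn b * sgn s) / 2 * Real.exp (16 * δ ^ 2 * c ^ 2) := by
    intro s
    have hs := hpos s
    have e1 : (1 + δ * sgn b * sgn s) / 2 * (c * relChange δ b s) = -(c * δ * sgn b) * sgn s := by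
      unfold relChange
      have : 1 + δ * sgn b * sgn s ≠ 0 := by linarith
      field_simp
    rw [← e1, ← mul_add]
    refine mul_le_mul_of_nonneg_left ((exp_le_add_exp_sq _).trans ?_) (by linarith)
    gcongr
    have := relChange_sq_le hδ0 hδ b s
    rw [mul_pow]
    nlinarith [sq_nonneg c]
  refine (Finset.sum_le_sum fun s _ => h1 s).trans (le_of_eq ?_)
  rw [Finset.sum_add_distrib, ← Finset.mul_sum, ← Finset.sum_mul, sum_one_add_mul_sgn]
  simp [sgn]

theorem signProb_flip {δ : ℝ} (hδ0 : 0 ≤ δ) (hδ : δ ≤ 1 / 2) (v ω : Fin d → Bool) (i : Fin d) :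
    signProb δ (flip v i) ω = signProb δ v ω * (1 + relChange δ (v i) (ω i)) := by
  simp only [signProb]
  rw [← Finset.mul_prod_erase _ _ (Finset.mem_univ i),
    ← Finset.mul_prod_erase _ (fun j => (1 + δ * sgn (v j) * sgn (ω j)) / 2) (Finset.mem_univ i)]
  have h1 : ∏ j ∈ Finset.univ.erase i, (1 + δ * sgn (flip v i j) * sgn (ω j)) / 2 =
      ∏ j ∈ Finset.univ.erase i, (1 + δ * sgn (v j) * sgn (ω j)) / 2 :=
    Finset.prod_congr rfl fun j hj => by rw [flip_of_ne (Finset.ne_of_mem_erase hj)]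
  have h2 : (1 + δ * sgn (flip v i i) * sgn (ω i)) / 2 =
      (1 + δ * sgn (v i) * sgn (ω i)) / 2 * (1 + relChange δ (v i) (ω i)) := by
    have := one_add_mul_sgn_mul_sgn_bounds hδ0 hδ (v i) (ω i)
    have h3 : 1 + δ * sgn (v i) * sgn (ω i) ≠ 0 := by linarith
    rw [flip_self, sgn_not, relChange]
    field_simp
    ring
  rw [h1, h2]
  ring

/-- The change of the probability `κ b` under a flip of `v i` is the correlation of `W · b` with the
centred variable `relChange`. These variables are independent and subgaussian, so the level-one
inequality bounds the sum of squares by `64δ² κ² log (1/κ)`. Dividing by `κ` and summing over `b`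
produces the entropy of the output. -/
theorem sum_sqrt_signProb_le {𝒴 : Type} [Fintype 𝒴] [Nonempty 𝒴] {δ : ℝ} (hδ0 : 0 < δ)
    (hδ : δ ≤ 1 / 2) {W : (Fin d → Bool) → 𝒴 → ℝ} (hW0 : ∀ ω b, 0 ≤ W ω b)
    (hW1 : ∀ ω, ∑ b, W ω b = 1) (v : Fin d → Bool) :
    ∑ i, ∑ b, (√(∑ ω, signProb δ v ω * W ω b) - √(∑ ω, signProb δ (flip v i) ω * W ω b)) ^ 2 ≤
      64 * δ ^ 2 * Real.log (Fintype.card 𝒴) := by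
  have hw0 : ∀ v ω : Fin d → Bool, 0 ≤ signProb δ v ω := fun v ω => (signProb_pos hδ0.le hδ v ω).le
  have hWle : ∀ ω b, W ω b ≤ 1 := fun ω b => by
    rw [← hW1 ω]
    exact Finset.single_le_sum (fun b _ => hW0 ω b) (Finset.mem_univ b)
  set κ : 𝒴 → ℝ := fun b => ∑ ω, signProb δ v ω * W ω b with hκ
  have hκ0 : ∀ b, 0 ≤ κ b := fun b =>
    Finset.sum_nonneg fun ω _ => mul_nonneg (hw0 v ω) (hW0 ω b)
  have hκ1 : ∑ b, κ b = 1 := by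
    simp only [hκ]
    rw [Finset.sum_comm]
    simp only [← Finset.mul_sum, hW1, mul_one, sum_signProb]
  have hκle : ∀ b, κ b ≤ 1 := fun b => by
    rw [← hκ1]
    exact Finset.single_le_sum (fun b _ => hκ0 b) (Finset.mem_univ b)
  have hmgf : ∀ c : Fin d → ℝ, ∑ ω, signProb δ v ω *
      Real.exp (∑ i, c i * relChange δ (v i) (ω i)) ≤ Real.exp (16 * δ ^ 2 * ∑ i, c i ^ 2) := by
    intro c
    have e : ∀ ω, signProb δ v ω * Real.exp (∑ i, c i * relChange δ (v i) (ω i)) =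
        ∏ j, ((1 + δ * sgn (v j) * sgn (ω j)) / 2 * Real.exp (c j * relChange δ (v j) (ω j))) :=
      fun ω => by rw [Real.exp_sum, signProb, ← Finset.prod_mul_distrib]
    simp only [e]
    rw [sum_prod_eq (g := fun j s => (1 + δ * sgn (v j) * sgn s) / 2 *
      Real.exp (c j * relChange δ (v j) s)), Finset.mul_sum, Real.exp_sum]
    refine Finset.prod_le_prod (fun j _ => Finset.sum_nonneg fun s _ => ?_)
      fun j _ => sum_mul_exp_relChange_le hδ0.le hδ _ _
    have := one_add_mul_sgn_mul_sgn_bounds hδ0.le hδ (v j) s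
    exact mul_nonneg (by linarith) (Real.exp_pos _).le
  have key : ∀ b, ∑ i, (√(κ b) - √(∑ ω, signProb δ (flip v i) ω * W ω b)) ^ 2 ≤
      64 * δ ^ 2 * (κ b * -Real.log (κ b)) := by
    intro b
    have hlog : 0 ≤ -Real.log (κ b) := neg_nonneg.2 (Real.log_nonpos (hκ0 b) (hκle b))
    refine sum_sqrt_sub_sq_le (hκ0 b)
      (fun i => Finset.sum_nonneg fun ω _ => mul_nonneg (hw0 _ ω) (hW0 ω b))
      (mul_nonneg (by positivity) (mul_nonneg (hκ0 b) hlog)) ?_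
    have hdiff : ∀ i, ∑ ω, signProb δ (flip v i) ω * W ω b - κ b =
        ∑ ω, signProb δ v ω * W ω b * relChange δ (v i) (ω i) := by
      intro i
      simp only [hκ, ← Finset.sum_sub_distrib]
      refine Finset.sum_congr rfl fun ω _ => ?_
      rw [signProb_flip hδ0.le hδ]
      ring
    simp only [hdiff]
    rcases (hκ0 b).eq_or_lt with h0 | h0
    · have hz := (Finset.sum_eq_zero_iff_of_nonneg fun ω _ =>
        mul_nonneg (hw0 v ω) (hW0 ω b)).1 h0.symm
      rw [← h0]
      simp only [hz _ (Finset.mem_univ _)]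
      simp
    · have := sum_sq_le_log (hw0 v) (fun ω => hW0 ω b) (fun ω => hWle ω b)
        (φ := fun i ω => relChange δ (v i) (ω i)) (τ := 16 * δ ^ 2) (by positivity) hmgf h0
      refine this.trans (le_of_eq ?_)
      change 4 * (16 * δ ^ 2) * κ b ^ 2 * -Real.log (κ b) = _
      ring
  rw [Finset.sum_comm]
  refine (Finset.sum_le_sum fun b _ => key b).trans ?_
  rw [← Finset.mul_sum]
  gcongr
  exact sum_negMulLog_le hκ0 hκ1

end Independent

/-! ### Lower bounds on the worst-case error -/

theorem le_worstError_of_sq_le {D B : ℝ} {T r : ℕ} (hp : 1 ≤ p) (hd : 1 ≤ d) (hT : 1 ≤ T)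
    (hD : 0 < D) (hB : 0 < B) (hr : 1 ≤ r) (hdT : (d : ℝ) ^ 2 / 8 ≤ T) :
    ((D * B * (d : ℝ) ^ (1 - recip p) / (100 * √(2 ^ r) * √T) : ℝ) : EReal) ≤
      worstError p D B T (comChannels d r) := by
  have hd0 : (0 : ℝ) < d := by exact_mod_cast hd
  have hT0 : (0 : ℝ) < T := by exact_mod_cast hT
  have hr2 : (2 : ℝ) ≤ 2 ^ r := le_self_pow₀ (by norm_num) (by omega)
  -- This makes `T * J = d / 16`; the assumption `d² / 8 ≤ T` keeps `δ ≤ 1/2`.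
  set δ := (d : ℝ) / (8 * √(2 ^ r) * √T) with hδdef
  have hδ0 : 0 < δ := by positivity
  have hδsq : δ ^ 2 = d ^ 2 / (64 * 2 ^ r * T) := by
    rw [hδdef, div_pow, mul_pow, mul_pow, Real.sq_sqrt (by positivity), Real.sq_sqrt hT0.le]
    norm_num
  have hδ : δ ≤ 1 / 2 := by
    refine le_of_sq_le_sq ?_ (by norm_num)
    rw [hδsq, div_le_iff₀ (by positivity)]
    have : (T : ℝ) * 2 ≤ T * 2 ^ r := by gcongr
    linarith
  refine le_iSup₂_of_le (cube d (D / (2 * (d : ℝ) ^ recip p))) (cube_mem_domains hp hd hD) ?_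
  refine le_trans (EReal.coe_le_coe_iff.2 ?_) (le_minmaxError_cube (p := p) (𝒴 := Fin r → Bool)
    (B := B) (a := D / (2 * (d : ℝ) ^ recip p)) (κ := B * δ / d)
    (J := 4 * δ ^ 2 / d * Fintype.card (Fin r → Bool)) (w := singleProb δ)
    (val := fun ω => Pi.single ω.1 (B * sgn ω.2)) (by positivity) (by positivity)
    (singleProb_nonneg hδ0.le hδ) (sum_singleProb hd δ) (fun ω => ?_) (sum_singleProb_mul δ B)
    (fun W hW0 hW1 v => sum_sqrt_singleProb_le hd hδ0.le hδ hW0 hW1 v) (T := T) ?_ _)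
  · have e : B * δ / d * (D / (2 * (d : ℝ) ^ recip p)) * d / 4 =
        D * B * (d : ℝ) ^ (1 - recip p) / (64 * √(2 ^ r) * √T) := by
      rw [hδdef, Real.rpow_sub hd0, Real.rpow_one]
      field_simp
      norm_num
    rw [e]
    gcongr
    norm_num
  · rw [lpNorm_single (one_le_holderConj p), abs_mul, abs_sgn, mul_one, abs_of_pos hB]
  · rw [hδsq]
    have : ((Fintype.card (Fin r → Bool) : ℕ) : ℝ) = 2 ^ r := by simp
    rw [this]
    have e : (T : ℝ) * (4 * ((d : ℝ) ^ 2 / (64 * 2 ^ r * T)) / d * 2 ^ r) = d / 16 := by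
      field_simp
      norm_num
    rw [e]
    linarith

theorem le_worstError {D B : ℝ} {T r : ℕ} (hp : 1 ≤ p) (hd : 1 ≤ d) (hT : 1 ≤ T) (hD : 0 < D)
    (hB : 0 < B) (hr : 1 ≤ r) (hdT : (d : ℝ) / 8 ≤ T) :
    ((D * B * √d / (100 * √r * √T) : ℝ) : EReal) ≤ worstError p D B T (comChannels d r) := by
  have hd0 : (0 : ℝ) < d := by exact_mod_cast hd
  have hT0 : (0 : ℝ) < T := by exact_mod_cast hT
  have hr1 : (1 : ℝ) ≤ r := by exact_mod_cast hr
  -- With `ln (2 ^ r) ≤ r` this gives `T * J ≤ 64/144 * d ≤ d / 2`, and `d / 8 ≤ T` keeps `δ ≤ 1/2`.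
  set δ := √d / (12 * √r * √T) with hδdef
  have hδ0 : 0 < δ := by positivity
  have hδsq : δ ^ 2 = d / (144 * r * T) := by
    rw [hδdef, div_pow, mul_pow, mul_pow, Real.sq_sqrt hd0.le, Real.sq_sqrt (by positivity),
      Real.sq_sqrt hT0.le]
    norm_num
  have hδ : δ ≤ 1 / 2 := by
    refine le_of_sq_le_sq ?_ (by norm_num)
    rw [hδsq, div_le_iff₀ (by positivity)]
    have : (T : ℝ) * 1 ≤ T * r := by gcongr
    linarith
  set c := B * (d : ℝ) ^ (-recip (holderConj p)) with hc
  refine le_iSup₂_of_le (cube d (D / (2 * (d : ℝ) ^ recip p))) (cube_mem_domains hp hd hD) ?_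
  refine le_trans (EReal.coe_le_coe_iff.2 ?_) (le_minmaxError_cube (p := p) (𝒴 := Fin r → Bool)
    (B := B) (a := D / (2 * (d : ℝ) ^ recip p)) (κ := c * δ)
    (J := 64 * δ ^ 2 * Real.log (Fintype.card (Fin r → Bool))) (w := signProb δ)
    (val := fun ω i => c * sgn (ω i)) (by positivity) (by positivity)
    (fun v ω => (signProb_pos hδ0.le hδ v ω).le) (sum_signProb δ) (fun ω => ?_)
    (sum_signProb_mul δ c) (fun W hW0 hW1 v => sum_sqrt_signProb_le hδ0 hδ hW0 hW1 v) (T := T) ?_ _)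
  · have h1 : (d : ℝ) = (d : ℝ) ^ recip p * (d : ℝ) ^ recip (holderConj p) := by
      rw [← Real.rpow_add hd0, recip_add_recip_holderConj hp, Real.rpow_one]
    have e : c * δ * (D / (2 * (d : ℝ) ^ recip p)) * d / 4 = D * B * √d / (96 * √r * √T) := by
      have h2 : c * δ * (D / (2 * (d : ℝ) ^ recip p)) * d / 4 =
          B * δ * D / 8 * (d / ((d : ℝ) ^ recip p * (d : ℝ) ^ recip (holderConj p))) := by
        rw [hc, Real.rpow_neg hd0.le]
        field_simp
        norm_num
      rw [h2, ← h1, div_self hd0.ne', hδdef]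
      field_simp
      norm_num
    rw [e]
    gcongr
    norm_num
  · refine (lpNorm_le_of_abs_le (one_le_holderConj p) (c := c) (by positivity) fun i => ?_).trans
      (le_of_eq ?_)
    · rw [abs_mul, abs_sgn, mul_one, abs_of_pos (by positivity)]
    · rw [hc, Real.rpow_neg hd0.le]
      field_simp
  · have hcard : Real.log (Fintype.card (Fin r → Bool)) ≤ r := by
      have : ((Fintype.card (Fin r → Bool) : ℕ) : ℝ) = 2 ^ r := by simp
      rw [this, Real.log_pow]
      have := Real.log_two_lt_d9
      nlinarith
    calc (T : ℝ) * (64 * δ ^ 2 * Real.log (Fintype.card (Fin r → Bool)))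
        ≤ T * (64 * δ ^ 2 * r) := by gcongr
      _ = 64 / 144 * (d : ℝ) := by rw [hδsq]; field_simp
      _ ≤ (d : ℝ) / 2 := by linarith

end CommOpt

/-! ### Bounds on the minimum precision. -/

namespace CommOpt

theorem le_minPrecision {c₁ : ℝ} {d T : ℕ} {p : ℝ≥0∞} {D B b : ℝ}
    (h : ∀ r : ℕ, 1 ≤ r →
      worstError p D B T (comChannels d r) ≤ ((4 * c₁ * classicRate d T p D B : ℝ) : EReal) → b ≤ r) :
    (b : EReal) ≤ minPrecision c₁ d T p D B :=
  le_iInf₂ fun r hr => EReal.coe_le_coe_iff.2 (h r hr.1 hr.2)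

variable {d T : ℕ} {p : ℝ≥0∞} {D B c₁ : ℝ}

theorem minPrecision_le_of_two_lt (hp : 2 < p) (hd : 1 ≤ d) (hT : 1 ≤ T) (hD : 0 < D) (hB : 0 < B)
    (hc : 3 ≤ c₁) :
    minPrecision c₁ d T p D B ≤ (((d : ℝ) ^ (2 * recip p) *
      Real.logb 2 (2 * Real.exp 1 * (d : ℝ) ^ (1 - 2 * recip p) + 2 * Real.exp 1) : ℝ) : EReal) := by
  have hd1 : (1 : ℝ) ≤ d := by exact_mod_cast hd
  have hp1 : 1 ≤ p := one_le_two.trans hp.le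
  have hr : 2 * recip p ≤ 1 := by
    have := recip_le_recip one_le_two hp.le
    rw [recip_two] at this
    linarith
  obtain ⟨r, hr1, hr2, hr3⟩ := exists_bits hd (K := (d : ℝ) ^ (2 * recip p))
    (Real.one_le_rpow hd1 (by have := recip_nonneg p; positivity))
    (by simpa using Real.rpow_le_rpow_of_exponent_le hd1 hr)
  refine minPrecision_le hr1 ((worstError_comChannels_le_of_two_le hp.le hd hT hD hB hr2).trans
    (EReal.coe_le_coe_iff.2 ?_)) ?_
  · have := classicRate_nonneg d T p hD hB
    gcongr
    linarith
  · rwa [Real.rpow_sub (by linarith), Real.rpow_one]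

/-- The `3d`-bit quantizer suffices, so the logarithmic terms of the stated bound, here arbitrary
natural numbers `m` and `n`, are pure slack. -/
theorem minPrecision_le_of_le_two (hp1 : 1 ≤ p) (hp : p ≤ 2) (hd : 2 ≤ d) (hT : 1 ≤ T) (hD : 0 < D)
    (hB : 0 < B) (hc : 3 ≤ c₁) (m n : ℕ) :
    minPrecision c₁ d T p D B ≤ (((d : ℝ) * (m + 3) + n : ℝ) : EReal) := by
  refine minPrecision_le (r := 3 * d) (by omega)
    ((worstError_comChannels_le_of_le_two hp1 hp hd hT hD hB).trans (EReal.coe_le_coe_iff.2 ?_)) ?_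
  · have := classicRate_nonneg d T p hD hB
    gcongr
    linarith
  · push_cast
    have : (0 : ℝ) ≤ d * m := by positivity
    have : (0 : ℝ) ≤ n := by positivity
    linarith

theorem sq_le_minPrecision (hp : 2 < p) (hd : 1 ≤ d) (hT : 1 ≤ T) (hD : 0 < D) (hB : 0 < B)
    (hc : 0 < c₁) (hdT : (d : ℝ) ^ 2 / 8 ≤ T) :
    (((1 / 100 / (4 * c₁) * (d : ℝ) ^ recip p) ^ 2 : ℝ) : EReal) ≤ minPrecision c₁ d T p D B := by
  refine le_minPrecision fun r hr h => ?_
  have hd1 : (1 : ℝ) ≤ d := by exact_mod_cast hd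
  have hd0 : (0 : ℝ) < d := by linarith
  have hT0 : (0 : ℝ) < T := by exact_mod_cast hT
  have hr0 : (0 : ℝ) < r := by exact_mod_cast hr
  have h1 := EReal.coe_le_coe_iff.1
    ((le_worstError (one_le_two.trans hp.le) hd hT hD hB hr (by nlinarith)).trans h)
  rw [classicRate, if_pos hp.le, Real.rpow_sub hd0, ← Real.sqrt_eq_rpow,
    div_le_iff₀ (by positivity)] at h1
  set s := (d : ℝ) ^ recip p
  have hs : 0 < s := by positivity
  have e : 4 * c₁ * (√d / s * D * B / √T) * (100 * √r * √T) =
      D * B * √d * (400 * c₁ * √r / s) := by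
    field_simp
    norm_num
  rw [e] at h1
  have h2 : 1 ≤ 400 * c₁ * √r / s :=
    le_of_mul_le_mul_left (by rwa [mul_one]) (show 0 < D * B * √d by positivity)
  rw [le_div_iff₀ hs, one_mul] at h2
  have h3 : 1 / 100 / (4 * c₁) * s ≤ √r := by
    calc 1 / 100 / (4 * c₁) * s ≤ 1 / 100 / (4 * c₁) * (400 * c₁ * √r) := by gcongr
      _ = √r := by field_simp; norm_num
  calc (1 / 100 / (4 * c₁) * s) ^ 2 ≤ √r ^ 2 := by gcongr
    _ = (r : ℝ) := Real.sq_sqrt hr0.le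

theorem two_mul_logb_le_minPrecision (hp : 2 < p) (hd : 1 ≤ d) (hT : 1 ≤ T) (hD : 0 < D)
    (hB : 0 < B) (hc : 0 < c₁) (hdT : (d : ℝ) ^ 2 / 8 ≤ T) :
    ((2 * Real.logb 2 (1 / 100 / (4 * c₁) * (d : ℝ) ^ (1 / 2 : ℝ)) : ℝ) : EReal) ≤
      minPrecision c₁ d T p D B := by
  refine le_minPrecision fun r hr h => ?_
  have hd0 : (0 : ℝ) < d := by exact_mod_cast hd
  have hT0 : (0 : ℝ) < T := by exact_mod_cast hT
  have h1 := EReal.coe_le_coe_iff.1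
    ((le_worstError_of_sq_le (one_le_two.trans hp.le) hd hT hD hB hr hdT).trans h)
  rw [classicRate, if_pos hp.le, Real.rpow_sub hd0, Real.rpow_sub hd0, Real.rpow_one,
    ← Real.sqrt_eq_rpow, div_le_iff₀ (by positivity)] at h1
  rw [← Real.sqrt_eq_rpow]
  set s := (d : ℝ) ^ recip p
  have hs : 0 < s := by positivity
  have hdd : (d : ℝ) = √d * √d := (Real.mul_self_sqrt hd0.le).symm
  have e1 : D * B * ((d : ℝ) / s) = D * B * √d / s * √d := by
    calc D * B * ((d : ℝ) / s) = D * B * (√d * √d / s) := by rw [← hdd]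
      _ = _ := by ring
  have e2 : 4 * c₁ * (√d / s * D * B / √T) * (100 * √(2 ^ r) * √T) =
      D * B * √d / s * (400 * c₁ * √(2 ^ r)) := by
    field_simp
    norm_num
  rw [e1, e2] at h1
  have h2 : √d ≤ 400 * c₁ * √(2 ^ r) :=
    le_of_mul_le_mul_left h1 (show 0 < D * B * √d / s by positivity)
  have h3 : 1 / 100 / (4 * c₁) * √d ≤ (2 : ℝ) ^ ((r : ℝ) / 2) := by
    calc 1 / 100 / (4 * c₁) * √d ≤ 1 / 100 / (4 * c₁) * (400 * c₁ * √(2 ^ r)) := by gcongr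
      _ = √(2 ^ r) := by field_simp; norm_num
      _ = _ := by
        rw [Real.sqrt_eq_rpow, ← Real.rpow_natCast, ← Real.rpow_mul (by norm_num)]
        ring_nf
  have h4 := Real.logb_le_logb_of_le (b := 2) (by norm_num) (by positivity) h3
  rw [Real.logb_rpow (by norm_num) (by norm_num)] at h4
  linarith

theorem sq_mul_le_minPrecision (hp1 : 1 ≤ p) (hp : p ≤ 2) (hd : 2 ≤ d) (hT : 1 ≤ T) (hD : 0 < D)
    (hB : 0 < B) (hc : 0 < c₁) (hdT : (d : ℝ) / 6 ≤ T) :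
    (((1 / 100 / (4 * c₁ * √(Real.logb 2 d))) ^ 2 * d : ℝ) : EReal) ≤
      minPrecision c₁ d T p D B := by
  refine le_minPrecision fun r hr h => ?_
  have hd2 : (2 : ℝ) ≤ d := by exact_mod_cast hd
  have hd0 : (0 : ℝ) < d := by linarith
  have hT0 : (0 : ℝ) < T := by exact_mod_cast hT
  have hr0 : (0 : ℝ) < r := by exact_mod_cast hr
  have hL : 1 ≤ Real.logb 2 d := by
    rw [Real.le_logb_iff_rpow_le (by norm_num) hd0]; simpa using hd2
  -- At `p = 2` the rate has no logarithm; since `d ≥ 2` it is still below the logarithmic form.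
  have hrate : classicRate d T p D B ≤ √(Real.logb 2 d) * D * B / √T := by
    unfold classicRate
    split_ifs with h2
    · obtain rfl : p = 2 := le_antisymm hp h2
      rw [recip_two, sub_self, Real.rpow_zero]
      gcongr
      exact Real.one_le_sqrt.2 hL
    · exact le_rfl
  have h1 := EReal.coe_le_coe_iff.1
    ((le_worstError hp1 (by omega) hT hD hB hr (by linarith)).trans h)
  set l := √(Real.logb 2 d)
  have hl : 0 < l := Real.sqrt_pos.2 (by linarith)
  replace h1 := h1.trans (mul_le_mul_of_nonneg_left hrate (by positivity))
  rw [div_le_iff₀ (by positivity)] at h1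
  have e : 4 * c₁ * (l * D * B / √T) * (100 * √r * √T) = D * B * (400 * c₁ * l * √r) := by
    field_simp
    norm_num
  rw [e] at h1
  have h2 : √d ≤ 400 * c₁ * l * √r := le_of_mul_le_mul_left h1 (show 0 < D * B by positivity)
  have h3 : 1 / 100 / (4 * c₁ * l) * √d ≤ √r := by
    calc 1 / 100 / (4 * c₁ * l) * √d ≤ 1 / 100 / (4 * c₁ * l) * (400 * c₁ * l * √r) := by gcongr
      _ = √r := by field_simp; norm_num
  calc (1 / 100 / (4 * c₁ * l)) ^ 2 * d = (1 / 100 / (4 * c₁ * l) * √d) ^ 2 := by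
        rw [mul_pow, Real.sq_sqrt hd0.le]
    _ ≤ √r ^ 2 := by gcongr
    _ = (r : ℝ) := Real.sq_sqrt hr0.le

end CommOpt


theorem theoremt :
    ∃ c₀ C₁ : ℝ, 0 < c₀ ∧ c₀ ≤ C₁ ∧
      ∀ c₁ : ℝ, C₁ ≤ c₁ → ∀ (d T : ℕ) (p : ℝ≥0∞) (D B : ℝ),
        1 ≤ d → 1 ≤ T → 1 ≤ p → 0 < D → 0 < B →
        -- `c₁` is a valid constant for the classical convergence rate
        ((2 ≤ p ∨ 2 ≤ d) →
          CommOpt.worstError p D B T (CommOpt.idChannel d) ≤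
            ((c₁ * CommOpt.classicRate d T p D B : ℝ) : EReal)) ∧
        -- the case `p > 2`
        (2 < p →
          CommOpt.minPrecision c₁ d T p D B ≤
            (((d : ℝ) ^ (2 * CommOpt.recip p) *
              Real.logb 2 (2 * Real.exp 1 * (d : ℝ) ^ (1 - 2 * CommOpt.recip p) +
                2 * Real.exp 1) : ℝ) : EReal) ∧
          ((d : ℝ) ^ 2 / 8 ≤ T →
            ((max ((c₀ / (4 * c₁) * (d : ℝ) ^ CommOpt.recip p) ^ 2)
              (2 * Real.logb 2 (c₀ / (4 * c₁) * (d : ℝ) ^ (1 / 2 : ℝ))) : ℝ) : EReal) ≤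
              CommOpt.minPrecision c₁ d T p D B)) ∧
        -- the case `1 ≤ p ≤ 2`
        (p ≤ 2 → 2 ≤ d →
          CommOpt.minPrecision c₁ d T p D B ≤
            (((d : ℝ) * (⌈Real.logb 2 (2 * √2 *
                (CommOpt.Delta₁ d p : ℝ) ^ CommOpt.recip (CommOpt.holderConj p) + 2)⌉₊ + 3) +
              CommOpt.Delta₂ d : ℝ) : EReal) ∧
          ((d : ℝ) / 6 ≤ T →
            (((c₀ / (4 * c₁ * √(Real.logb 2 d))) ^ 2 * d : ℝ) : EReal) ≤
              CommOpt.minPrecision c₁ d T p D B)) := by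
  -- `1 / 100` is the constant of both error lower bounds. The identity channel with `p < 2` needs
  -- `12`; the precision upper bounds need only `4 * c₁ ≥ 12`.
  refine ⟨1 / 100, 12, by norm_num, by norm_num, fun c₁ hc d T p D B hd hT hp hD hB =>
    ⟨fun h => ?_, fun hp2 => ⟨?_, fun hdT => ?_⟩, fun hp2 hd2 => ⟨?_, fun hdT => ?_⟩⟩⟩
  · refine (CommOpt.worstError_idChannel_le hp hd hT hD hB h).trans (EReal.coe_le_coe_iff.2 ?_)
    have := CommOpt.classicRate_nonneg d T p hD hB
    gcongr
  · exact CommOpt.minPrecision_le_of_two_lt hp2 hd hT hD hB (by linarith)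
  · exact EReal.coe_strictMono.monotone.map_max.trans_le <| max_le
      (CommOpt.sq_le_minPrecision hp2 hd hT hD hB (by linarith) hdT)
      (CommOpt.two_mul_logb_le_minPrecision hp2 hd hT hD hB (by linarith) hdT)
  · exact CommOpt.minPrecision_le_of_le_two hp hp2 hd2 hT hD hB (by linarith) _ _
  · exact CommOpt.sq_mul_le_minPrecision hp hp2 hd2 hT hD hB (by linarith) hdT
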